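/- Let $k\ge 1$ be an integer and let $f:(\mathbb Z/k\mathbb Z)^2\to S$ be any function into a set $S$ (a $k$-link function); evaluate $f$ at integers by reducing them modulo $k$. Matrix indices start at $0$. For a multiple $N\ge 1$ of $k$, say that positions $(i,j)$ and $(i',j')$ of an $N\times N$ matrix are *linked* if $i-j\equiv i'-j' \pmod N$ and $f(i,j)=f(i',j')$. Let $X$ be a real random variable with mean $0$, variance $1$ and finite moments of all orders. Let $M_{f,N,X}$ be the $N\times N$ real random matrix ensemble whose entries $a_{i,j}$ are iid copies of $X$ apart from the restrictions $a_{i,j}=a_{j,i}$, and $a_{i,j}=a_{i',j'}$ whenever $(i,j)$ and $(i',j')$ are linked (so entries not identified through a chain of these restrictions are independent). Let $\tilde M_{f,k}$ (the complex companion ensemble) be the $k\times k$ Hermitian random matrix ensemble whose entries $c_{\ell,j}$ are standard Gaussians, independent apart from the restrictions $c_{\ell,j}=\overline{c_{j,\ell}}$, and $c_{\ell,j}=c_{\ell',j'}$ whenever $(\ell,j)$ and $(\ell',j')$ are linked (with $N=k$). Here $c_{\ell,j}$ is a real Gaussian $\mathcal N_{\mathbb R}(0,1)$ if these restrictions force $c_{\ell,j}=c_{j,\ell}$,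 and otherwise it is a complex Gaussian distributed as $(a+ib)/\sqrt2$ with $a,b$ iid $\mathcal N_{\mathbb R}(0,1)$. For a Hermitian $N\times N$ matrix $A$ with eigenvalues $\lambda_1,\dots,\lambda_N$ (with multiplicity), let $\nu_A=\frac1N\sum_{i=1}^N\delta_{\lambda_i/\sqrt N}$ be its empirical spectral measure. The eigenvalue distribution $\mu_M$ of a Hermitian ensemble $M$ is the law of a point drawn from $\nu_A$ where $A$ is drawn from $M$, i.e. $\mu_M=\mathbb E[\nu_A]$. Then, for $(A_N)_{N\in\{k,2k,3k,\dots\}}$ with $A_N$ drawn independently from $M_{f,N,X}$, with probability $1$ in the product measure the measures $\nu_{A_N}$ converge weakly to $\mu_{\tilde M_{f,k}}$, i.e. $\int g\,d\nu_{A_N}\to\int g\,d\mu_{\tilde M_{f,k}}$ for all bounded continuous $g:\mathbb R\to\mathbb R$. In particular, let $A_N$ be drawn independently from the $k$-block circulant ensembles, i.e. the ensembles of $N\times N$ real matrices whose entries are iid copies of $X$ apart from the restrictions $a_{i,j}=a_{j,i}$ and $a_{i,j}=a_{i+k \bmod N,\,j+k \bmod N}$. Then with probability $1$ the measures $\nu_{A_N}$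 converge weakly to the eigenvalue distribution of the $k\times k$ Gaussian Unitary Ensemble, i.e. the Hermitian ensemble with independent entries on and above the diagonal, the diagonal ones $\mathcal N_{\mathbb R}(0,1)$ and the ones above it distributed as $(a+ib)/\sqrt2$ with $a,b$ iid $\mathcal N_{\mathbb R}(0,1)$. -/

import Mathlib

open MeasureTheory ProbabilityTheory Filter Topology

noncomputable section

namespace PeriodicEnsemble

/-- Matrices carry the product (equivalently, Borel) sigma-algebra of their entries. -/
instance instMeasurableSpaceMatrix {m n α : Type*} [MeasurableSpace α] :
    MeasurableSpace (Matrix m n α) :=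
  inferInstanceAs (MeasurableSpace (m → n → α))

/-! ### Real ensembles with identified entries -/

/-- The law of an `N × N` real random matrix whose entries are iid with law `μ`, apart from the
restriction that entries in the same class of `s` are equal: one independent sample is drawn
for each equivalence class of positions. -/
def identifiedLaw {N : ℕ} (s : Setoid (Fin N × Fin N)) (μ : Measure ℝ) :
    Measure (Matrix (Fin N) (Fin N) ℝ) :=
  haveI : Fintype (Quotient s) := Fintype.ofFinite _
  (Measure.pi fun _ : Quotient s => μ).map
    fun ω => Matrix.of fun i j => ω (Quotient.mk s (i, j))

instance instIsProbabilityMeasureIdentifiedLaw {N : ℕ} (s : Setoid (Fin N × Fin N))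
    (μ : Measure ℝ) [IsProbabilityMeasure μ] : IsProbabilityMeasure (identifiedLaw s μ) := by
  unfold identifiedLaw
  apply Measure.isProbabilityMeasure_map
  apply Measurable.aemeasurable
  exact measurable_pi_lambda _ fun i => measurable_pi_lambda _ fun j => measurable_pi_apply _

/-! ### Link functions -/

section Link

variable {k : ℕ} {S : Type*}

/-- The restriction imposed by the link function `f` on positions of an `N × N` matrix (zero
indexed, `k ∣ N`): the positions `p = (i, j)` and `q = (i', j')` lie on the same wrapped diagonal,
`i - j ≡ i' - j' (mod N)`, and `f (i, j) = f (i', j')`. -/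
def Linked (f : ZMod k → ZMod k → S) (N : ℕ) (p q : Fin N × Fin N) : Prop :=
  ((p.1 : ℕ) : ZMod N) - ((p.2 : ℕ) : ZMod N) = ((q.1 : ℕ) : ZMod N) - ((q.2 : ℕ) : ZMod N) ∧
    f ((p.1 : ℕ) : ZMod k) ((p.2 : ℕ) : ZMod k) = f ((q.1 : ℕ) : ZMod k) ((q.2 : ℕ) : ZMod k)

/-- The equivalence relation on positions generated by symmetry and by the link function. -/
def linkSetoid (f : ZMod k → ZMod k → S) (N : ℕ) : Setoid (Fin N × Fin N) :=
  Relation.EqvGen.setoid fun p q => q = p.swap ∨ Linked f N p q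

/-- The law of the `f`-linked `N × N` real symmetric ensemble with entry distribution `μ`. -/
def linkedLaw (f : ZMod k → ZMod k → S) (N : ℕ) (μ : Measure ℝ) :
    Measure (Matrix (Fin N) (Fin N) ℝ) :=
  identifiedLaw (linkSetoid f N) μ

instance instIsProbabilityMeasureLinkedLaw (f : ZMod k → ZMod k → S) (N : ℕ)
    (μ : Measure ℝ) [IsProbabilityMeasure μ] : IsProbabilityMeasure (linkedLaw f N μ) :=
  instIsProbabilityMeasureIdentifiedLaw _ _

/-! ### The complex companion ensemble

Its entries satisfy `c q = conj (c p)` for `q = p.swap` and `c p = c q` for `Linked f N p q`.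
Composing these restrictions, `c p` and `c q` are constrained to be equal when `p` and `q` are
joined by a chain using an even number of swaps (relation `SameEntry`), and conjugate when `p` and
`q.swap` are so joined; together the two cases make up `linkSetoid f N`. -/

/-- The equality relation `c p = c q` forced by the restrictions. It is generated by the link
restriction and by its transpose (transpose, link, transpose back). -/
def SameEntry (f : ZMod k → ZMod k → S) (N : ℕ) : Fin N × Fin N → Fin N × Fin N → Prop :=
  Relation.EqvGen fun p q => Linked f N p q ∨ Linked f N p.swap q.swap

/-- The entry at position `p` is real iff the restrictions identify it with the transposed entry,
of which it is the conjugate. -/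
def IsRealEntry (f : ZMod k → ZMod k → S) (N : ℕ) (p : Fin N × Fin N) : Prop :=
  SameEntry f N p p.swap

/-- If `p` lies on the main or the split diagonal and `f (i, j) = f (j, i)`, then the entry at `p`
is real. -/
theorem isRealEntry_of_link (f : ZMod k → ZMod k → S) (N : ℕ) (p : Fin N × Fin N)
    (h : 2 * (((p.2 : ℕ) : ZMod N) - ((p.1 : ℕ) : ZMod N)) = 0)
    (hf : f ((p.2 : ℕ) : ZMod k) ((p.1 : ℕ) : ZMod k) =
      f ((p.1 : ℕ) : ZMod k) ((p.2 : ℕ) : ZMod k)) : IsRealEntry f N p := by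
  refine Relation.EqvGen.rel _ _ (Or.inl ⟨?_, ?_⟩)
  · simp only [Prod.fst_swap, Prod.snd_swap]
    linear_combination -h
  · simpa using hf.symm

/-- A pair of real numbers `(a, b)` read as the complex number `(a + i b) / √2`. For `a, b` iid
standard real Gaussians this is the standard complex Gaussian. -/
def toComplexGaussian (x : ℝ × ℝ) : ℂ :=
  ((x.1 : ℂ) + (x.2 : ℂ) * Complex.I) / ((Real.sqrt 2 : ℝ) : ℂ)

/-- The law of a pair of iid standard real Gaussians. -/
def gaussianPair : Measure (ℝ × ℝ) := (gaussianReal 0 1).prod (gaussianReal 0 1)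

open scoped Classical in
/-- The companion matrix built from one pair `(a, b)` for each class of positions: the entry at `p`
is `a` if it is real; otherwise it is `(a + i b) / √2` if it is constrained to be equal to the entry
at the chosen representative of its class, and the conjugate of that number if not. -/
def companionMatrix (f : ZMod k → ZMod k → S) (N : ℕ) (ω : Quotient (linkSetoid f N) → ℝ × ℝ) :
    Matrix (Fin N) (Fin N) ℂ :=
  Matrix.of fun i j =>
    let q : Quotient (linkSetoid f N) := Quotient.mk (linkSetoid f N) (i, j)
    if IsRealEntry f N (i, j) then ((ω q).1 : ℂ)
    else if SameEntry f N (i, j) q.out then toComplexGaussian (ω q)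
    else star (toComplexGaussian (ω q))

/-- The law of the `N × N` complex companion ensemble of `f`. -/
def companionLaw (f : ZMod k → ZMod k → S) (N : ℕ) : Measure (Matrix (Fin N) (Fin N) ℂ) :=
  haveI : Fintype (Quotient (linkSetoid f N)) := Fintype.ofFinite _
  (Measure.pi fun _ : Quotient (linkSetoid f N) => gaussianPair).map (companionMatrix f N)

end Link

/-! ### Block circulant ensembles and the GUE -/

/-- The equivalence relation on positions of an `N × N` matrix generated by
`(i, j) ~ (i + k mod N, j + k mod N)` and `(i, j) ~ (j, i)`. -/
def blockCirculantSetoid (k N : ℕ) : Setoid (Fin N × Fin N) :=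
  Relation.EqvGen.setoid fun p q => q = p.swap ∨
    (((q.1 : ℕ) : ZMod N) = ((p.1 : ℕ) : ZMod N) + (k : ZMod N) ∧
      ((q.2 : ℕ) : ZMod N) = ((p.2 : ℕ) : ZMod N) + (k : ZMod N))

/-- The law of the `N × N` symmetric `k`-block circulant ensemble with entry distribution `μ`. -/
def blockCirculantLaw (k N : ℕ) (μ : Measure ℝ) : Measure (Matrix (Fin N) (Fin N) ℝ) :=
  identifiedLaw (blockCirculantSetoid k N) μ

instance instIsProbabilityMeasureBlockCirculantLaw (k N : ℕ)
    (μ : Measure ℝ) [IsProbabilityMeasure μ] : IsProbabilityMeasure (blockCirculantLaw k N μ) :=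
  instIsProbabilityMeasureIdentifiedLaw _ _

/-- The GUE matrix built from one pair `(a, b)` for each position on or above the diagonal. -/
def gueMatrix (N : ℕ) (ω : Fin N × Fin N → ℝ × ℝ) : Matrix (Fin N) (Fin N) ℂ :=
  Matrix.of fun i j =>
    if i = j then ((ω (i, i)).1 : ℂ)
    else if i < j then toComplexGaussian (ω (i, j))
    else star (toComplexGaussian (ω (j, i)))

/-- The law of the `N × N` Gaussian Unitary Ensemble, with entries of variance one. -/
def gueLaw (N : ℕ) : Measure (Matrix (Fin N) (Fin N) ℂ) :=
  (Measure.pi fun _ : Fin N × Fin N => gaussianPair).map (gueMatrix N)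

/-! ### Spectral measures -/

section Spectral

variable {𝕜 : Type*} [RCLike 𝕜] {N : ℕ}

open scoped Classical in
/-- The empirical spectral measure `(1/N) ∑ δ_{λ_i / √N}` of a Hermitian `N × N` matrix, the
`λ_i` being its eigenvalues with multiplicity. (The zero measure if the matrix is not Hermitian.) -/
def empiricalSpectralMeasure (A : Matrix (Fin N) (Fin N) 𝕜) : Measure ℝ :=
  if hA : A.IsHermitian then
    (N : ENNReal)⁻¹ • ∑ i : Fin N, Measure.dirac (hA.eigenvalues i / Real.sqrt N)
  else 0

/-- The eigenvalue distribution of an ensemble of Hermitian matrices with law `P`: the law of the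
real number obtained by drawing a matrix from `P` and then drawing a point from its
empirical spectral measure. -/
def eigenvalueDistribution [MeasurableSpace 𝕜] (P : Measure (Matrix (Fin N) (Fin N) 𝕜)) :
    Measure ℝ :=
  P.bind empiricalSpectralMeasure

end Spectral

end PeriodicEnsemble

end

noncomputable section

namespace PeriodicEnsemble

/-! ### Perturbation of spectral sums -/

section Perturbation

open Matrix

variable {𝕜 n : Type*} [RCLike 𝕜] [Fintype n]

/-! The proof counts no moments of traces. The mean of a linear spectral statistic is found by
Fourier analysis and a central limit theorem, and its fluctuations are controlled by concentration.

Mean. Let N = kn. The class of a position (i, j) depends only on i mod k and j - i mod N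
(`mk_eq_entryClass`), so a linked matrix is invariant under shifting both indices by k. The
characters of Z/N, cut down to residue classes mod k, therefore block-diagonalize it into n
Hermitian k × k blocks (`classMatrix_mul_fourierMatrix`). For every sample each block satisfies the
restrictions of the companion ensemble, hence is √n times a companion matrix
(`blockMatrix_eq_smul_companionMatrix`), and the empirical spectral measure is the average over the
blocks of those of these companion matrices. The coordinates of a block are linear in the
independent entries, with coefficients O(n^{-1/2}). Which coefficients share a variable is settled
by `entryClass_out_eq_iff`: over a real position the offsets d and -d coincide, and nothing else
does. When n does not divide 2r, the sums of χ(2rd) over a residue class mod k vanish, so the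
variances tend to those of the companion coordinates and the r-th block converges in law
(`tendsto_charFun_blockLaw`). At most two values of r are excluded, and they are negligible in the
average over r (`tendsto_average`).

Fluctuations. A first-order expansion of Tr g(A) with quadratic Frobenius remainder
(`abs_sum_sub_sum_sub_trace_le`) bounds the effect of resampling one independent entry. The
gradients are class sums of the entries of g'(A/√N)/√N, so their total square is O(N) whatever A is
(`sum_sq_sum_spectralFunction_le`). A fourth-moment form of the Efron-Stein inequality
(`integral_central_fourth_moment_le`) gives a fourth central moment O(N^{-3/2}), which is summable,
so the statistic almost surely has the same limit as its mean.

Weak convergence. The almost sure statement is used only for cosines and sines of rational frequency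
and a sequence of cutoffs, so that a single null set suffices. The cutoffs supply tightness, and
Lévy's continuity theorem gives all bounded continuous functions. The block circulant case is the
link function f = (a, b), whose companion ensemble is the GUE (`companionLaw_pair_eq_gueLaw`). -/

/-- The squared Frobenius norm of a matrix. -/
def frobSq {m n 𝕜 : Type*} [Fintype m] [Fintype n] [RCLike 𝕜] (M : Matrix m n 𝕜) : ℝ :=
  ∑ i, ∑ j, ‖M i j‖ ^ 2

theorem frobSq_eq_trace (M : Matrix n n 𝕜) : ((frobSq M : ℝ) : 𝕜) = (Mᴴ * M).trace := by
  simp only [frobSq, Matrix.trace, Matrix.diag_apply, Matrix.mul_apply, conjTranspose_apply]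
  rw [Finset.sum_comm]
  push_cast
  refine Finset.sum_congr rfl fun i _ => Finset.sum_congr rfl fun j _ => ?_
  rw [RCLike.star_def, RCLike.conj_mul]

variable [DecidableEq n]

theorem frobSq_unitary_mul {U M : Matrix n n 𝕜} (hU : Uᴴ * U = 1) :
    frobSq (U * M) = frobSq M := by
  have h : ((frobSq (U * M) : ℝ) : 𝕜) = ((frobSq M : ℝ) : 𝕜) := by
    rw [frobSq_eq_trace, frobSq_eq_trace, conjTranspose_mul, Matrix.mul_assoc,
      ← Matrix.mul_assoc Uᴴ, hU, Matrix.one_mul]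
  exact_mod_cast h

theorem frobSq_mul_unitary {U M : Matrix n n 𝕜} (hU : U * Uᴴ = 1) :
    frobSq (M * U) = frobSq M := by
  have h : ((frobSq (M * U) : ℝ) : 𝕜) = ((frobSq M : ℝ) : 𝕜) := by
    rw [frobSq_eq_trace, frobSq_eq_trace, conjTranspose_mul, Matrix.mul_assoc,
      Matrix.trace_mul_comm, Matrix.mul_assoc, Matrix.mul_assoc, hU, Matrix.mul_one]
  exact_mod_cast h

variable {A B : Matrix n n 𝕜}

/-- The unitary matrix relating the eigenbases of two Hermitian matrices. -/
def eigenTransition (hA : A.IsHermitian) (hB : B.IsHermitian) : Matrix n n 𝕜 :=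
  (hA.eigenvectorUnitary : Matrix n n 𝕜)ᴴ * (hB.eigenvectorUnitary : Matrix n n 𝕜)

/-- The value at a Hermitian matrix of a real function, through the spectral theorem. -/
def spectralFunction (hA : A.IsHermitian) (h : ℝ → ℝ) : Matrix n n 𝕜 :=
  (hA.eigenvectorUnitary : Matrix n n 𝕜) *
    diagonal (fun i => ((h (hA.eigenvalues i) : ℝ) : 𝕜)) * (hA.eigenvectorUnitary : Matrix n n 𝕜)ᴴ

theorem eigenvectorUnitary_conjTranspose_mul (hA : A.IsHermitian) :
    (hA.eigenvectorUnitary : Matrix n n 𝕜)ᴴ * (hA.eigenvectorUnitary : Matrix n n 𝕜) = 1 := by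
  simpa [star_eq_conjTranspose] using Unitary.coe_star_mul_self hA.eigenvectorUnitary

theorem eigenvectorUnitary_mul_conjTranspose (hA : A.IsHermitian) :
    (hA.eigenvectorUnitary : Matrix n n 𝕜) * (hA.eigenvectorUnitary : Matrix n n 𝕜)ᴴ = 1 := by
  simpa [star_eq_conjTranspose] using Unitary.coe_mul_star_self hA.eigenvectorUnitary

theorem spectralFunction_id (hA : A.IsHermitian) : spectralFunction hA (fun x => x) = A := by
  conv_rhs => rw [hA.spectral_theorem, Unitary.conjStarAlgAut_apply]
  simp only [spectralFunction, Function.comp_def]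
  rfl

theorem conjTranspose_eigenvectorUnitary_mul (hA : A.IsHermitian) :
    (hA.eigenvectorUnitary : Matrix n n 𝕜)ᴴ * A =
      diagonal (fun i => ((hA.eigenvalues i : ℝ) : 𝕜)) *
        (hA.eigenvectorUnitary : Matrix n n 𝕜)ᴴ := by
  conv_lhs => enter [2]; rw [← spectralFunction_id hA]
  rw [spectralFunction, ← Matrix.mul_assoc, ← Matrix.mul_assoc,
    eigenvectorUnitary_conjTranspose_mul, Matrix.one_mul]

theorem mul_eigenvectorUnitary (hA : A.IsHermitian) :
    A * (hA.eigenvectorUnitary : Matrix n n 𝕜) =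
      (hA.eigenvectorUnitary : Matrix n n 𝕜) *
        diagonal (fun i => ((hA.eigenvalues i : ℝ) : 𝕜)) := by
  conv_lhs => enter [1]; rw [← spectralFunction_id hA]
  rw [spectralFunction, Matrix.mul_assoc, eigenvectorUnitary_conjTranspose_mul, Matrix.mul_one]

/-- Using the eigenbasis of A on the left and that of B on the right, both terms of B - A act by
scalars although A and B need not commute. Matrix perturbation is thereby reduced to scalar
inequalities between pairs of eigenvalues. -/
theorem conj_sub_apply (hA : A.IsHermitian) (hB : B.IsHermitian) (i j : n) :
    ((hA.eigenvectorUnitary : Matrix n n 𝕜)ᴴ * (B - A) *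
      (hB.eigenvectorUnitary : Matrix n n 𝕜)) i j =
      ((hB.eigenvalues j - hA.eigenvalues i : ℝ) : 𝕜) * eigenTransition hA hB i j := by
  rw [Matrix.mul_sub, Matrix.sub_mul, Matrix.mul_assoc _ B, mul_eigenvectorUnitary hB,
    conjTranspose_eigenvectorUnitary_mul hA, Matrix.mul_assoc _ _ (hB.eigenvectorUnitary :
      Matrix n n 𝕜), ← Matrix.mul_assoc, ← eigenTransition, Matrix.sub_apply, mul_diagonal,
    diagonal_mul]
  push_cast
  ring

/-- The doubly stochastic weights `|⟪u i, v j⟫|²` relating two eigenbases. -/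
def overlap (hA : A.IsHermitian) (hB : B.IsHermitian) (i j : n) : ℝ :=
  ‖eigenTransition hA hB i j‖ ^ 2

theorem overlap_nonneg (hA : A.IsHermitian) (hB : B.IsHermitian) (i j : n) :
    0 ≤ overlap hA hB i j := by unfold overlap; positivity

theorem eigenTransition_mul_conjTranspose (hA : A.IsHermitian) (hB : B.IsHermitian) :
    eigenTransition hA hB * (eigenTransition hA hB)ᴴ = 1 := by
  rw [eigenTransition, conjTranspose_mul, conjTranspose_conjTranspose, Matrix.mul_assoc,
    ← Matrix.mul_assoc _ _ (hA.eigenvectorUnitary : Matrix n n 𝕜),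
    eigenvectorUnitary_mul_conjTranspose, Matrix.one_mul, eigenvectorUnitary_conjTranspose_mul]

theorem conjTranspose_mul_eigenTransition (hA : A.IsHermitian) (hB : B.IsHermitian) :
    (eigenTransition hA hB)ᴴ * eigenTransition hA hB = 1 := by
  rw [eigenTransition, conjTranspose_mul, conjTranspose_conjTranspose, Matrix.mul_assoc,
    ← Matrix.mul_assoc _ _ (hB.eigenvectorUnitary : Matrix n n 𝕜),
    eigenvectorUnitary_mul_conjTranspose, Matrix.one_mul, eigenvectorUnitary_conjTranspose_mul]

theorem sum_overlap_right (hA : A.IsHermitian) (hB : B.IsHermitian) (i : n) :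
    ∑ j, overlap hA hB i j = 1 := by
  have h := congrFun (congrFun (eigenTransition_mul_conjTranspose hA hB) i) i
  rw [Matrix.mul_apply, Matrix.one_apply_eq] at h
  have h2 : ((∑ j, overlap hA hB i j : ℝ) : 𝕜) = 1 := by
    rw [← h]
    push_cast
    refine Finset.sum_congr rfl fun j _ => ?_
    rw [conjTranspose_apply, RCLike.star_def, RCLike.mul_conj, overlap]
    push_cast; rfl
  exact_mod_cast h2

theorem sum_overlap_left (hA : A.IsHermitian) (hB : B.IsHermitian) (j : n) :
    ∑ i, overlap hA hB i j = 1 := by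
  have h := congrFun (congrFun (conjTranspose_mul_eigenTransition hA hB) j) j
  rw [Matrix.mul_apply, Matrix.one_apply_eq] at h
  have h2 : ((∑ i, overlap hA hB i j : ℝ) : 𝕜) = 1 := by
    rw [← h]
    push_cast
    refine Finset.sum_congr rfl fun j _ => ?_
    rw [conjTranspose_apply, RCLike.star_def, RCLike.conj_mul, overlap]
    push_cast; rfl
  exact_mod_cast h2

theorem frobSq_sub_eq (hA : A.IsHermitian) (hB : B.IsHermitian) :
    frobSq (B - A) =
      ∑ i, ∑ j, overlap hA hB i j * (hB.eigenvalues j - hA.eigenvalues i) ^ 2 := by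
  rw [← frobSq_mul_unitary (M := B - A) (eigenvectorUnitary_mul_conjTranspose hB),
    ← frobSq_unitary_mul (U := (hA.eigenvectorUnitary : Matrix n n 𝕜)ᴴ)
      (by rw [conjTranspose_conjTranspose]; exact eigenvectorUnitary_mul_conjTranspose hA),
    ← Matrix.mul_assoc]
  refine Finset.sum_congr rfl fun i _ => Finset.sum_congr rfl fun j _ => ?_
  rw [conj_sub_apply, norm_mul, mul_pow, overlap, RCLike.norm_ofReal, sq_abs, mul_comm]

/-- Inserting U_B U_B^* = 1 writes the first-order term with the same weights as `frobSq_sub_eq` and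
`sum_sub_sum_eq_overlap`, so the three can be compared pair by pair. -/
theorem trace_spectralFunction_mul_sub (hA : A.IsHermitian) (hB : B.IsHermitian) (h : ℝ → ℝ) :
    (spectralFunction hA h * (B - A)).trace =
      ((∑ i, ∑ j, overlap hA hB i j *
        (h (hA.eigenvalues i) * (hB.eigenvalues j - hA.eigenvalues i)) : ℝ) : 𝕜) := by
  have h1 : (spectralFunction hA h * (B - A)).trace =
      (diagonal (fun i => ((h (hA.eigenvalues i) : ℝ) : 𝕜)) *
        (((hA.eigenvectorUnitary : Matrix n n 𝕜)ᴴ * (B - A) *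
          (hB.eigenvectorUnitary : Matrix n n 𝕜)) * (eigenTransition hA hB)ᴴ)).trace := by
    rw [spectralFunction, Matrix.mul_assoc, Matrix.mul_assoc, Matrix.trace_mul_comm,
      eigenTransition, conjTranspose_mul, conjTranspose_conjTranspose,
      Matrix.mul_assoc (_ * _) _ (_ * _),
      ← Matrix.mul_assoc (hB.eigenvectorUnitary : Matrix n n 𝕜),
      eigenvectorUnitary_mul_conjTranspose, Matrix.one_mul]
    simp only [Matrix.mul_assoc]
  rw [h1]
  simp only [Matrix.trace, Matrix.diag_apply, diagonal_mul, Matrix.mul_apply (N := (_)ᴴ)]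
  push_cast
  refine Finset.sum_congr rfl fun i _ => ?_
  rw [Finset.mul_sum]
  refine Finset.sum_congr rfl fun j _ => ?_
  rw [conj_sub_apply, conjTranspose_apply, RCLike.star_def, mul_assoc (RCLike.ofReal _),
    RCLike.mul_conj, overlap]
  push_cast
  ring

theorem frobSq_spectralFunction (hA : A.IsHermitian) (h : ℝ → ℝ) :
    frobSq (spectralFunction hA h) = ∑ i, h (hA.eigenvalues i) ^ 2 := by
  rw [spectralFunction, frobSq_mul_unitary (by
      rw [conjTranspose_conjTranspose]; exact eigenvectorUnitary_conjTranspose_mul hA),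
    frobSq_unitary_mul (eigenvectorUnitary_conjTranspose_mul hA), frobSq]
  refine Finset.sum_congr rfl fun i _ => ?_
  rw [Finset.sum_eq_single i]
  · simp
  · intro j _ hj; simp [diagonal_apply_ne' _ hj]
  · simp

/-- The overlaps are doubly stochastic, so a sum over the eigenvalues of either matrix is also a sum
over pairs. -/
theorem sum_sub_sum_eq_overlap (hA : A.IsHermitian) (hB : B.IsHermitian) (g : ℝ → ℝ) :
    ∑ j, g (hB.eigenvalues j) - ∑ i, g (hA.eigenvalues i) =
      ∑ i, ∑ j, overlap hA hB i j * (g (hB.eigenvalues j) - g (hA.eigenvalues i)) := by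
  simp only [mul_sub, Finset.sum_sub_distrib]
  congr 1
  · rw [Finset.sum_comm]
    simp only [← Finset.sum_mul, sum_overlap_left, one_mul]
  · simp only [← Finset.sum_mul, sum_overlap_right, one_mul]

/-- Second order expansion of a spectral sum, with quadratic remainder. -/
theorem abs_sum_sub_sum_sub_trace_le (hA : A.IsHermitian) (hB : B.IsHermitian) {g h : ℝ → ℝ}
    {K : ℝ} (hg : ∀ x y, |g y - g x - h x * (y - x)| ≤ K * (y - x) ^ 2) :
    |∑ j, g (hB.eigenvalues j) - ∑ i, g (hA.eigenvalues i) -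
      RCLike.re (spectralFunction hA h * (B - A)).trace| ≤ K * frobSq (B - A) := by
  rw [trace_spectralFunction_mul_sub hA hB, RCLike.ofReal_re, sum_sub_sum_eq_overlap hA hB,
    frobSq_sub_eq hA hB, ← Finset.sum_sub_distrib, Finset.mul_sum]
  refine (Finset.abs_sum_le_sum_abs _ _).trans (Finset.sum_le_sum fun i _ => ?_)
  rw [← Finset.sum_sub_distrib, Finset.mul_sum]
  refine (Finset.abs_sum_le_sum_abs _ _).trans (Finset.sum_le_sum fun j _ => ?_)
  rw [← mul_sub, abs_mul, abs_of_nonneg (overlap_nonneg hA hB i j), mul_left_comm]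
  exact mul_le_mul_of_nonneg_left (hg _ _) (overlap_nonneg hA hB i j)

/-- Spectral sums of Lipschitz functions are Lipschitz for the Frobenius norm. -/
theorem abs_sum_sub_sum_le (hA : A.IsHermitian) (hB : B.IsHermitian) {g : ℝ → ℝ}
    {L : ℝ} (hL : 0 ≤ L) (hg : ∀ x y, |g y - g x| ≤ L * |y - x|) :
    |∑ j, g (hB.eigenvalues j) - ∑ i, g (hA.eigenvalues i)| ≤
      L * Real.sqrt (Fintype.card n * frobSq (B - A)) := by
  rw [sum_sub_sum_eq_overlap hA hB]
  have h1 : |∑ i, ∑ j, overlap hA hB i j * (g (hB.eigenvalues j) - g (hA.eigenvalues i))| ≤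
      L * ∑ p : n × n, overlap hA hB p.1 p.2 * |hB.eigenvalues p.2 - hA.eigenvalues p.1| := by
    rw [Fintype.sum_prod_type, Finset.mul_sum]
    refine (Finset.abs_sum_le_sum_abs _ _).trans (Finset.sum_le_sum fun i _ => ?_)
    rw [Finset.mul_sum]
    refine (Finset.abs_sum_le_sum_abs _ _).trans (Finset.sum_le_sum fun j _ => ?_)
    rw [abs_mul, abs_of_nonneg (overlap_nonneg hA hB i j), mul_left_comm]
    exact mul_le_mul_of_nonneg_left (hg _ _) (overlap_nonneg hA hB i j)
  refine h1.trans (mul_le_mul_of_nonneg_left (Real.le_sqrt_of_sq_le ?_) hL)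
  -- Cauchy-Schwarz with the overlaps as weights; their total mass is the number of rows, whence the
  -- factor `Fintype.card n`.
  have h2 := Finset.sum_sq_le_sum_mul_sum_of_sq_le_mul (Finset.univ : Finset (n × n))
    (r := fun p => overlap hA hB p.1 p.2 * |hB.eigenvalues p.2 - hA.eigenvalues p.1|)
    (f := fun p => overlap hA hB p.1 p.2)
    (g := fun p => overlap hA hB p.1 p.2 * (hB.eigenvalues p.2 - hA.eigenvalues p.1) ^ 2)
    (fun p _ => overlap_nonneg hA hB _ _)
    (fun p _ => mul_nonneg (overlap_nonneg hA hB _ _) (sq_nonneg _))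
    (fun p _ => by rw [mul_pow, sq_abs]; exact le_of_eq (by ring))
  refine h2.trans (le_of_eq ?_)
  rw [Fintype.sum_prod_type, Fintype.sum_prod_type, frobSq_sub_eq hA hB]
  congr 1
  simp [sum_overlap_right]

end Perturbation

/-! ### Integrals against empirical spectral measures -/

section Empirical

open Matrix

variable {𝕜 : Type*} [RCLike 𝕜] {N : ℕ}

instance isFiniteMeasure_empiricalSpectralMeasure (A : Matrix (Fin N) (Fin N) 𝕜) :
    IsFiniteMeasure (empiricalSpectralMeasure A) := by
  unfold empiricalSpectralMeasure
  split_ifs with hA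
  -- For N = 0 the scalar N⁻¹ is ∞ in `ENNReal`, but it multiplies the zero measure.
  · rcases Nat.eq_zero_or_pos N with rfl | hN
    · simp only [Finset.univ_eq_empty, Finset.sum_empty, smul_zero]
      infer_instance
    · refine ⟨?_⟩
      rw [Measure.smul_apply, smul_eq_mul]
      refine ENNReal.mul_lt_top ?_ (measure_lt_top _ _)
      rw [ENNReal.inv_lt_top]
      exact_mod_cast hN
  · infer_instance

theorem isProbabilityMeasure_empiricalSpectralMeasure (hN : 0 < N)
    {A : Matrix (Fin N) (Fin N) 𝕜} (hA : A.IsHermitian) :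
    IsProbabilityMeasure (empiricalSpectralMeasure A) := by
  refine ⟨?_⟩
  rw [empiricalSpectralMeasure, dif_pos hA, Measure.smul_apply, Measure.coe_finsetSum,
    Finset.sum_apply]
  simp only [measure_univ, Finset.sum_const, Finset.card_univ, Fintype.card_fin, smul_eq_mul,
    nsmul_eq_mul, mul_one]
  exact ENNReal.inv_mul_cancel (by exact_mod_cast hN.ne') (ENNReal.natCast_ne_top N)

theorem integral_empiricalSpectralMeasure {A : Matrix (Fin N) (Fin N) 𝕜} (hA : A.IsHermitian)
    (g : ℝ → ℝ) :
    ∫ x, g x ∂(empiricalSpectralMeasure A) =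
      (N : ℝ)⁻¹ * ∑ i, g (hA.eigenvalues i / Real.sqrt N) := by
  rw [empiricalSpectralMeasure, dif_pos hA, integral_smul_measure, integral_finsetSum_measure]
  · simp
  · intro i _
    exact integrable_dirac (by simp)

/-- The Frobenius-Lipschitz bound replaces any continuity statement about individual eigenvalues.
The restriction to Hermitian matrices is needed because the measure is set to zero elsewhere. -/
theorem continuousOn_integral_empiricalSpectralMeasure {g : ℝ → ℝ} {L : ℝ} (hL : 0 ≤ L)
    (hg : ∀ x y, |g y - g x| ≤ L * |y - x|) :
    ContinuousOn (fun A : Matrix (Fin N) (Fin N) 𝕜 => ∫ x, g x ∂(empiricalSpectralMeasure A))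
      {A | A.IsHermitian} := by
  intro A hA
  have hlip : ∀ B ∈ {A : Matrix (Fin N) (Fin N) 𝕜 | A.IsHermitian},
      dist (∫ x, g x ∂(empiricalSpectralMeasure B)) (∫ x, g x ∂(empiricalSpectralMeasure A)) ≤
        (N : ℝ)⁻¹ * ((L / Real.sqrt N) *
          Real.sqrt (Fintype.card (Fin N) * frobSq (B - A))) := by
    intro B hB
    have hA' : A.IsHermitian := hA
    have hB' : B.IsHermitian := hB
    rw [integral_empiricalSpectralMeasure hA', integral_empiricalSpectralMeasure hB', Real.dist_eq,
      ← mul_sub, abs_mul, abs_of_nonneg (by positivity : (0:ℝ) ≤ (N:ℝ)⁻¹)]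
    refine mul_le_mul_of_nonneg_left ?_ (by positivity)
    refine abs_sum_sub_sum_le hA' hB' (g := fun x => g (x / Real.sqrt N)) (by positivity) ?_
    intro x y
    refine (hg _ _).trans (le_of_eq ?_)
    rw [← sub_div, abs_div, abs_of_nonneg (Real.sqrt_nonneg _)]
    ring
  rw [ContinuousWithinAt, tendsto_iff_dist_tendsto_zero]
  refine squeeze_zero' (.of_forall fun _ => dist_nonneg)
    (eventually_nhdsWithin_of_forall hlip) ?_
  have hc : Continuous fun B : Matrix (Fin N) (Fin N) 𝕜 => (N : ℝ)⁻¹ * ((L / Real.sqrt N) *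
          Real.sqrt (Fintype.card (Fin N) * frobSq (B - A))) := by
    unfold frobSq
    simp only [Matrix.sub_apply]
    fun_prop
  have := (hc.tendsto A).mono_left (nhdsWithin_le_nhds (s := {A | A.IsHermitian}))
  simpa [frobSq] using this

theorem abs_integral_empiricalSpectralMeasure_le (A : Matrix (Fin N) (Fin N) 𝕜)
    {g : ℝ → ℝ} {C : ℝ} (hC : ∀ x, |g x| ≤ C) :
    |∫ x, g x ∂(empiricalSpectralMeasure A)| ≤ C := by
  have hC0 : 0 ≤ C := (abs_nonneg _).trans (hC 0)
  by_cases hA : A.IsHermitian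
  · rcases Nat.eq_zero_or_pos N with rfl | hN
    · rw [integral_empiricalSpectralMeasure hA]; simpa
    · have := isProbabilityMeasure_empiricalSpectralMeasure hN hA
      have h := norm_integral_le_of_norm_le_const (μ := empiricalSpectralMeasure A) (f := g)
        (C := C) (.of_forall fun x => by simpa using hC x)
      simpa using h
  · rw [empiricalSpectralMeasure, dif_neg hA]; simpa

variable [MeasurableSpace 𝕜] [BorelSpace 𝕜]

instance borelSpace_matrix : BorelSpace (Matrix (Fin N) (Fin N) 𝕜) :=
  inferInstanceAs (BorelSpace (Fin N → Fin N → 𝕜))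

theorem measurableSet_isHermitian :
    MeasurableSet {A : Matrix (Fin N) (Fin N) 𝕜 | A.IsHermitian} := by
  refine IsClosed.measurableSet ?_
  exact isClosed_eq (by fun_prop) continuous_id

theorem measurable_integral_empiricalSpectralMeasure_of_lipschitz {g : ℝ → ℝ} {L : ℝ} (hL : 0 ≤ L)
    (hg : ∀ x y, |g y - g x| ≤ L * |y - x|) :
    Measurable fun A : Matrix (Fin N) (Fin N) 𝕜 => ∫ x, g x ∂(empiricalSpectralMeasure A) := by
  classical
  have h := (continuousOn_integral_empiricalSpectralMeasure (𝕜 := 𝕜) (N := N) hL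
    hg).measurable_piecewise (continuousOn_const (c := (0 : ℝ))) measurableSet_isHermitian
  convert! h using 1
  ext A
  by_cases hA : A.IsHermitian
  · rw [Set.piecewise_eq_of_mem _ _ _ (show A ∈ {A | A.IsHermitian} from hA)]
  · rw [Set.piecewise_eq_of_notMem _ _ _ (show A ∉ {A | A.IsHermitian} from hA),
      empiricalSpectralMeasure, dif_neg hA]
    simp

/-- Closed sets are a generating π-system, and the indicator of a closed set is a limit of Lipschitz
thickened indicators, to which the previous lemma applies. This makes the `bind` in
`eigenvalueDistribution` a genuine mixture. -/
theorem measurable_empiricalSpectralMeasure :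
    Measurable (empiricalSpectralMeasure : Matrix (Fin N) (Fin N) 𝕜 → Measure ℝ) := by
  have hclosed : ∀ F : Set ℝ, IsClosed F → Measurable fun A : Matrix (Fin N) (Fin N) 𝕜 =>
      empiricalSpectralMeasure A F := by
    intro F hF
    have hpos : ∀ n : ℕ, (0 : ℝ) < 1 / ((n : ℝ) + 1) := fun n => by positivity
    refine measurable_of_tendsto_metrizable (f := fun (n : ℕ) (A : Matrix (Fin N) (Fin N) 𝕜) =>
      ∫⁻ x, (thickenedIndicator (hpos n) F x : ENNReal) ∂(empiricalSpectralMeasure A)) ?_ ?_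
    · intro n
      have heq : (fun A : Matrix (Fin N) (Fin N) 𝕜 =>
          ∫⁻ x, (thickenedIndicator (hpos n) F x : ENNReal) ∂(empiricalSpectralMeasure A)) =
          fun A => ENNReal.ofReal
            (∫ x, (thickenedIndicator (hpos n) F x : ℝ) ∂(empiricalSpectralMeasure A)) := by
        ext A
        rw [lintegral_coe_eq_integral]
        exact integrable_thickenedIndicator F (hpos n)
      rw [heq]
      refine ENNReal.measurable_ofReal.comp
        (measurable_integral_empiricalSpectralMeasure_of_lipschitz
          (L := ((1 / ((n : ℝ) + 1)).toNNReal⁻¹ : NNReal)) (NNReal.coe_nonneg _) ?_)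
      intro x y
      have := (lipschitzWith_thickenedIndicator (hpos n) F).dist_le_mul y x
      simpa [NNReal.dist_eq, Real.dist_eq] using this
    · rw [tendsto_pi_nhds]
      intro A
      exact tendsto_lintegral_thickenedIndicator_of_isClosed _ hF hpos
        tendsto_one_div_add_atTop_nhds_zero_nat
  exact Measurable.measure_of_isPiSystem (BorelSpace.measurable_eq.trans
    borel_eq_generateFrom_isClosed) isPiSystem_isClosed (fun s hs => hclosed s hs)
    (hclosed _ isClosed_univ)

theorem integral_eigenvalueDistribution (P : Measure (Matrix (Fin N) (Fin N) 𝕜))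
    [IsProbabilityMeasure P] (g : BoundedContinuousFunction ℝ ℝ) :
    ∫ x, g x ∂(eigenvalueDistribution P) =
      ∫ A, ∫ x, g x ∂(empiricalSpectralMeasure A) ∂P := by
  let κ : Kernel (Matrix (Fin N) (Fin N) 𝕜) ℝ :=
    ⟨empiricalSpectralMeasure, measurable_empiricalSpectralMeasure⟩
  have hκ : IsFiniteKernel κ := by
    refine ⟨⟨1, ENNReal.one_lt_top, fun A => ?_⟩⟩
    change empiricalSpectralMeasure A Set.univ ≤ 1
    by_cases hA : A.IsHermitian
    · rcases Nat.eq_zero_or_pos N with rfl | hN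
      · rw [empiricalSpectralMeasure, dif_pos hA]; simp
      · have := isProbabilityMeasure_empiricalSpectralMeasure hN hA
        simp
    · rw [empiricalSpectralMeasure, dif_neg hA]; simp
  have h := Kernel.integral_comp (κ := Kernel.const Unit P) (η := κ) (a := ()) (f := g) ?_
  · rw [Kernel.comp_apply, Kernel.const_apply] at h
    exact h
  · exact g.integrable _

theorem isProbabilityMeasure_eigenvalueDistribution (hN : 0 < N)
    (P : Measure (Matrix (Fin N) (Fin N) 𝕜))
    [IsProbabilityMeasure P] (hP : ∀ᵐ A ∂P, A.IsHermitian) :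
    IsProbabilityMeasure (eigenvalueDistribution P) := by
  refine ⟨?_⟩
  rw [eigenvalueDistribution, Measure.bind_apply .univ
    measurable_empiricalSpectralMeasure.aemeasurable]
  rw [lintegral_congr_ae (g := fun _ => 1)]
  · simp
  · filter_upwards [hP] with A hA
    have := isProbabilityMeasure_empiricalSpectralMeasure hN hA
    simp

end Empirical

/-! ### The Efron-Stein inequality and its fourth moment version -/

section EfronStein

variable {ι α : Type*} [Fintype ι] [DecidableEq ι] [MeasurableSpace α]

/-- From a family of pairs, choose the second components on `s` and the first ones elsewhere. -/
def resample (s : Finset ι) (ω : ι → α × α) : ι → α :=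
  fun c => if c ∈ s then (ω c).2 else (ω c).1

/-- Exchange the two components of the pairs indexed by `s`. -/
def exchange (s : Finset ι) (ω : ι → α × α) : ι → α × α :=
  fun c => if c ∈ s then (ω c).swap else ω c

omit [Fintype ι] [MeasurableSpace α] in
theorem resample_exchange (s t : Finset ι) (ω : ι → α × α) :
    resample s (exchange t ω) = resample (symmDiff s t) ω := by
  ext c
  simp only [resample, exchange, Finset.mem_symmDiff]
  by_cases hs : c ∈ s <;> by_cases ht : c ∈ t <;> simp [hs, ht]

omit [Fintype ι] in
@[fun_prop]
theorem measurable_resample (s : Finset ι) : Measurable (resample (α := α) s) := by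
  refine measurable_pi_lambda _ fun c => ?_
  unfold resample
  split_ifs <;> fun_prop

variable (μ : Measure α) [IsProbabilityMeasure μ]

theorem measurePreserving_resample (s : Finset ι) :
    MeasurePreserving (resample s) (Measure.pi fun _ : ι => μ.prod μ) (Measure.pi fun _ => μ) := by
  refine measurePreserving_pi (f := fun c (p : α × α) => if c ∈ s then p.2 else p.1) _ _ fun c => ?_
  by_cases hc : c ∈ s
  · simpa only [hc, if_true] using measurePreserving_snd
  · simpa only [hc, if_false] using measurePreserving_fst

theorem measurePreserving_exchange (s : Finset ι) :
    MeasurePreserving (exchange s) (Measure.pi fun _ : ι => μ.prod μ)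
      (Measure.pi fun _ => μ.prod μ) := by
  refine measurePreserving_pi (f := fun c (p : α × α) => if c ∈ s then p.swap else p) _ _
    fun c => ?_
  by_cases hc : c ∈ s
  · simpa only [hc, if_true] using Measure.measurePreserving_swap
  · simp only [hc, if_false]
    exact MeasurePreserving.id _

variable {μ}

theorem integral_resample {F : (ι → α) → ℝ} (hF : Measurable F) (s : Finset ι) :
    ∫ ω, F (resample s ω) ∂(Measure.pi fun _ : ι => μ.prod μ) =
      ∫ x, F x ∂(Measure.pi fun _ => μ) := by
  rw [← (measurePreserving_resample μ s).map_eq,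
    integral_map (measurable_resample s).aemeasurable hF.aestronglyMeasurable]

theorem integral_exchange {G : (ι → α × α) → ℝ} (hG : Measurable G) (s : Finset ι) :
    ∫ ω, G (exchange s ω) ∂(Measure.pi fun _ : ι => μ.prod μ) =
      ∫ ω, G ω ∂(Measure.pi fun _ => μ.prod μ) := by
  conv_rhs => rw [← (measurePreserving_exchange μ s).map_eq,
    integral_map (measurePreserving_exchange μ s).measurable.aemeasurable hG.aestronglyMeasurable]

/-- The two components of the pairs are independent copies, so the mean of the product factors. -/
theorem integral_resample_mul_resample (F : (ι → α) → ℝ) :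
    ∫ ω, F (resample ∅ ω) * F (resample Finset.univ ω) ∂(Measure.pi fun _ : ι => μ.prod μ) =
      (∫ x, F x ∂(Measure.pi fun _ => μ)) ^ 2 := by
  have h := measurePreserving_arrowProdEquivProdArrow α α ι (fun _ => μ) (fun _ => μ)
  rw [pow_two, ← integral_prod_mul, ← h.map_eq, integral_map_equiv]
  refine integral_congr_ae (.of_forall fun ω => ?_)
  have h0 : resample ∅ ω = fun c => (ω c).1 := by ext c; simp [resample]
  have h1 : resample Finset.univ ω = fun c => (ω c).2 := by ext c; simp [resample]
  simp only [h0, h1]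
  rfl

theorem integrable_of_abs_le {β : Type*} [MeasurableSpace β] {P : Measure β} [IsFiniteMeasure P]
    {G : β → ℝ} (hG : Measurable G) {C : ℝ} (hC : ∀ x, |G x| ≤ C) : Integrable G P :=
  Integrable.of_bound hG.aestronglyMeasurable C (.of_forall fun x => by simpa using hC x)

/-- Coordinates are resampled one at a time. Exchanging the two copies of the new coordinate c
preserves the law and flips the sign of the increment, so the contribution of c is half the mean of
a product of two c-increments, one with the copies on s exchanged. These increments have the same
law, so 2ab ≤ a² + b² finishes. -/
theorem integral_mul_sub_resample_le {F : (ι → α) → ℝ} (hF : Measurable F) {C : ℝ}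
    (hC : ∀ x, |F x| ≤ C) (s : Finset ι) :
    ∫ ω, F (resample ∅ ω) * (F (resample ∅ ω) - F (resample s ω))
        ∂(Measure.pi fun _ : ι => μ.prod μ) ≤
      1 / 2 * ∑ c ∈ s, ∫ ω, (F (resample ∅ ω) - F (resample {c} ω)) ^ 2
        ∂(Measure.pi fun _ : ι => μ.prod μ) := by
  have hC0 (x : ι → α) : 0 ≤ C := (abs_nonneg _).trans (hC x)
  have hm (s : Finset ι) : Measurable fun ω : ι → α × α => F (resample s ω) :=
    hF.comp (measurable_resample s)
  have hb (s t : Finset ι) (ω : ι → α × α) : |F (resample s ω) - F (resample t ω)| ≤ 2 * C := by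
    have := abs_sub (F (resample s ω)) (F (resample t ω))
    linarith [hC (resample s ω), hC (resample t ω)]
  have hint (r s t : Finset ι) : Integrable (fun ω : ι → α × α =>
      F (resample r ω) * (F (resample s ω) - F (resample t ω)))
      (Measure.pi fun _ : ι => μ.prod μ) := by
    refine integrable_of_abs_le ((hm r).mul ((hm s).sub (hm t))) (C := C * (2 * C)) fun ω => ?_
    rw [abs_mul]
    exact mul_le_mul (hC _) (hb _ _ _) (abs_nonneg _) (hC0 (resample s ω))
  have hsq (s t : Finset ι) : Integrable (fun ω : ι → α × α =>
      (F (resample s ω) - F (resample t ω)) ^ 2) (Measure.pi fun _ : ι => μ.prod μ) := by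
    refine integrable_of_abs_le (((hm s).sub (hm t)).pow_const 2) (C := (2 * C) ^ 2) fun ω => ?_
    rw [abs_pow]
    exact pow_le_pow_left₀ (abs_nonneg _) (hb _ _ _) 2
  induction s using Finset.induction_on with
  | empty => simp
  | insert c s hc ih =>
    rw [Finset.sum_insert hc, mul_add]
    have hsplit : ∫ ω, F (resample ∅ ω) * (F (resample ∅ ω) - F (resample (insert c s) ω))
        ∂(Measure.pi fun _ : ι => μ.prod μ) =
        ∫ ω, F (resample ∅ ω) * (F (resample ∅ ω) - F (resample s ω))
          ∂(Measure.pi fun _ : ι => μ.prod μ) +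
        ∫ ω, F (resample ∅ ω) * (F (resample s ω) - F (resample (insert c s) ω))
          ∂(Measure.pi fun _ : ι => μ.prod μ) := by
      rw [← integral_add (hint _ _ _) (hint _ _ _)]
      exact integral_congr_ae (.of_forall fun ω => by simp only []; ring)
    have hs1 : symmDiff s {c} = insert c s := by
      ext x; by_cases hx : x = c <;> simp [Finset.mem_symmDiff, hx, hc]
    have hs2 : symmDiff (insert c s) {c} = s := by
      rw [← hs1, symmDiff_symmDiff_cancel_right]
    have hs3 : symmDiff {c} s = insert c s := by rw [symmDiff_comm, hs1]
    have hflip : ∫ ω, F (resample ∅ ω) * (F (resample s ω) - F (resample (insert c s) ω))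
          ∂(Measure.pi fun _ : ι => μ.prod μ) =
        ∫ ω, F (resample {c} ω) * (F (resample (insert c s) ω) - F (resample s ω))
          ∂(Measure.pi fun _ : ι => μ.prod μ) := by
      rw [← integral_exchange (G := fun ω => F (resample ∅ ω) *
        (F (resample s ω) - F (resample (insert c s) ω)))
        ((hm ∅).mul ((hm s).sub (hm (insert c s)))) {c}]
      have hs0 : symmDiff ∅ {c} = ({c} : Finset ι) := by simp [symmDiff_def]
      simp only [resample_exchange, hs1, hs2, hs0]
    have hflip2 : ∫ ω, (F (resample s ω) - F (resample (insert c s) ω)) ^ 2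
          ∂(Measure.pi fun _ : ι => μ.prod μ) =
        ∫ ω, (F (resample ∅ ω) - F (resample {c} ω)) ^ 2
          ∂(Measure.pi fun _ : ι => μ.prod μ) := by
      rw [← integral_exchange (G := fun ω => (F (resample ∅ ω) - F (resample {c} ω)) ^ 2)
        (((hm ∅).sub (hm {c})).pow_const 2) s]
      have hs0 : symmDiff ∅ s = s := by simp [symmDiff_def]
      simp only [resample_exchange, hs3, hs0]
    have hle : ∫ ω, F (resample ∅ ω) * (F (resample s ω) - F (resample (insert c s) ω))
          ∂(Measure.pi fun _ : ι => μ.prod μ) +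
        ∫ ω, F (resample {c} ω) * (F (resample (insert c s) ω) - F (resample s ω))
          ∂(Measure.pi fun _ : ι => μ.prod μ) ≤
        1 / 2 * ∫ ω, (F (resample ∅ ω) - F (resample {c} ω)) ^ 2
          ∂(Measure.pi fun _ : ι => μ.prod μ) +
        1 / 2 * ∫ ω, (F (resample s ω) - F (resample (insert c s) ω)) ^ 2
          ∂(Measure.pi fun _ : ι => μ.prod μ) := by
      rw [← integral_add (hint _ _ _) (hint _ _ _), ← integral_const_mul, ← integral_const_mul,
        ← integral_add ((hsq _ _).const_mul _) ((hsq _ _).const_mul _)]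
      refine integral_mono ((hint _ _ _).add (hint _ _ _))
        (((hsq _ _).const_mul _).add ((hsq _ _).const_mul _)) fun ω => ?_
      simp only []
      nlinarith [sq_nonneg ((F (resample ∅ ω) - F (resample {c} ω)) -
        (F (resample s ω) - F (resample (insert c s) ω)))]
    rw [hflip2, ← hflip] at hle
    rw [hsplit]
    linarith

/-- The **Efron-Stein inequality** for bounded functions. -/
theorem integral_sq_sub_sq_integral_le {F : (ι → α) → ℝ} (hF : Measurable F) {C : ℝ}
    (hC : ∀ x, |F x| ≤ C) :
    ∫ x, F x ^ 2 ∂(Measure.pi fun _ => μ) - (∫ x, F x ∂(Measure.pi fun _ => μ)) ^ 2 ≤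
      1 / 2 * ∑ c, ∫ ω, (F (resample ∅ ω) - F (resample {c} ω)) ^ 2
        ∂(Measure.pi fun _ : ι => μ.prod μ) := by
  have hm (s : Finset ι) : Measurable fun ω : ι → α × α => F (resample s ω) :=
    hF.comp (measurable_resample s)
  have hint (s t : Finset ι) : Integrable (fun ω : ι → α × α =>
      F (resample s ω) * F (resample t ω)) (Measure.pi fun _ : ι => μ.prod μ) := by
    refine integrable_of_abs_le ((hm s).mul (hm t)) (C := C * C) fun ω => ?_
    rw [abs_mul]
    exact mul_le_mul (hC _) (hC _) (abs_nonneg _) ((abs_nonneg _).trans (hC (resample s ω)))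
  refine le_trans (le_of_eq ?_) (integral_mul_sub_resample_le hF hC Finset.univ)
  simp only [mul_sub]
  rw [integral_sub (hint _ _) (hint _ _), integral_resample_mul_resample F,
    ← integral_resample (hF.pow_const 2) ∅]
  simp only [pow_two]

/-- The fourth central moment of a bounded function of independent variables is controlled by the
second moment of the sum of its squared increments. -/
theorem integral_central_fourth_moment_le {F : (ι → α) → ℝ} (hF : Measurable F) {C : ℝ}
    (hC : ∀ x, |F x| ≤ C) :
    ∫ x, (F x - ∫ y, F y ∂(Measure.pi fun _ => μ)) ^ 4 ∂(Measure.pi fun _ => μ) ≤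
      19 * ∫ ω, (∑ c, (F (resample ∅ ω) - F (resample {c} ω)) ^ 2) ^ 2
        ∂(Measure.pi fun _ : ι => μ.prod μ) := by
  set m := ∫ y, F y ∂(Measure.pi fun _ => μ) with hmdef
  set P := Measure.pi fun _ : ι => μ.prod μ with hP
  set U : (ι → α) → ℝ := fun x => F x - m with hU
  set V : (ι → α × α) → ℝ := fun ω => ∑ c, (F (resample ∅ ω) - F (resample {c} ω)) ^ 2 with hV
  have hUm : Measurable U := hF.sub_const m
  have hUb (x) : |U x| ≤ C + |m| := (abs_sub _ _).trans (by gcongr; exact hC x)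
  have hm (s : Finset ι) : Measurable fun ω : ι → α × α => F (resample s ω) :=
    hF.comp (measurable_resample s)
  have hVm : Measurable V :=
    Finset.measurable_sum _ fun c _ => ((hm ∅).sub (hm {c})).pow_const 2
  have hVb (ω) : |V ω| ≤ ∑ _c : ι, (2 * C) ^ 2 := by
    rw [abs_of_nonneg (Finset.sum_nonneg fun _ _ => sq_nonneg _)]
    refine Finset.sum_le_sum fun c _ => ?_
    rw [← sq_abs]
    refine pow_le_pow_left₀ (abs_nonneg _) ?_ 2
    have := abs_sub (F (resample ∅ ω)) (F (resample {c} ω))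
    linarith [hC (resample ∅ ω), hC (resample {c} ω)]
  have hVi : Integrable V P := integrable_of_abs_le hVm hVb
  have hV2i : Integrable (fun ω => V ω ^ 2) P := by
    refine integrable_of_abs_le (hVm.pow_const 2) (C := (∑ _c : ι, (2 * C) ^ 2) ^ 2) fun ω => ?_
    rw [abs_pow]
    exact pow_le_pow_left₀ (abs_nonneg _) (hVb ω) 2
  have hUpi (n : ℕ) : Integrable (fun ω => U (resample ∅ ω) ^ n) P := by
    refine integrable_of_abs_le ((hUm.comp (measurable_resample ∅)).pow_const n)
      (C := (C + |m|) ^ n) fun ω => ?_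
    rw [abs_pow]
    exact pow_le_pow_left₀ (abs_nonneg _) (hUb _) n
  have hmean : ∫ x, U x ∂(Measure.pi fun _ => μ) = 0 := by
    simp only [hU]
    rw [integral_sub (integrable_of_abs_le hF hC) (integrable_const _), ← hmdef]
    simp
  have hvar : ∫ x, U x ^ 2 ∂(Measure.pi fun _ => μ) ≤ 1 / 2 * ∫ ω, V ω ∂P := by
    have h := integral_sq_sub_sq_integral_le (μ := μ) hUm hUb
    rw [hmean, ← integral_finsetSum] at h
    · simpa [hU, hV] using h
    · intro c _
      refine integrable_of_abs_le (((hUm.comp (measurable_resample ∅)).sub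
        (hUm.comp (measurable_resample {c}))).pow_const 2) (C := (2 * (C + |m|)) ^ 2) fun ω => ?_
      rw [abs_pow]
      refine pow_le_pow_left₀ (abs_nonneg _) ((abs_sub _ _).trans ?_) 2
      linarith [hUb (resample ∅ ω), hUb (resample {c} ω)]
  have hVsq : (∫ ω, V ω ∂P) ^ 2 ≤ ∫ ω, V ω ^ 2 ∂P := by
    have h := integral_nonneg (μ := P) (f := fun ω => (V ω - ∫ ω', V ω' ∂P) ^ 2)
      fun ω => sq_nonneg _
    have heq : ∫ ω, (V ω - ∫ ω', V ω' ∂P) ^ 2 ∂P =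
        ∫ ω, V ω ^ 2 ∂P - (∫ ω, V ω ∂P) ^ 2 := by
      have : ∀ ω, (V ω - ∫ ω', V ω' ∂P) ^ 2 =
          V ω ^ 2 - 2 * (∫ ω', V ω' ∂P) * V ω + (∫ ω', V ω' ∂P) ^ 2 := fun ω => by ring
      simp only [this]
      rw [integral_add (f := fun ω => V ω ^ 2 - 2 * (∫ ω', V ω' ∂P) * V ω)
        (hV2i.sub (hVi.const_mul _)) (integrable_const _),
        integral_sub hV2i (hVi.const_mul _), integral_const_mul]
      simp
      ring
    rw [heq] at h
    linarith
  -- Efron-Stein a second time, now for the square of the centred function.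
  have hfour := integral_sq_sub_sq_integral_le (μ := μ) (hUm.pow_const 2) (C := (C + |m|) ^ 2)
    fun x => by rw [abs_pow]; exact pow_le_pow_left₀ (abs_nonneg _) (hUb _) 2
  -- With u = U and an increment d, (u² - (u - d)²)² ≤ 8u²d² + 2d⁴, and 4u²V ≤ u⁴/2 + 8V². The term
  -- u⁴/2 is absorbed at the end, leaving the constant 2(9 + 1/4) ≤ 19.
  have hsum : 1 / 2 * ∑ c, ∫ ω, (U (resample ∅ ω) ^ 2 - U (resample {c} ω) ^ 2) ^ 2 ∂P ≤
      1 / 2 * ∫ ω, U (resample ∅ ω) ^ 4 ∂P + 9 * ∫ ω, V ω ^ 2 ∂P := by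
    rw [← integral_finsetSum, ← integral_const_mul, ← integral_const_mul, ← integral_const_mul,
      ← integral_add ((hUpi 4).const_mul _) (hV2i.const_mul _)]
    · refine integral_mono_of_nonneg (.of_forall fun ω => ?_)
        (((hUpi 4).const_mul _).add (hV2i.const_mul _)) (.of_forall fun ω => ?_)
      · have : (0:ℝ) ≤ ∑ i, (U (resample ∅ ω) ^ 2 - U (resample {i} ω) ^ 2) ^ 2 :=
          Finset.sum_nonneg fun _ _ => sq_nonneg _
        simp only [Pi.zero_apply]
        linarith
      · have h1 : ∑ c, (U (resample ∅ ω) ^ 2 - U (resample {c} ω) ^ 2) ^ 2 ≤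
            8 * U (resample ∅ ω) ^ 2 * V ω + 2 * ∑ c,
              ((F (resample ∅ ω) - F (resample {c} ω)) ^ 2) ^ 2 := by
          simp only [hV]
          rw [Finset.mul_sum, Finset.mul_sum, ← Finset.sum_add_distrib]
          refine Finset.sum_le_sum fun c _ => ?_
          have hΔ : U (resample {c} ω) =
              U (resample ∅ ω) - (F (resample ∅ ω) - F (resample {c} ω)) := by
            simp only [hU]; ring
          rw [hΔ]
          generalize U (resample ∅ ω) = u
          generalize F (resample ∅ ω) - F (resample {c} ω) = d
          nlinarith [mul_nonneg (sq_nonneg d) (sq_nonneg (2 * u + d))]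
        have h2 : ∑ c, ((F (resample ∅ ω) - F (resample {c} ω)) ^ 2) ^ 2 ≤ V ω ^ 2 := by
          rw [pow_two (V ω)]
          nth_rw 1 [hV]
          simp only []
          rw [Finset.sum_mul]
          refine Finset.sum_le_sum fun c _ => ?_
          rw [pow_two ((F (resample ∅ ω) - F (resample {c} ω)) ^ 2)]
          refine mul_le_mul_of_nonneg_left ?_ (sq_nonneg _)
          exact Finset.single_le_sum
            (f := fun c => (F (resample ∅ ω) - F (resample {c} ω)) ^ 2)
            (fun _ _ => sq_nonneg _) (Finset.mem_univ c)
        simp only []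
        nlinarith [sq_nonneg (U (resample ∅ ω) ^ 2 - 4 * V ω)]
    · intro c _
      refine integrable_of_abs_le ((((hUm.comp (measurable_resample ∅)).pow_const 2).sub
        ((hUm.comp (measurable_resample {c})).pow_const 2)).pow_const 2)
        (C := (2 * (C + |m|) ^ 2) ^ 2) fun ω => ?_
      rw [abs_pow]
      refine pow_le_pow_left₀ (abs_nonneg _) ((abs_sub _ _).trans ?_) 2
      rw [abs_pow, abs_pow]
      have h1 := pow_le_pow_left₀ (abs_nonneg _) (hUb (resample ∅ ω)) 2
      have h2 := pow_le_pow_left₀ (abs_nonneg _) (hUb (resample {c} ω)) 2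
      linarith
  rw [integral_resample (hUm.pow_const 4) ∅] at hsum
  have hpow : ∀ x, (U x ^ 2) ^ 2 = U x ^ 4 := fun x => by ring
  simp only [hpow] at hfour
  have hU2 : (∫ x, U x ^ 2 ∂(Measure.pi fun _ => μ)) ^ 2 ≤ 1 / 4 * ∫ ω, V ω ^ 2 ∂P := by
    have h0 : 0 ≤ ∫ x, U x ^ 2 ∂(Measure.pi fun _ => μ) := integral_nonneg fun _ => sq_nonneg _
    have := pow_le_pow_left₀ h0 hvar 2
    nlinarith
  have hVnn : 0 ≤ ∫ ω, V ω ^ 2 ∂P := integral_nonneg fun _ => sq_nonneg _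
  change ∫ x, U x ^ 4 ∂(Measure.pi fun _ => μ) ≤ 19 * ∫ ω, V ω ^ 2 ∂P
  linarith

end EfronStein

/-! ### Concentration of spectral statistics -/

section Concentration

open Matrix

/-- The matrix whose entries are given by one number for each class of positions. -/
def classMatrix {N : ℕ} (s : Setoid (Fin N × Fin N)) (x : Quotient s → ℝ) :
    Matrix (Fin N) (Fin N) ℝ :=
  Matrix.of fun i j => x (Quotient.mk s (i, j))

variable {N : ℕ} {s : Setoid (Fin N × Fin N)}

theorem isHermitian_classMatrix (hs : ∀ p, s p p.swap) (x : Quotient s → ℝ) :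
    (classMatrix s x).IsHermitian := by
  ext i j
  simp only [conjTranspose_apply, classMatrix, of_apply, star_trivial]
  exact congrArg x (Quotient.sound (hs (j, i)))

theorem measurable_classMatrix : Measurable (classMatrix s) :=
  measurable_pi_lambda _ fun _ => measurable_pi_lambda _ fun _ => measurable_pi_apply _

variable [Fintype (Quotient s)] [DecidableEq (Quotient s)]

theorem sum_sq_sum_class_le {C : ℝ}
    (hC : ∀ c : Quotient s,
      ((Finset.univ.filter fun p : Fin N × Fin N => Quotient.mk s p = c).card : ℝ) ≤ C)
    (M : Fin N × Fin N → ℝ) :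
    ∑ c : Quotient s,
      (∑ p ∈ Finset.univ.filter (fun p : Fin N × Fin N => Quotient.mk s p = c), M p) ^ 2 ≤
      C * ∑ p, M p ^ 2 := by
  rw [← Finset.sum_fiberwise (s := Finset.univ) (fun p : Fin N × Fin N => Quotient.mk s p)
    (fun p => M p ^ 2), Finset.mul_sum]
  refine Finset.sum_le_sum fun c _ => sq_sum_le_card_mul_sum_sq.trans ?_
  exact mul_le_mul_of_nonneg_right (hC c) (Finset.sum_nonneg fun _ _ => sq_nonneg _)

omit [Fintype (Quotient s)] in
/-- Effect on a linear spectral statistic of the modification of one variable. -/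
theorem abs_integral_sub_integral_le (hs : ∀ p, s p p.swap) {C : ℝ}
    (hC : ∀ c : Quotient s,
      ((Finset.univ.filter fun p : Fin N × Fin N => Quotient.mk s p = c).card : ℝ) ≤ C * N)
    (hN : 0 < N) {g h : ℝ → ℝ} {K : ℝ} (hK : 0 ≤ K)
    (hg : ∀ x y, |g y - g x - h x * (y - x)| ≤ K * (y - x) ^ 2)
    (x x' : Quotient s → ℝ) (c : Quotient s) (hx : ∀ c', c' ≠ c → x' c' = x c') :
    |∫ t, g t ∂(empiricalSpectralMeasure (classMatrix s x)) -
        ∫ t, g t ∂(empiricalSpectralMeasure (classMatrix s x'))| ≤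
      (N : ℝ)⁻¹ * (|x' c - x c| *
        |∑ p ∈ Finset.univ.filter (fun p : Fin N × Fin N => Quotient.mk s p = c),
          spectralFunction (isHermitian_classMatrix hs x)
            (fun t => h (t / Real.sqrt N) / Real.sqrt N) p.1 p.2| +
        K * C * (x' c - x c) ^ 2) := by
  have hN' : (0 : ℝ) < N := by exact_mod_cast hN
  have hR : 0 < Real.sqrt N := Real.sqrt_pos.2 hN'
  have hRR : Real.sqrt N ^ 2 = N := Real.sq_sqrt hN'.le
  set hA := isHermitian_classMatrix hs x
  set hB := isHermitian_classMatrix hs x'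
  set M := spectralFunction hA (fun t => h (t / Real.sqrt N) / Real.sqrt N) with hM
  have hdiff : ∀ i j, (classMatrix s x' - classMatrix s x) i j =
      if Quotient.mk s (i, j) = c then x' c - x c else 0 := by
    intro i j
    simp only [Matrix.sub_apply, classMatrix, of_apply]
    split_ifs with hc
    · rw [hc]
    · rw [hx _ hc, sub_self]
  -- The trace pairs the position (i, j) with (j, i); classes are stable under transposition, so the
  -- sum runs over the class of c itself.
  have htrace : (M * (classMatrix s x' - classMatrix s x)).trace = (x' c - x c) *
      ∑ p ∈ Finset.univ.filter (fun p : Fin N × Fin N => Quotient.mk s p = c), M p.1 p.2 := by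
    rw [Finset.mul_sum, Finset.sum_filter, Fintype.sum_prod_type]
    simp only [Matrix.trace, Matrix.diag_apply, Matrix.mul_apply]
    refine Finset.sum_congr rfl fun i _ => Finset.sum_congr rfl fun j _ => ?_
    rw [hdiff, show Quotient.mk s (j, i) = Quotient.mk s (i, j) from Quotient.sound (hs (j, i))]
    split_ifs <;> ring
  have hfrob : frobSq (classMatrix s x' - classMatrix s x) ≤ C * N * (x' c - x c) ^ 2 := by
    have : frobSq (classMatrix s x' - classMatrix s x) =
        ((Finset.univ.filter fun p : Fin N × Fin N => Quotient.mk s p = c).card : ℝ) *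
          (x' c - x c) ^ 2 := by
      rw [← nsmul_eq_mul, ← Finset.sum_const, Finset.sum_filter, Fintype.sum_prod_type]
      refine Finset.sum_congr rfl fun i _ => Finset.sum_congr rfl fun j _ => ?_
      rw [hdiff]
      split_ifs <;> simp
    rw [this]
    exact mul_le_mul_of_nonneg_right (hC c) (sq_nonneg _)
  -- Rescaling the argument by √N divides the quadratic constant by N, which compensates the class
  -- size of at most C N.
  have hKlein := abs_sum_sub_sum_sub_trace_le hA hB (g := fun t => g (t / Real.sqrt N))
    (h := fun t => h (t / Real.sqrt N) / Real.sqrt N) (K := K / N) (fun a b => by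
      refine le_trans (le_of_eq ?_) ((hg (a / Real.sqrt N) (b / Real.sqrt N)).trans (le_of_eq ?_))
      · congr 1; ring
      · rw [← sub_div, div_pow, hRR]; ring)
  rw [← hM, htrace] at hKlein
  simp only [RCLike.re_to_real] at hKlein
  rw [integral_empiricalSpectralMeasure hA, integral_empiricalSpectralMeasure hB, ← mul_sub,
    abs_mul, abs_of_nonneg (inv_nonneg.2 hN'.le), abs_sub_comm]
  refine mul_le_mul_of_nonneg_left ?_ (inv_nonneg.2 hN'.le)
  rw [← abs_mul]
  have h1 : K / N * frobSq (classMatrix s x' - classMatrix s x) ≤ K * C * (x' c - x c) ^ 2 := by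
    refine (mul_le_mul_of_nonneg_left hfrob (by positivity)).trans (le_of_eq ?_)
    field_simp
  have h2 := abs_sub_abs_le_abs_sub
    (∑ j, g (hB.eigenvalues j / Real.sqrt N) - ∑ i, g (hA.eigenvalues i / Real.sqrt N))
    ((x' c - x c) * ∑ p ∈ Finset.univ.filter (fun p : Fin N × Fin N => Quotient.mk s p = c),
      M p.1 p.2)
  linarith

/-- The class sums are the gradient of the statistic in the independent variables. Cauchy-Schwarz in
each class costs C N, while the squared Frobenius norm of h(A/√N)/√N is an average of values of h²,
at most L² for every A. -/
theorem sum_sq_sum_spectralFunction_le (hs : ∀ p, s p p.swap) {C : ℝ} (hC0 : 0 ≤ C)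
    (hC : ∀ c : Quotient s,
      ((Finset.univ.filter fun p : Fin N × Fin N => Quotient.mk s p = c).card : ℝ) ≤ C * N)
    (hN : 0 < N) {h : ℝ → ℝ} {L : ℝ} (hL : ∀ x, |h x| ≤ L) (x : Quotient s → ℝ) :
    ∑ c : Quotient s,
      (∑ p ∈ Finset.univ.filter (fun p : Fin N × Fin N => Quotient.mk s p = c),
        spectralFunction (isHermitian_classMatrix hs x)
          (fun t => h (t / Real.sqrt N) / Real.sqrt N) p.1 p.2) ^ 2 ≤ C * L ^ 2 * N := by
  have hN' : (0 : ℝ) < N := by exact_mod_cast hN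
  have hRR : Real.sqrt N ^ 2 = N := Real.sq_sqrt hN'.le
  refine (sum_sq_sum_class_le hC (fun p => spectralFunction (isHermitian_classMatrix hs x)
          (fun t => h (t / Real.sqrt N) / Real.sqrt N) p.1 p.2)).trans ?_
  have h1 : ∑ p : Fin N × Fin N, spectralFunction (isHermitian_classMatrix hs x)
      (fun t => h (t / Real.sqrt N) / Real.sqrt N) p.1 p.2 ^ 2 =
      frobSq (spectralFunction (isHermitian_classMatrix hs x)
        (fun t => h (t / Real.sqrt N) / Real.sqrt N)) := by
    rw [frobSq, Fintype.sum_prod_type]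
    simp
  rw [h1, frobSq_spectralFunction]
  have h2 : ∑ i, (h ((isHermitian_classMatrix hs x).eigenvalues i / Real.sqrt N) /
      Real.sqrt N) ^ 2 ≤ ∑ _i : Fin N, L ^ 2 / N := by
    refine Finset.sum_le_sum fun i _ => ?_
    rw [div_pow, hRR, ← sq_abs]
    gcongr
    exact hL _
  refine (mul_le_mul_of_nonneg_left h2 (by positivity)).trans (le_of_eq ?_)
  simp
  field_simp

/-- The squared sum of the squared increments, bounded in terms of the eighth powers of the
differences of the variables. -/
theorem sum_sq_increments_sq_le {ι : Type*} [Fintype ι] {N C K L : ℝ} (hN : 0 < N)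
    (hcard : (Fintype.card ι : ℝ) ≤ C * N) (D δ T : ι → ℝ)
    (hD : ∀ c, |D c| ≤ N⁻¹ * (|δ c| * |T c| + K * C * δ c ^ 2))
    (hT : ∑ c, T c ^ 2 ≤ C * L ^ 2 * N) :
    (∑ c, D c ^ 2) ^ 2 ≤ 8 * (C ^ 2 * L ^ 4 * (Real.sqrt N / 2 + 1 / (2 * Real.sqrt N) *
      ∑ c, δ c ^ 8) * N⁻¹ ^ 2 + K ^ 4 * C ^ 5 * N⁻¹ ^ 3 * ∑ c, δ c ^ 8) := by
  have hR : 0 < Real.sqrt N := Real.sqrt_pos.2 hN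
  set R := Real.sqrt N
  set E := ∑ c, δ c ^ 8 with hE
  have hE0 : ∀ c, 0 ≤ δ c ^ 8 := fun c => by positivity
  have hT0 : 0 ≤ ∑ c, T c ^ 2 := Finset.sum_nonneg fun _ _ => sq_nonneg _
  have h1 : ∑ c, D c ^ 2 ≤ 2 * N⁻¹ ^ 2 * (∑ c, δ c ^ 2 * T c ^ 2) +
      2 * N⁻¹ ^ 2 * K ^ 2 * C ^ 2 * ∑ c, δ c ^ 4 := by
    rw [Finset.mul_sum, Finset.mul_sum, ← Finset.sum_add_distrib]
    refine Finset.sum_le_sum fun c _ => ?_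
    rw [← sq_abs (D c)]
    refine (pow_le_pow_left₀ (abs_nonneg _) (hD c) 2).trans ?_
    rw [mul_pow, ← sq_abs (δ c), ← sq_abs (T c)]
    have : δ c ^ 4 = (|δ c| ^ 2) ^ 2 := by rw [sq_abs]; ring
    rw [this]
    nlinarith [mul_nonneg (sq_nonneg N⁻¹) (sq_nonneg (|δ c| * |T c| - K * C * |δ c| ^ 2))]
  have h2 : (∑ c, δ c ^ 2 * T c ^ 2) ^ 2 ≤
      (C * L ^ 2 * N) ^ 2 * (R / 2 + 1 / (2 * R) * E) := by
    have hcs := Finset.sum_sq_le_sum_mul_sum_of_sq_le_mul (Finset.univ : Finset ι)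
      (r := fun c => δ c ^ 2 * T c ^ 2) (f := fun c => T c ^ 2) (g := fun c => T c ^ 2 * δ c ^ 4)
      (fun c _ => sq_nonneg _) (fun c _ => by positivity) (fun c _ => le_of_eq (by ring))
    -- The δ are unbounded, so δ⁴ ≤ R/2 + δ⁸/(2R) is used and δ⁸ is enlarged to the full sum E. For
    -- variables with finite eighth moment E has mean O(N), so R = √N balances the two terms at
    -- order √N.
    have h3 : ∑ c, T c ^ 2 * δ c ^ 4 ≤ (∑ c, T c ^ 2) * (R / 2 + 1 / (2 * R) * E) := by
      rw [Finset.sum_mul]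
      refine Finset.sum_le_sum fun c _ => mul_le_mul_of_nonneg_left ?_ (sq_nonneg _)
      have h4 : δ c ^ 8 ≤ E := Finset.single_le_sum (fun c _ => hE0 c) (Finset.mem_univ c)
      have h5 : 1 / (2 * R) * δ c ^ 8 ≤ 1 / (2 * R) * E :=
        mul_le_mul_of_nonneg_left h4 (by positivity)
      have h6 : R / 2 + 1 / (2 * R) * δ c ^ 8 - δ c ^ 4 = 1 / (2 * R) * (δ c ^ 4 - R) ^ 2 := by
        field_simp
        ring
      have h7 : 0 ≤ 1 / (2 * R) * (δ c ^ 4 - R) ^ 2 := by positivity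
      linarith
    have hpos : 0 ≤ R / 2 + 1 / (2 * R) * E := by
      have : 0 ≤ E := Finset.sum_nonneg fun c _ => hE0 c
      positivity
    calc _ ≤ _ := hcs
      _ ≤ (∑ c, T c ^ 2) * ((∑ c, T c ^ 2) * (R / 2 + 1 / (2 * R) * E)) :=
        mul_le_mul_of_nonneg_left h3 hT0
      _ = (∑ c, T c ^ 2) ^ 2 * (R / 2 + 1 / (2 * R) * E) := by ring
      _ ≤ _ := mul_le_mul_of_nonneg_right (pow_le_pow_left₀ hT0 hT 2) hpos
  have h8 : (∑ c, δ c ^ 4) ^ 2 ≤ C * N * E := by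
    have := sq_sum_le_card_mul_sum_sq (s := (Finset.univ : Finset ι)) (f := fun c => δ c ^ 4)
    refine this.trans ?_
    rw [Finset.card_univ]
    have he : ∑ c, (δ c ^ 4) ^ 2 = E := Finset.sum_congr rfl fun c _ => by ring
    rw [he]
    exact mul_le_mul_of_nonneg_right hcard (Finset.sum_nonneg fun c _ => hE0 c)
  have h9 : (∑ c, D c ^ 2) ^ 2 ≤ (2 * N⁻¹ ^ 2 * (∑ c, δ c ^ 2 * T c ^ 2) +
      2 * N⁻¹ ^ 2 * K ^ 2 * C ^ 2 * ∑ c, δ c ^ 4) ^ 2 :=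
    pow_le_pow_left₀ (Finset.sum_nonneg fun _ _ => sq_nonneg _) h1 2
  have h10 : (2 * N⁻¹ ^ 2 * (∑ c, δ c ^ 2 * T c ^ 2) +
      2 * N⁻¹ ^ 2 * K ^ 2 * C ^ 2 * ∑ c, δ c ^ 4) ^ 2 ≤
      8 * N⁻¹ ^ 4 * (∑ c, δ c ^ 2 * T c ^ 2) ^ 2 +
      8 * N⁻¹ ^ 4 * K ^ 4 * C ^ 4 * (∑ c, δ c ^ 4) ^ 2 := by
    nlinarith [sq_nonneg (2 * N⁻¹ ^ 2 * (∑ c, δ c ^ 2 * T c ^ 2) -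
      2 * N⁻¹ ^ 2 * K ^ 2 * C ^ 2 * ∑ c, δ c ^ 4)]
  have h11 := mul_le_mul_of_nonneg_left h2 (show 0 ≤ 8 * N⁻¹ ^ 4 by positivity)
  have h12 := mul_le_mul_of_nonneg_left h8 (show 0 ≤ 8 * N⁻¹ ^ 4 * K ^ 4 * C ^ 4 by positivity)
  refine (h9.trans (h10.trans (add_le_add h11 h12))).trans (le_of_eq ?_)
  field_simp

end Concentration

/-! ### Almost sure convergence of spectral statistics -/

section TestFunction

/-- Bounded Lipschitz functions with a first order expansion with quadratic remainder. -/
def IsTestFunction (g : ℝ → ℝ) : Prop :=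
  ∃ (h : ℝ → ℝ) (G L K : ℝ), 0 ≤ L ∧ 0 ≤ K ∧ (∀ x, |g x| ≤ G) ∧ (∀ x, |h x| ≤ L) ∧
    (∀ x y, |g y - g x| ≤ L * |y - x|) ∧ ∀ x y, |g y - g x - h x * (y - x)| ≤ K * (y - x) ^ 2

theorem isTestFunction_of_deriv {g g' g'' : ℝ → ℝ} {G L K : ℝ} (h1 : ∀ x, HasDerivAt g (g' x) x)
    (h2 : ∀ x, HasDerivAt g' (g'' x) x) (hG : ∀ x, |g x| ≤ G) (hL : ∀ x, |g' x| ≤ L)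
    (hK : ∀ x, |g'' x| ≤ K) : IsTestFunction g := by
  have hlip {u u' : ℝ → ℝ} {B : ℝ} (hu : ∀ x, HasDerivAt u (u' x) x) (hB : ∀ x, |u' x| ≤ B)
      (x y : ℝ) : |u y - u x| ≤ B * |y - x| := by
    simpa using Convex.norm_image_sub_le_of_norm_hasDerivWithin_le (s := Set.univ) (C := B)
      (fun x _ => (hu x).hasDerivWithinAt) (fun x _ => by simpa using hB x) convex_univ
      (Set.mem_univ x) (Set.mem_univ y)
  refine ⟨g', G, L, K, (abs_nonneg _).trans (hL 0), (abs_nonneg _).trans (hK 0), hG, hL,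
    hlip h1 hL, fun x y => ?_⟩
  -- Mean value inequality for g minus its tangent part on the segment, where the derivative is at
  -- most K |y - x|. The constant K instead of K/2 is enough.
  have h := Convex.norm_image_sub_le_of_norm_hasDerivWithin_le (s := Set.uIcc x y)
    (f := fun t => g t - g' x * t) (f' := fun t => g' t - g' x) (C := K * |y - x|)
    (fun t _ => ((h1 t).fun_sub (by simpa using (hasDerivAt_id t).const_mul (g' x))
      : HasDerivAt (fun t => g t - g' x * t) (g' t - g' x) t).hasDerivWithinAt)
    (fun t ht => by
      refine (hlip h2 hK x t).trans ?_
      exact mul_le_mul_of_nonneg_left (Set.abs_sub_left_of_mem_uIcc ht)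
        ((abs_nonneg _).trans (hK 0)))
    (convex_uIcc x y) Set.left_mem_uIcc Set.right_mem_uIcc
  simp only [Real.norm_eq_abs] at h
  rw [mul_assoc, abs_mul_abs_self, ← pow_two] at h
  convert h using 2
  ring

theorem isTestFunction_cos (t : ℝ) : IsTestFunction fun x => Real.cos (t * x) := by
  have h0 (x : ℝ) : HasDerivAt (fun x => t * x) t x := by simpa using (hasDerivAt_id x).const_mul t
  refine isTestFunction_of_deriv (g' := fun x => -t * Real.sin (t * x))
    (g'' := fun x => -t * (t * Real.cos (t * x))) (G := 1) (L := |t|) (K := |t| * |t|)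
    (fun x => ?_) (fun x => ?_) (fun x => Real.abs_cos_le_one _) (fun x => ?_) (fun x => ?_)
  · exact ((h0 x).cos).congr_deriv (by ring)
  · exact ((h0 x).sin.const_mul (-t)).congr_deriv (by ring)
  · rw [abs_mul, abs_neg]
    exact mul_le_of_le_one_right (abs_nonneg _) (Real.abs_sin_le_one _)
  · rw [abs_mul, abs_neg, abs_mul, ← mul_assoc]
    exact mul_le_of_le_one_right (by positivity) (Real.abs_cos_le_one _)

theorem isTestFunction_sin (t : ℝ) : IsTestFunction fun x => Real.sin (t * x) := by
  have h0 (x : ℝ) : HasDerivAt (fun x => t * x) t x := by simpa using (hasDerivAt_id x).const_mul t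
  refine isTestFunction_of_deriv (g' := fun x => t * Real.cos (t * x))
    (g'' := fun x => -t * (t * Real.sin (t * x))) (G := 1) (L := |t|) (K := |t| * |t|)
    (fun x => ?_) (fun x => ?_) (fun x => Real.abs_sin_le_one _) (fun x => ?_) (fun x => ?_)
  · exact ((h0 x).sin).congr_deriv (by ring)
  · exact ((h0 x).cos.const_mul t).congr_deriv (by ring)
  · rw [abs_mul]
    exact mul_le_of_le_one_right (abs_nonneg _) (Real.abs_cos_le_one _)
  · rw [abs_mul, abs_neg, abs_mul, ← mul_assoc]
    exact mul_le_of_le_one_right (by positivity) (Real.abs_sin_le_one _)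

theorem isTestFunction_of_hasCompactSupport {g : ℝ → ℝ} (hg : ContDiff ℝ 2 g)
    (hs : HasCompactSupport g) : IsTestFunction g := by
  have hg1 : ContDiff ℝ 1 (deriv g) := by
    have : ContDiff ℝ (1 + 1) g := by simpa [one_add_one_eq_two] using hg
    exact (contDiff_succ_iff_deriv.1 this).2.2
  obtain ⟨G, hG⟩ := hs.exists_bound_of_continuous hg.continuous
  obtain ⟨L, hL⟩ := hs.deriv.exists_bound_of_continuous hg1.continuous
  obtain ⟨K, hK⟩ := hs.deriv.deriv.exists_bound_of_continuous (hg1.continuous_deriv le_rfl)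
  exact isTestFunction_of_deriv
    (fun x => (hg.differentiable (by norm_num) x).hasDerivAt)
    (fun x => (hg1.differentiable (by norm_num) x).hasDerivAt) hG hL hK

end TestFunction

/-! ### Fourth central moments of order N^{-3/2} -/

section FourthMoment

variable {μ : Measure ℝ} [IsProbabilityMeasure μ]

theorem integrable_sub_pow_eight (hmom : ∀ m : ℕ, Integrable (fun x : ℝ => x ^ m) μ) :
    Integrable (fun p : ℝ × ℝ => (p.2 - p.1) ^ 8) (μ.prod μ) := by
  have h1 : Integrable (fun p : ℝ × ℝ => p.1 ^ 8) (μ.prod μ) := (hmom 8).comp_fst μ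
  have h2 : Integrable (fun p : ℝ × ℝ => p.2 ^ 8) (μ.prod μ) := (hmom 8).comp_snd μ
  refine ((h1.add h2).const_mul (2 ^ 7)).mono' (by fun_prop) (.of_forall fun p => ?_)
  rw [Real.norm_eq_abs, abs_pow, Pi.add_apply]
  have h3 := add_pow_le (abs_nonneg p.2) (abs_nonneg p.1) 8
  have h4 : |p.2 - p.1| ≤ |p.2| + |p.1| := abs_sub _ _
  have h5 := pow_le_pow_left₀ (abs_nonneg _) h4 8
  have e1 : |p.2| ^ 8 = p.2 ^ 8 := by rw [← abs_pow]; exact abs_of_nonneg (by positivity)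
  have e2 : |p.1| ^ 8 = p.1 ^ 8 := by rw [← abs_pow]; exact abs_of_nonneg (by positivity)
  rw [e1, e2] at h3
  norm_num at h3 ⊢
  linarith

/-- The constant depends on the law, the test function and C, but neither on N nor on the partition.
The exponent 3/2 is what makes the bounds summable over N; a variance bound of order 1/N would not
be. -/
theorem exists_fourth_moment_bound (hmom : ∀ m : ℕ, Integrable (fun x : ℝ => x ^ m) μ)
    {g : ℝ → ℝ} (hg : IsTestFunction g) {C : ℝ} (hC : 0 ≤ C) :
    ∃ D : ℝ, ∀ (N : ℕ), 0 < N → ∀ (s : Setoid (Fin N × Fin N)), (∀ p, s p p.swap) →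
      (∀ c : Quotient s, ({p | Quotient.mk s p = c}.ncard : ℝ) ≤ C * N) →
      ((Nat.card (Quotient s) : ℕ) : ℝ) ≤ C * N →
      ∫ A, (∫ t, g t ∂(empiricalSpectralMeasure A) -
        ∫ B, ∫ t, g t ∂(empiricalSpectralMeasure B) ∂(identifiedLaw s μ)) ^ 4
          ∂(identifiedLaw s μ) ≤ D / (N * Real.sqrt N) := by
  obtain ⟨h, G, L, K, hL0, hK0, hG, hL, hlip, hquad⟩ := hg
  set m8 := ∫ p : ℝ × ℝ, (p.2 - p.1) ^ 8 ∂(μ.prod μ) with hm8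
  have hm80 : 0 ≤ m8 := integral_nonneg fun p => by positivity
  refine ⟨19 * (8 * (C ^ 2 * L ^ 4 * (1 + C * m8) / 2 + K ^ 4 * C ^ 6 * m8)),
    fun N hN s hs hsize hcard => ?_⟩
  classical
  let : Fintype (Quotient s) := Fintype.ofFinite _
  have hN' : (0 : ℝ) < N := by exact_mod_cast hN
  have hN1 : (1 : ℝ) ≤ N := by exact_mod_cast hN
  have hR : 0 < Real.sqrt N := Real.sqrt_pos.2 hN'
  have hRR : Real.sqrt N * Real.sqrt N = N := Real.mul_self_sqrt hN'.le
  have hsize' : ∀ c : Quotient s,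
      ((Finset.univ.filter fun p : Fin N × Fin N => Quotient.mk s p = c).card : ℝ) ≤ C * N := by
    intro c
    have := hsize c
    rwa [Set.ncard_eq_toFinset_card', Set.toFinset_ofPred] at this
  have hcard' : (Fintype.card (Quotient s) : ℝ) ≤ C * N := by
    rwa [Nat.card_eq_fintype_card] at hcard
  set F : Matrix (Fin N) (Fin N) ℝ → ℝ := fun A => ∫ t, g t ∂(empiricalSpectralMeasure A) with hF
  have hFm : Measurable F := measurable_integral_empiricalSpectralMeasure_of_lipschitz hL0 hlip
  have hlaw : identifiedLaw s μ = (Measure.pi fun _ : Quotient s => μ).map (classMatrix s) := rfl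
  rw [hlaw, integral_map measurable_classMatrix.aemeasurable
      ((hFm.sub_const _).pow_const 4).aestronglyMeasurable,
    integral_map measurable_classMatrix.aemeasurable hFm.aestronglyMeasurable]
  have hES := integral_central_fourth_moment_le (μ := μ) (F := fun x => F (classMatrix s x))
    (hFm.comp measurable_classMatrix) (C := G)
    (fun x => abs_integral_empiricalSpectralMeasure_le _ hG)
  refine hES.trans ?_
  set P := Measure.pi fun _ : Quotient s => μ.prod μ with hP
  have hint1 (c : Quotient s) : Integrable (fun ω : Quotient s → ℝ × ℝ =>
      ((ω c).2 - (ω c).1) ^ 8) P :=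
    ((measurePreserving_eval (fun _ : Quotient s => μ.prod μ) c).integrable_comp
      (integrable_sub_pow_eight hmom).aestronglyMeasurable).2 (integrable_sub_pow_eight hmom)
  have hval1 (c : Quotient s) : ∫ ω : Quotient s → ℝ × ℝ, ((ω c).2 - (ω c).1) ^ 8 ∂P = m8 := by
    rw [hm8, ← (measurePreserving_eval (fun _ : Quotient s => μ.prod μ) c).map_eq,
      integral_map (measurable_pi_apply c).aemeasurable (by fun_prop)]
  have hint : Integrable (fun ω : Quotient s → ℝ × ℝ => ∑ c, ((ω c).2 - (ω c).1) ^ 8) P :=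
    integrable_finsetSum _ fun c _ => hint1 c
  have hval : ∫ ω : Quotient s → ℝ × ℝ, ∑ c, ((ω c).2 - (ω c).1) ^ 8 ∂P ≤ C * N * m8 := by
    rw [integral_finsetSum _ fun c _ => hint1 c]
    simp only [hval1, Finset.sum_const, Finset.card_univ, nsmul_eq_mul]
    exact mul_le_mul_of_nonneg_right hcard' hm80
  have hpt (ω : Quotient s → ℝ × ℝ) :
      (∑ c, (F (classMatrix s (resample ∅ ω)) - F (classMatrix s (resample {c} ω))) ^ 2) ^ 2 ≤
      8 * (C ^ 2 * L ^ 4 * (Real.sqrt N / 2 + 1 / (2 * Real.sqrt N) *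
        ∑ c, ((ω c).2 - (ω c).1) ^ 8) * (N : ℝ)⁻¹ ^ 2 +
        K ^ 4 * C ^ 5 * (N : ℝ)⁻¹ ^ 3 * ∑ c, ((ω c).2 - (ω c).1) ^ 8) := by
    refine sum_sq_increments_sq_le hN' hcard' _ (fun c => (ω c).2 - (ω c).1) _ (fun c => ?_)
      (sum_sq_sum_spectralFunction_le hs hC hsize' hN hL (resample ∅ ω))
    have := abs_integral_sub_integral_le hs hsize' hN hK0 hquad (resample ∅ ω) (resample {c} ω) c
      (fun c' hc' => by simp [resample, hc'])
    simpa [resample] using this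
  have hle : ∫ ω, (∑ c, (F (classMatrix s (resample ∅ ω)) -
      F (classMatrix s (resample {c} ω))) ^ 2) ^ 2 ∂P ≤
      8 * (C ^ 2 * L ^ 4 * (Real.sqrt N / 2 + 1 / (2 * Real.sqrt N) * (C * N * m8)) *
        (N : ℝ)⁻¹ ^ 2 + K ^ 4 * C ^ 5 * (N : ℝ)⁻¹ ^ 3 * (C * N * m8)) := by
    -- The pointwise bound is affine in the sum of the eighth powers, so integrating it only
    -- requires the mean of that sum.
    have haff (e : ℝ) : 8 * (C ^ 2 * L ^ 4 * (Real.sqrt N / 2 + 1 / (2 * Real.sqrt N) * e) *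
        (N : ℝ)⁻¹ ^ 2 + K ^ 4 * C ^ 5 * (N : ℝ)⁻¹ ^ 3 * e) =
        8 * (C ^ 2 * L ^ 4 * (Real.sqrt N / 2) * (N : ℝ)⁻¹ ^ 2) +
        8 * (C ^ 2 * L ^ 4 * (1 / (2 * Real.sqrt N)) * (N : ℝ)⁻¹ ^ 2 +
          K ^ 4 * C ^ 5 * (N : ℝ)⁻¹ ^ 3) * e := by ring
    simp only [haff] at hpt ⊢
    refine (integral_mono_of_nonneg (.of_forall fun ω => sq_nonneg _)
      ((integrable_const _).add (hint.const_mul _)) (.of_forall hpt)).trans ?_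
    rw [integral_add' (integrable_const _) (hint.const_mul _), integral_const]
    simp only [probReal_univ, smul_eq_mul, one_mul]
    rw [integral_const_mul]
    gcongr
  have hfin : 8 * (C ^ 2 * L ^ 4 * (Real.sqrt N / 2 + 1 / (2 * Real.sqrt N) * (C * N * m8)) *
        (N : ℝ)⁻¹ ^ 2 + K ^ 4 * C ^ 5 * (N : ℝ)⁻¹ ^ 3 * (C * N * m8)) ≤
      8 * (C ^ 2 * L ^ 4 * (1 + C * m8) / 2 + K ^ 4 * C ^ 6 * m8) / (N * Real.sqrt N) := by
    have e1 : 8 * (C ^ 2 * L ^ 4 * (Real.sqrt N / 2 + 1 / (2 * Real.sqrt N) * (C * N * m8)) *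
        (N : ℝ)⁻¹ ^ 2 + K ^ 4 * C ^ 5 * (N : ℝ)⁻¹ ^ 3 * (C * N * m8)) =
        8 * (C ^ 2 * L ^ 4 * (1 + C * m8) / 2) / (N * Real.sqrt N) +
          8 * (K ^ 4 * C ^ 6 * m8) / (N * N) := by
      have hN2 : (N : ℝ) = Real.sqrt N * Real.sqrt N := hRR.symm
      generalize Real.sqrt N = R at *
      rw [hN2]
      field_simp
    have e2 : 8 * (K ^ 4 * C ^ 6 * m8) / (N * N) ≤
        8 * (K ^ 4 * C ^ 6 * m8) / (N * Real.sqrt N) := by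
      have : Real.sqrt N ≤ N := by
        rw [Real.sqrt_le_left hN'.le]; nlinarith
      gcongr
    rw [e1]
    refine (add_le_add_right e2 _).trans (le_of_eq ?_)
    ring
  calc _ ≤ 19 * _ := mul_le_mul_of_nonneg_left (hle.trans hfin) (by norm_num)
    _ = _ := by ring

end FourthMoment

/-! ### From summable fourth moments to almost sure convergence -/

section AlmostSure

/-- By Tonelli the sum of the fourth powers of the deviations has finite mean, hence is almost
surely finite and its terms tend to zero. Only the marginals of the product measure enter. -/
theorem ae_tendsto_of_summable_fourth_moment {X : ℕ → Type*} [∀ n, MeasurableSpace (X n)]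
    (P : ∀ n, Measure (X n)) [∀ n, IsProbabilityMeasure (P n)] {F : ∀ n, X n → ℝ}
    (hF : ∀ n, Measurable (F n)) {G : ℝ} (hG : ∀ n x, |F n x| ≤ G) {a : ℕ → ℝ} (ha : Summable a)
    (hFa : ∀ n, ∫ x, (F n x - ∫ y, F n y ∂(P n)) ^ 4 ∂(P n) ≤ a n) {l : ℝ}
    (hl : Tendsto (fun n => ∫ y, F n y ∂(P n)) atTop (𝓝 l)) :
    ∀ᵐ A ∂(Measure.infinitePi P), Tendsto (fun n => F n (A n)) atTop (𝓝 l) := by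
  set m : ℕ → ℝ := fun n => ∫ y, F n y ∂(P n) with hm
  have ha0 : ∀ n, 0 ≤ a n := fun n => (integral_nonneg fun x => by positivity).trans (hFa n)
  have hmeas (n : ℕ) : Measurable fun x : X n => ENNReal.ofReal ((F n x - m n) ^ 4) :=
    (((hF n).sub_const _).pow_const 4).ennreal_ofReal
  have hmeas' (n : ℕ) : Measurable fun A : ∀ n, X n => ENNReal.ofReal ((F n (A n) - m n) ^ 4) :=
    (hmeas n).comp (measurable_pi_apply n)
  have hterm (n : ℕ) : ∫⁻ A, ENNReal.ofReal ((F n (A n) - m n) ^ 4) ∂(Measure.infinitePi P) ≤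
      ENNReal.ofReal (a n) := by
    have hmp := measurePreserving_eval_infinitePi P n
    have e : ∫⁻ A, ENNReal.ofReal ((F n (A n) - m n) ^ 4) ∂(Measure.infinitePi P) =
        ∫⁻ x, ENNReal.ofReal ((F n x - m n) ^ 4) ∂(P n) := by
      rw [← hmp.map_eq, lintegral_map (hmeas n) hmp.measurable]
    rw [e, ← ofReal_integral_eq_lintegral_ofReal]
    · exact ENNReal.ofReal_le_ofReal (hFa n)
    · refine integrable_of_abs_le (((hF n).sub_const _).pow_const 4)
        (C := (G + |m n|) ^ 4) fun x => ?_
      rw [abs_pow]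
      refine pow_le_pow_left₀ (abs_nonneg _) ((abs_sub _ _).trans ?_) 4
      linarith [hG n x]
    · exact .of_forall fun x => by positivity
  have hsum : ∫⁻ A, ∑' n, ENNReal.ofReal ((F n (A n) - m n) ^ 4) ∂(Measure.infinitePi P) ≠ ⊤ := by
    rw [lintegral_tsum fun n => (hmeas' n).aemeasurable]
    refine ne_top_of_le_ne_top ?_ (ENNReal.tsum_le_tsum hterm)
    rw [← ENNReal.ofReal_tsum_of_nonneg ha0 ha]
    exact ENNReal.ofReal_ne_top
  have hfin := ae_lt_top (Measurable.tsum hmeas') hsum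
  filter_upwards [hfin] with A hA
  have h1 := ENNReal.tendsto_atTop_zero_of_tsum_ne_top hA.ne
  have h2 : Tendsto (fun n => (F n (A n) - m n) ^ 4) atTop (𝓝 0) := by
    have := (ENNReal.tendsto_toReal ENNReal.zero_ne_top).comp h1
    simp only [ENNReal.toReal_zero] at this
    refine this.congr fun n => ?_
    exact ENNReal.toReal_ofReal (by positivity)
  have h3 : Tendsto (fun n => F n (A n) - m n) atTop (𝓝 0) := by
    rw [tendsto_zero_iff_abs_tendsto_zero]
    have h4 := ((Real.continuous_sqrt.comp Real.continuous_sqrt).tendsto 0).comp h2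
    simp only [Function.comp_def, Real.sqrt_zero] at h4
    refine h4.congr fun n => ?_
    rw [show (F n (A n) - m n) ^ 4 = ((F n (A n) - m n) ^ 2) ^ 2 by ring,
      Real.sqrt_sq (sq_nonneg _), Real.sqrt_sq_eq_abs]
    rfl
  have := h3.add hl
  simpa using this

theorem summable_div_mul_sqrt {k : ℕ} (hk : 0 < k) (D : ℝ) :
    Summable fun n : ℕ => D / (((k * (n + 1) : ℕ) : ℝ) * Real.sqrt ((k * (n + 1) : ℕ) : ℝ)) := by
  have hk' : (0 : ℝ) < k := by exact_mod_cast hk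
  have h : Summable fun n : ℕ => 1 / ((n : ℝ) ^ (3 / 2 : ℝ)) :=
    Real.summable_one_div_nat_rpow.2 (by norm_num)
  have h' := ((summable_nat_add_iff 1).2 h).mul_left (D / (k * Real.sqrt k))
  refine h'.congr fun n => ?_
  have hn : (0 : ℝ) < (n : ℝ) + 1 := by positivity
  push_cast
  rw [Real.sqrt_mul hk'.le, show (3 / 2 : ℝ) = 1 + 1 / 2 by norm_num, Real.rpow_add hn,
    Real.rpow_one, ← Real.sqrt_eq_rpow]
  field_simp

end AlmostSure

/-! ### Classes of linked positions -/

section Classes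

variable {k : ℕ} {S : Type*} {f : ZMod k → ZMod k → S} {N : ℕ}

theorem SameEntry.swap {p q : Fin N × Fin N} (h : SameEntry f N p q) :
    SameEntry f N p.swap q.swap := by
  induction h with
  | rel p q h =>
    refine .rel _ _ ?_
    rw [Prod.swap_swap, Prod.swap_swap]
    exact h.symm
  | refl p => exact .refl _
  | symm p q _ ih => exact .symm _ _ ih
  | trans p q r _ _ ih1 ih2 => exact .trans _ _ _ ih1 ih2

theorem linkSetoid_swap (p : Fin N × Fin N) : linkSetoid f N p p.swap :=
  .rel _ _ (Or.inl rfl)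

theorem linkSetoid_of_linked {p q : Fin N × Fin N} (h : Linked f N p q) : linkSetoid f N p q :=
  .rel _ _ (Or.inr h)

theorem linkSetoid_of_sameEntry {p q : Fin N × Fin N} (h : SameEntry f N p q) :
    linkSetoid f N p q := by
  induction h with
  | rel p q h =>
    rcases h with h | h
    · exact linkSetoid_of_linked h
    · exact (linkSetoid f N).trans (linkSetoid_swap p) ((linkSetoid f N).trans
        (linkSetoid_of_linked h) ((linkSetoid f N).symm (linkSetoid_swap q)))
  | refl p => exact (linkSetoid f N).refl p
  | symm p q _ ih => exact (linkSetoid f N).symm ih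
  | trans p q r _ _ ih1 ih2 => exact (linkSetoid f N).trans ih1 ih2

/-- Since `SameEntry` is invariant under transposition, all swaps in a chain can be moved to its
end, where only their parity matters. -/
theorem sameEntry_or_of_linkSetoid {p q : Fin N × Fin N} (h : linkSetoid f N p q) :
    SameEntry f N p q ∨ SameEntry f N p q.swap := by
  change Relation.EqvGen _ p q at h
  induction h with
  | rel p q h =>
    rcases h with rfl | h
    · right; rw [Prod.swap_swap]; exact .refl _
    · exact Or.inl (.rel _ _ (Or.inl h))
  | refl p => exact Or.inl (.refl _)
  | symm p q _ ih =>
    rcases ih with h | h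
    · exact Or.inl (.symm _ _ h)
    · right; have := SameEntry.swap h; rw [Prod.swap_swap] at this; exact .symm _ _ this
  | trans p q r _ _ ih1 ih2 =>
    rcases ih1 with h1 | h1 <;> rcases ih2 with h2 | h2
    · exact Or.inl (.trans _ _ _ h1 h2)
    · exact Or.inr (.trans _ _ _ h1 h2)
    · exact Or.inr (.trans _ _ _ h1 (SameEntry.swap h2))
    · left; have := SameEntry.swap h2; rw [Prod.swap_swap] at this; exact .trans _ _ _ h1 this

theorem isRealEntry_iff_of_sameEntry {p q : Fin N × Fin N} (h : SameEntry f N p q) :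
    IsRealEntry f N p ↔ IsRealEntry f N q :=
  ⟨fun hp => .trans _ _ _ (.symm _ _ h) (.trans _ _ _ hp h.swap),
    fun hq => .trans _ _ _ h (.trans _ _ _ hq (.symm _ _ h.swap))⟩

theorem isRealEntry_swap_iff {p : Fin N × Fin N} :
    IsRealEntry f N p.swap ↔ IsRealEntry f N p := by
  unfold IsRealEntry
  rw [Prod.swap_swap]
  exact ⟨fun h => .symm _ _ h, fun h => .symm _ _ h⟩

theorem isRealEntry_iff_of_linkSetoid {p q : Fin N × Fin N} (h : linkSetoid f N p q) :
    IsRealEntry f N p ↔ IsRealEntry f N q := by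
  rcases sameEntry_or_of_linkSetoid h with h | h
  · exact isRealEntry_iff_of_sameEntry h
  · rw [isRealEntry_iff_of_sameEntry h, isRealEntry_swap_iff]

/-- The element of `Fin N` with a given residue. -/
def finOf [NeZero N] (a : ZMod N) : Fin N := ⟨a.val, ZMod.val_lt a⟩

@[simp]
theorem natCast_finOf [NeZero N] (a : ZMod N) : (((finOf a : Fin N) : ℕ) : ZMod N) = a :=
  ZMod.natCast_zmod_val a

@[simp]
theorem finOf_natCast [NeZero N] (i : Fin N) : finOf ((i : ℕ) : ZMod N) = i := by
  ext
  simp only [finOf]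
  exact ZMod.val_cast_of_lt i.isLt

/-- Positions in a matrix as residues. -/
def finEquivZMod (N : ℕ) [NeZero N] : Fin N ≃ ZMod N where
  toFun i := ((i : ℕ) : ZMod N)
  invFun := finOf
  left_inv := finOf_natCast
  right_inv := natCast_finOf

theorem natCast_fin_injective [NeZero N] {i j : Fin N}
    (h : ((i : ℕ) : ZMod N) = ((j : ℕ) : ZMod N)) : i = j := (finEquivZMod N).injective h

variable [NeZero k] [NeZero N] (hkN : k ∣ N)

/-- Reduction modulo a divisor. -/
abbrev red : ZMod N →+* ZMod k := ZMod.castHom hkN (ZMod k)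

omit [NeZero k] in
theorem natCast_finOf_eq_red (a : ZMod N) : (((finOf a : Fin N) : ℕ) : ZMod k) = red hkN a := by
  conv_rhs => rw [← natCast_finOf a, map_natCast]

variable (f N) in
/-- The class of the position in the row of `p` at the distance `d` from the diagonal. -/
def entryClass (p : Fin k × Fin k) (d : ZMod N) : Quotient (linkSetoid f N) :=
  Quotient.mk _ (finOf ((p.1 : ℕ) : ZMod N), finOf (((p.1 : ℕ) : ZMod N) + d))

/-- The distance `d` occurs among the lifts of the position `p` of the `k × k` matrix. -/
def Compatible (p : Fin k × Fin k) (d : ZMod N) : Prop :=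
  red hkN d = ((p.2 : ℕ) : ZMod k) - ((p.1 : ℕ) : ZMod k)

omit [NeZero k] [NeZero N] in
theorem compatible_swap {p : Fin k × Fin k} {d : ZMod N} :
    Compatible hkN p.swap (-d) ↔ Compatible hkN p d := by
  simp only [Compatible, map_neg, Prod.fst_swap, Prod.snd_swap]
  constructor
  · intro h; linear_combination -h
  · intro h; linear_combination -h

omit [NeZero k] in
include hkN in
theorem mk_eq_mk_of_linked {a b a' b' : ZMod N} (h : a - b = a' - b')
    (hf : f (red hkN a) (red hkN b) = f (red hkN a') (red hkN b')) :
    Quotient.mk (linkSetoid f N) (finOf a, finOf b) =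
      Quotient.mk (linkSetoid f N) (finOf a', finOf b') := by
  refine Quotient.sound (linkSetoid_of_linked ⟨?_, ?_⟩)
  · simpa using h
  · simpa only [natCast_finOf_eq_red hkN] using hf

-- Sliding a position along its wrapped diagonal by multiples of k changes neither link condition,
-- so it can be moved into one of the first k rows.
omit [NeZero k] in
include hkN in
theorem mk_eq_entryClass (i j : Fin N) (p : Fin k × Fin k)
    (h1 : ((p.1 : ℕ) : ZMod k) = ((i : ℕ) : ZMod k)) :
    Quotient.mk (linkSetoid f N) (i, j) =
      entryClass f N p (((j : ℕ) : ZMod N) - ((i : ℕ) : ZMod N)) := by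
  have h := mk_eq_mk_of_linked (f := f) hkN (a := ((i : ℕ) : ZMod N)) (b := ((j : ℕ) : ZMod N))
    (a' := ((p.1 : ℕ) : ZMod N))
    (b' := ((p.1 : ℕ) : ZMod N) + (((j : ℕ) : ZMod N) - ((i : ℕ) : ZMod N))) (by ring)
    (by simp only [map_natCast, map_add, map_sub, h1, add_sub_cancel])
  simpa [entryClass] using h

omit [NeZero k] in
theorem entryClass_swap {p : Fin k × Fin k} {d : ZMod N} (h : Compatible hkN p d) :
    entryClass f N p.swap (-d) = entryClass f N p d := by
  unfold Compatible at h
  unfold entryClass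
  rw [show Quotient.mk (linkSetoid f N)
      (finOf ((p.1 : ℕ) : ZMod N), finOf (((p.1 : ℕ) : ZMod N) + d)) =
      Quotient.mk _ (finOf (((p.1 : ℕ) : ZMod N) + d), finOf ((p.1 : ℕ) : ZMod N)) from
      Quotient.sound (linkSetoid_swap _)]
  refine mk_eq_mk_of_linked hkN (by simp only [Prod.fst_swap]; ring) ?_
  simp only [map_add, map_neg, map_natCast, h, Prod.fst_swap]
  congr 1 <;> ring

-- Identifications in the k × k companion lift to the large matrix at every compatible offset. The
-- equality of differences is proved in the same induction because it carries compatibility along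
-- the chain.
omit [NeZero k] in
theorem SameEntry.sub_eq_and_entryClass_eq {p q : Fin k × Fin k} (h : SameEntry f k p q) :
    ((p.2 : ℕ) : ZMod k) - ((p.1 : ℕ) : ZMod k) = ((q.2 : ℕ) : ZMod k) - ((q.1 : ℕ) : ZMod k) ∧
      ∀ d : ZMod N, Compatible hkN p d → entryClass f N p d = entryClass f N q d := by
  induction h with
  | rel p q h =>
    have hlink : ∀ {p q : Fin k × Fin k}, Linked f k p q → ∀ d : ZMod N, Compatible hkN p d →
        entryClass f N p d = entryClass f N q d := by
      intro p q h d hd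
      have hd' : Compatible hkN q d := by
        unfold Compatible at hd ⊢; rw [hd]; linear_combination -h.1
      unfold Compatible at hd hd'
      refine mk_eq_mk_of_linked hkN (by ring) ?_
      rw [map_add, map_add, map_natCast, map_natCast]
      nth_rw 1 [hd]
      rw [hd', add_sub_cancel, add_sub_cancel]
      exact h.2
    rcases h with h | h
    · exact ⟨by linear_combination -h.1, hlink h⟩
    · have h1 := h.1
      simp only [Prod.fst_swap, Prod.snd_swap] at h1
      refine ⟨h1, fun d hd => ?_⟩
      have hd' : Compatible hkN q d := by
        unfold Compatible at hd ⊢; rw [hd]; exact h1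
      rw [← entryClass_swap hkN hd, ← entryClass_swap hkN hd']
      exact hlink h _ ((compatible_swap hkN).2 hd)
  | refl p => exact ⟨rfl, fun _ _ => rfl⟩
  | symm p q _ ih =>
    refine ⟨ih.1.symm, fun d hd => (ih.2 d ?_).symm⟩
    unfold Compatible at hd ⊢; rw [hd, ih.1]
  | trans p q r _ _ ih1 ih2 =>
    refine ⟨ih1.1.trans ih2.1, fun d hd => (ih1.2 d hd).trans (ih2.2 d ?_)⟩
    unfold Compatible at hd ⊢; rw [hd, ih1.1]

/-- Reduction of positions. -/
def reducePos (P : Fin N × Fin N) : Fin k × Fin k :=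
  (finOf ((P.1 : ℕ) : ZMod k), finOf ((P.2 : ℕ) : ZMod k))

/-- Signed distance of a position from the diagonal. -/
def offset (P : Fin N × Fin N) : ZMod N := ((P.2 : ℕ) : ZMod N) - ((P.1 : ℕ) : ZMod N)

-- Converse direction: identifications in the large matrix descend modulo k, and in addition they
-- preserve the offset modulo N.
omit [NeZero N] in
include hkN in
theorem SameEntry.reducePos {P Q : Fin N × Fin N} (h : SameEntry f N P Q) :
    SameEntry f k (reducePos P) (reducePos Q) ∧ offset P = offset Q := by
  have hlink : ∀ {P Q : Fin N × Fin N}, Linked f N P Q →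
      Linked f k (PeriodicEnsemble.reducePos P) (PeriodicEnsemble.reducePos Q) := by
    intro P Q h
    have h1 := congrArg (red hkN) h.1
    simp only [map_sub, map_natCast] at h1
    refine ⟨?_, ?_⟩
    · simpa [PeriodicEnsemble.reducePos] using h1
    · simpa [PeriodicEnsemble.reducePos] using h.2
  induction h with
  | rel P Q h =>
    rcases h with h | h
    · exact ⟨.rel _ _ (Or.inl (hlink h)), by unfold offset; linear_combination -h.1⟩
    · refine ⟨.rel _ _ (Or.inr (hlink h)), ?_⟩
      have := h.1
      simpa [offset] using this
  | refl P => exact ⟨.refl _, rfl⟩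
  | symm P Q _ ih => exact ⟨.symm _ _ ih.1, ih.2.symm⟩
  | trans P Q R _ _ ih1 ih2 => exact ⟨.trans _ _ _ ih1.1 ih2.1, ih1.2.trans ih2.2⟩

include hkN in
theorem entryClass_eq_entryClass {p q : Fin k × Fin k} {d e : ZMod N}
    (hd : Compatible hkN p d) (he : Compatible hkN q e)
    (h : entryClass f N p d = entryClass f N q e) :
    (SameEntry f k p q ∧ d = e) ∨ (SameEntry f k p q.swap ∧ d = -e) := by
  have hred : ∀ {p : Fin k × Fin k} {d : ZMod N}, Compatible hkN p d →
      reducePos (k := k) (finOf ((p.1 : ℕ) : ZMod N), finOf (((p.1 : ℕ) : ZMod N) + d)) = p := by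
    intro p d hd
    unfold Compatible at hd
    ext1
    · simp only [reducePos, natCast_finOf_eq_red hkN, map_natCast, finOf_natCast]
    · simp only [reducePos, natCast_finOf_eq_red hkN, map_add, map_natCast, hd, add_sub_cancel,
        finOf_natCast]
  have hoff : ∀ (p : Fin k × Fin k) (d : ZMod N),
      offset (finOf ((p.1 : ℕ) : ZMod N), finOf (((p.1 : ℕ) : ZMod N) + d)) = d := by
    intro p d
    simp [offset]
  rcases sameEntry_or_of_linkSetoid (Quotient.exact h) with h | h
  · have := SameEntry.reducePos hkN h
    rw [hred hd, hred he, hoff, hoff] at this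
    exact Or.inl this
  · have := SameEntry.reducePos hkN h
    have h2 : reducePos (k := k)
      (finOf ((q.1 : ℕ) : ZMod N), finOf (((q.1 : ℕ) : ZMod N) + e)).swap = q.swap := by
      conv_rhs => rw [← hred he]
      rfl
    have h3 : offset (finOf ((q.1 : ℕ) : ZMod N), finOf (((q.1 : ℕ) : ZMod N) + e)).swap = -e := by
      simp [offset]
    rw [hred hd, h2, hoff, h3] at this
    exact Or.inr this

-- This is the full list of coincidences among the variables occurring in the blocks. It decides
-- which terms of a linear functional are independent, and it is where real positions start to
-- differ from complex ones.
include hkN in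
theorem entryClass_out_eq_iff {q q' : Quotient (linkSetoid f k)} {d e : ZMod N}
    (hd : Compatible hkN q.out d) (he : Compatible hkN q'.out e) :
    entryClass f N q.out d = entryClass f N q'.out e ↔
      q = q' ∧ (d = e ∨ (IsRealEntry f k q.out ∧ d = -e)) := by
  constructor
  · intro h
    have hq : ∀ {a b : Fin k × Fin k}, linkSetoid f k a b →
        Quotient.mk (linkSetoid f k) a = Quotient.mk _ b := fun h => Quotient.sound h
    rcases entryClass_eq_entryClass hkN hd he h with ⟨h1, h2⟩ | ⟨h1, h2⟩
    · refine ⟨?_, Or.inl h2⟩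
      rw [← q.out_eq, ← q'.out_eq]
      exact hq (linkSetoid_of_sameEntry h1)
    · have hqq : q = q' := by
        rw [← q.out_eq, ← q'.out_eq]
        refine (hq (linkSetoid_of_sameEntry h1)).trans (hq ?_)
        exact (linkSetoid f k).symm (linkSetoid_swap _)
      subst hqq
      exact ⟨rfl, Or.inr ⟨h1, h2⟩⟩
  · rintro ⟨rfl, rfl | ⟨hr, rfl⟩⟩
    · rfl
    · have h1 : SameEntry f k q.out q.out.swap := hr
      rw [(SameEntry.sub_eq_and_entryClass_eq hkN h1).2 _ hd, entryClass_swap hkN he]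

-- All positions of a class have one of two opposite offsets, and a row together with an offset
-- determines the column.
include hkN in
theorem ncard_class_le (c : Quotient (linkSetoid f N)) :
    {P | Quotient.mk (linkSetoid f N) P = c}.ncard ≤ 2 * N := by
  classical
  rw [← c.out_eq]
  have hinj : Set.InjOn (fun P : Fin N × Fin N => (P.1, decide (offset P = offset c.out)))
      {P | Quotient.mk (linkSetoid f N) P = Quotient.mk _ c.out} := by
    have hoff : ∀ P ∈ {P | Quotient.mk (linkSetoid f N) P = Quotient.mk _ c.out},
        offset P = offset c.out ∨ offset P = -offset c.out := by
      intro P hP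
      rcases sameEntry_or_of_linkSetoid (Quotient.exact hP) with h | h
      · exact Or.inl (SameEntry.reducePos hkN h).2
      · right
        rw [(SameEntry.reducePos hkN h).2]
        simp [offset]
    intro P hP Q hQ h
    simp only [Prod.mk.injEq, decide_eq_decide] at h
    have hPQ : offset P = offset Q := by
      by_cases hc : offset P = offset c.out
      · rw [hc, h.2.1 hc]
      · rw [(hoff P hP).resolve_left hc, (hoff Q hQ).resolve_left (fun h' => hc (h.2.2 h'))]
    refine Prod.ext h.1 (natCast_fin_injective ?_)
    unfold offset at hPQ
    rw [h.1] at hPQ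
    exact sub_left_injective hPQ
  have h := Set.ncard_le_ncard_of_injOn _ (fun P _ => Set.mem_univ _) hinj
  refine h.trans (le_of_eq ?_)
  rw [Set.ncard_univ, Nat.card_eq_fintype_card, Fintype.card_prod, Fintype.card_bool,
    Fintype.card_fin, mul_comm]

include hkN in
theorem card_classes_le : Nat.card (Quotient (linkSetoid f N)) ≤ k ^ 2 * N := by
  have hsurj : Function.Surjective fun x : (Fin k × Fin k) × ZMod N => entryClass f N x.1 x.2 := by
    intro c
    induction c using Quotient.inductionOn with
    | h P =>
      refine ⟨(reducePos P, offset P), ?_⟩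
      refine (mk_eq_entryClass hkN P.1 P.2 (reducePos P) ?_).symm
      simp [reducePos]
  refine (Nat.card_le_card_of_surjective _ hsurj).trans (le_of_eq ?_)
  rw [Nat.card_prod, Nat.card_prod, Nat.card_zmod, Nat.card_eq_fintype_card, Fintype.card_fin,
    pow_two]

end Classes

/-! ### Block diagonalization by the Fourier transform -/

section Companion

variable {k : ℕ} {S : Type*} {f : ZMod k → ZMod k → S} {N : ℕ}

theorem isRealEntry_of_sameEntry_of_sameEntry {p q : Fin N × Fin N} (h1 : SameEntry f N p q)
    (h2 : SameEntry f N p.swap q) : IsRealEntry f N p :=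
  .trans _ _ _ h1 (.symm _ _ h2)

theorem linkSetoid_out (p : Fin N × Fin N) :
    linkSetoid f N p (Quotient.mk (linkSetoid f N) p).out :=
  (linkSetoid f N).symm (Quotient.mk_out p)

theorem mk_swap (p : Fin N × Fin N) :
    Quotient.mk (linkSetoid f N) p.swap = Quotient.mk (linkSetoid f N) p :=
  Quotient.sound ((linkSetoid f N).symm (linkSetoid_swap p))

/-- For a complex entry exactly one of p and its transpose agrees with the representative; this
makes the conjugation convention of `companionMatrix` Hermitian. -/
theorem sameEntry_swap_out_iff {p : Fin N × Fin N} (hp : ¬ IsRealEntry f N p) :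
    SameEntry f N p.swap (Quotient.mk (linkSetoid f N) p).out ↔
      ¬ SameEntry f N p (Quotient.mk (linkSetoid f N) p).out := by
  constructor
  · intro h1 h2
    exact hp (isRealEntry_of_sameEntry_of_sameEntry h2 h1)
  · intro h
    have := (sameEntry_or_of_linkSetoid (linkSetoid_out (f := f) p)).resolve_left h
    simpa using this.swap

theorem companionMatrix_apply_of_real {p : Fin N × Fin N} (hp : IsRealEntry f N p)
    (ω : Quotient (linkSetoid f N) → ℝ × ℝ) :
    companionMatrix f N ω p.1 p.2 = ((ω (Quotient.mk _ p)).1 : ℂ) := by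
  simp only [companionMatrix, Matrix.of_apply, Prod.mk.eta, if_pos hp]

theorem companionMatrix_apply_of_sameEntry {p : Fin N × Fin N} (hp : ¬ IsRealEntry f N p)
    (h : SameEntry f N p (Quotient.mk (linkSetoid f N) p).out)
    (ω : Quotient (linkSetoid f N) → ℝ × ℝ) :
    companionMatrix f N ω p.1 p.2 = toComplexGaussian (ω (Quotient.mk _ p)) := by
  simp only [companionMatrix, Matrix.of_apply, Prod.mk.eta, if_neg hp, if_pos h]

theorem companionMatrix_apply_of_not_sameEntry {p : Fin N × Fin N} (hp : ¬ IsRealEntry f N p)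
    (h : ¬ SameEntry f N p (Quotient.mk (linkSetoid f N) p).out)
    (ω : Quotient (linkSetoid f N) → ℝ × ℝ) :
    companionMatrix f N ω p.1 p.2 = star (toComplexGaussian (ω (Quotient.mk _ p))) := by
  simp only [companionMatrix, Matrix.of_apply, Prod.mk.eta, if_neg hp, if_neg h]

theorem isHermitian_companionMatrix (ω : Quotient (linkSetoid f N) → ℝ × ℝ) :
    (companionMatrix f N ω).IsHermitian := by
  ext i j
  rw [Matrix.conjTranspose_apply]
  change star (companionMatrix f N ω (i, j).swap.1 (i, j).swap.2) =
    companionMatrix f N ω (i, j).1 (i, j).2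
  generalize (i, j) = p
  by_cases hp : IsRealEntry f N p
  · rw [companionMatrix_apply_of_real hp, companionMatrix_apply_of_real (isRealEntry_swap_iff.2 hp),
      mk_swap]
    simp
  · have hp' : ¬ IsRealEntry f N p.swap := fun h => hp (isRealEntry_swap_iff.1 h)
    by_cases h : SameEntry f N p (Quotient.mk (linkSetoid f N) p).out
    · rw [companionMatrix_apply_of_sameEntry hp h, companionMatrix_apply_of_not_sameEntry hp' ?_,
        mk_swap, star_star]
      rw [mk_swap, sameEntry_swap_out_iff hp]
      exact not_not.2 h
    · rw [companionMatrix_apply_of_not_sameEntry hp h, companionMatrix_apply_of_sameEntry hp' ?_,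
        mk_swap]
      rw [mk_swap, sameEntry_swap_out_iff hp]
      exact h

end Companion

/-! ### Characters of Z/kn and the Fourier blocks -/

section Fourier

variable {k n : ℕ} [NeZero k] [NeZero n] {S : Type*} (f : ZMod k → ZMod k → S)

/-- The residues in `ZMod (k * n)` over a residue modulo `k`. -/
def fiber (k n : ℕ) [NeZero k] [NeZero n] (a : ZMod k) : Finset (ZMod (k * n)) :=
  Finset.univ.filter fun d => red (Dvd.intro n rfl : k ∣ k * n) d = a

theorem mem_fiber {a : ZMod k} {d : ZMod (k * n)} :
    d ∈ fiber k n a ↔ red (Dvd.intro n rfl : k ∣ k * n) d = a := by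
  rw [fiber, Finset.mem_filter]
  simp only [Finset.mem_univ, true_and]

theorem sum_fiber_add {M : Type*} [AddCommMonoid M] (a : ZMod k) (c : ZMod (k * n))
    (F : ZMod (k * n) → M) :
    ∑ d ∈ fiber k n a, F (d + c) =
      ∑ d ∈ fiber k n (a + red (Dvd.intro n rfl : k ∣ k * n) c), F d := by
  refine Finset.sum_equiv (Equiv.addRight c) (fun d => ?_) (fun d _ => rfl)
  simp [mem_fiber]

theorem sum_fiber_neg {M : Type*} [AddCommMonoid M] (a : ZMod k)
    (F : ZMod (k * n) → M) :
    ∑ d ∈ fiber k n a, F (-d) = ∑ d ∈ fiber k n (-a), F d := by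
  refine Finset.sum_equiv (Equiv.neg _) (fun d => ?_) (fun d _ => rfl)
  simp [mem_fiber]

omit [NeZero k] [NeZero n] in
theorem red_natCast_self : red (Dvd.intro n rfl : k ∣ k * n) ((k : ℕ) : ZMod (k * n)) = 0 := by
  rw [map_natCast, ZMod.natCast_self]

/-- The k fibers are translates of one another and partition a set of kn elements. -/
theorem card_fiber (a : ZMod k) : (fiber k n a).card = n := by
  have hconst : ∀ b : ZMod k, (fiber k n b).card = (fiber k n (0 : ZMod k)).card := by
    intro b
    have h := sum_fiber_add (k := k) (n := n) 0 (((b.val : ℕ)) : ZMod (k * n)) (fun _ => 1)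
    simp only [Finset.sum_const, smul_eq_mul, mul_one, zero_add] at h
    rw [map_natCast, ZMod.natCast_zmod_val] at h
    exact h.symm
  have htot := Finset.card_eq_sum_card_fiberwise (s := (Finset.univ : Finset (ZMod (k * n))))
    (t := (Finset.univ : Finset (ZMod k))) (f := red (Dvd.intro n rfl : k ∣ k * n))
    (fun _ _ => Finset.mem_coe.2 (Finset.mem_univ _))
  have htot' : k * n = ∑ b : ZMod k, (fiber k n b).card := by
    rw [Finset.card_univ, ZMod.card] at htot
    exact htot
  simp only [hconst, Finset.sum_const, Finset.card_univ, ZMod.card, smul_eq_mul] at htot'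
  rw [hconst a]
  exact (Nat.eq_of_mul_eq_mul_left (NeZero.pos k) htot').symm

/-- The standard additive character of `ZMod (k * n)`. -/
abbrev chi (k n : ℕ) [NeZero k] [NeZero n] : AddChar (ZMod (k * n)) ℂ := ZMod.stdAddChar

theorem norm_chi (a : ZMod (k * n)) : ‖chi k n a‖ = 1 := AddChar.norm_apply _ _

theorem chi_neg (a : ZMod (k * n)) : chi k n (-a) = star (chi k n a) :=
  AddChar.map_neg_eq_conj _ _

/-- A fiber is invariant under translation by k, which multiplies the sum by χ(bk) ≠ 1. -/
theorem sum_fiber_chi (a : ZMod k) (b : ZMod (k * n)) (hb : b * (k : ℕ) ≠ 0) :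
    ∑ d ∈ fiber k n a, chi k n (b * d) = 0 := by
  have h := sum_fiber_add a ((k : ℕ) : ZMod (k * n)) (fun d => chi k n (b * d))
  rw [red_natCast_self, add_zero] at h
  simp only [mul_add, AddChar.map_add_eq_mul] at h
  rw [← Finset.sum_mul] at h
  have hne : chi k n (b * (k : ℕ)) ≠ 1 := by
    intro h1
    apply hb
    apply ZMod.injective_stdAddChar (N := k * n)
    rw [h1, AddChar.map_zero_eq_one]
  have h2 : (∑ d ∈ fiber k n a, chi k n (b * d)) * (chi k n (b * (k : ℕ)) - 1) = 0 := by
    rw [mul_sub, h, mul_one, sub_self]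
  exact (mul_eq_zero.1 h2).resolve_right (sub_ne_zero.2 hne)

omit [NeZero n] in
theorem natCast_mul_self_eq_zero_iff (r : ℕ) :
    ((r : ℕ) : ZMod (k * n)) * (k : ℕ) = 0 ↔ n ∣ r := by
  rw [← Nat.cast_mul, ZMod.natCast_eq_zero_iff, mul_comm r k]
  exact Nat.mul_dvd_mul_iff_left (NeZero.pos k)

/-- The blocks of the Fourier transform of the matrix given by `x`. -/
def blockMatrix (x : Quotient (linkSetoid f (k * n)) → ℝ) (r : ZMod (k * n)) :
    Matrix (Fin k) (Fin k) ℂ :=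
  Matrix.of fun l m => ∑ d ∈ fiber k n (((m : ℕ) : ZMod k) - ((l : ℕ) : ZMod k)),
    (x (entryClass f (k * n) (l, m) d) : ℂ) * chi k n (r * d)

variable {f} {x : Quotient (linkSetoid f (k * n)) → ℝ} {r : ZMod (k * n)}

/-- With `blockMatrix_swap`, this says that the blocks obey the restrictions of the companion
ensemble for every x, not merely in law. -/
theorem blockMatrix_eq_of_sameEntry {p q : Fin k × Fin k} (h : SameEntry f k p q) :
    blockMatrix f x r p.1 p.2 = blockMatrix f x r q.1 q.2 := by
  have h' := SameEntry.sub_eq_and_entryClass_eq (Dvd.intro n rfl : k ∣ k * n) h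
  simp only [blockMatrix, Matrix.of_apply, Prod.mk.eta]
  rw [h'.1]
  refine Finset.sum_congr rfl fun d hd => ?_
  rw [h'.2 d]
  rw [mem_fiber] at hd
  unfold Compatible
  rw [hd, h'.1]

theorem blockMatrix_swap (p : Fin k × Fin k) :
    blockMatrix f x r p.2 p.1 = star (blockMatrix f x r p.1 p.2) := by
  simp only [blockMatrix, Matrix.of_apply, star_sum, Prod.mk.eta]
  rw [← neg_sub, ← sum_fiber_neg]
  refine Finset.sum_congr rfl fun d hd => ?_
  have hd' : Compatible (Dvd.intro n rfl : k ∣ k * n) p d := mem_fiber.1 hd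
  have := entryClass_swap (f := f) _ hd'
  rw [show (p.2, p.1) = p.swap from rfl, this, mul_neg, chi_neg, star_mul', RCLike.star_def,
    Complex.conj_ofReal]

variable (f) in
/-- Normalized coordinates of the blocks of the Fourier transform. -/
def blockCoord (x : Quotient (linkSetoid f (k * n)) → ℝ) (r : ZMod (k * n))
    (q : Quotient (linkSetoid f k)) : ℝ × ℝ :=
  open scoped Classical in
  if IsRealEntry f k q.out then
    ((blockMatrix f x r q.out.1 q.out.2).re / Real.sqrt n, 0)
  else (Real.sqrt 2 * (blockMatrix f x r q.out.1 q.out.2).re / Real.sqrt n,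
    Real.sqrt 2 * (blockMatrix f x r q.out.1 q.out.2).im / Real.sqrt n)

theorem sqrt_mul_toComplexGaussian (z : ℂ) :
    (Real.sqrt n : ℂ) * toComplexGaussian
      (Real.sqrt 2 * z.re / Real.sqrt n, Real.sqrt 2 * z.im / Real.sqrt n) = z := by
  have hn : ((Real.sqrt n : ℝ) : ℂ) ≠ 0 := by
    rw [Ne, Complex.ofReal_eq_zero]
    exact (Real.sqrt_pos.2 (by exact_mod_cast NeZero.pos n)).ne'
  have h2 : ((Real.sqrt 2 : ℝ) : ℂ) ≠ 0 := by
    rw [Ne, Complex.ofReal_eq_zero]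
    exact (Real.sqrt_pos.2 (by norm_num)).ne'
  unfold toComplexGaussian
  push_cast
  conv_rhs => rw [← Complex.re_add_im z]
  field_simp

/-- A matrix obeying the companion restrictions is determined by its entries at the class
representatives, and `blockCoord` reads off exactly these. Being an identity for every x, it leaves
only the law of `blockCoord` to be studied. -/
theorem blockMatrix_eq_smul_companionMatrix :
    blockMatrix f x r = (Real.sqrt n : ℂ) • companionMatrix f k (blockCoord f x r) := by
  ext i j
  rw [Matrix.smul_apply, smul_eq_mul]
  change blockMatrix f x r (i, j).1 (i, j).2 =
    _ * companionMatrix f k (blockCoord f x r) (i, j).1 (i, j).2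
  generalize (i, j) = p
  have hreal := isRealEntry_iff_of_linkSetoid (linkSetoid_out (f := f) p)
  have hn : ((Real.sqrt n : ℝ) : ℂ) ≠ 0 := by
    rw [Ne, Complex.ofReal_eq_zero]
    exact (Real.sqrt_pos.2 (by exact_mod_cast NeZero.pos n)).ne'
  have hout : SameEntry f k p (Quotient.mk (linkSetoid f k) p).out ∨
      SameEntry f k p (Quotient.mk (linkSetoid f k) p).out.swap :=
    sameEntry_or_of_linkSetoid (linkSetoid_out (f := f) p)
  by_cases hp : IsRealEntry f k p
  · rw [companionMatrix_apply_of_real hp]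
    simp only [blockCoord, if_pos (hreal.1 hp)]
    have h1 : blockMatrix f x r p.1 p.2 = blockMatrix f x r
        (Quotient.mk (linkSetoid f k) p).out.1 (Quotient.mk (linkSetoid f k) p).out.2 := by
      rcases hout with h | h
      · exact blockMatrix_eq_of_sameEntry h
      · exact (blockMatrix_eq_of_sameEntry h).trans
          (blockMatrix_eq_of_sameEntry (hreal.1 hp)).symm
    have h2 : star (blockMatrix f x r p.1 p.2) = blockMatrix f x r p.1 p.2 := by
      rw [← blockMatrix_swap]
      exact (blockMatrix_eq_of_sameEntry (show SameEntry f k p p.swap from hp)).symm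
    rw [← h1]
    push_cast
    rw [Complex.conj_eq_iff_re.1 h2]
    field_simp
  · by_cases h : SameEntry f k p (Quotient.mk (linkSetoid f k) p).out
    · rw [companionMatrix_apply_of_sameEntry hp h]
      simp only [blockCoord, if_neg (fun h' => hp (hreal.2 h'))]
      rw [sqrt_mul_toComplexGaussian, blockMatrix_eq_of_sameEntry h]
    · rw [companionMatrix_apply_of_not_sameEntry hp h]
      simp only [blockCoord, if_neg (fun h' => hp (hreal.2 h'))]
      have hs : (Real.sqrt n : ℂ) = star (Real.sqrt n : ℂ) := by
        rw [RCLike.star_def, Complex.conj_ofReal]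
      rw [hs, ← star_mul', sqrt_mul_toComplexGaussian, ← blockMatrix_swap,
        blockMatrix_eq_of_sameEntry (hout.resolve_left h)]
      rfl

end Fourier

/-! ### Comparison of spectra through characteristic polynomials -/

section Charpoly

open Polynomial

theorem charpoly_smul_of_isHermitian {m : Type*} [Fintype m] [DecidableEq m] {C : Matrix m m ℂ}
    (hC : C.IsHermitian) (c : ℂ) :
    (c • C).charpoly = ∏ i, (X - Polynomial.C (c * (hC.eigenvalues i : ℂ))) := by
  conv_lhs => rw [hC.spectral_theorem, Unitary.conjStarAlgAut_apply, ← smul_mul_assoc,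
    Matrix.charpoly_mul_comm, ← mul_smul_comm, ← mul_assoc, ← Matrix.diagonal_smul]
  rw [show star (hC.eigenvectorUnitary : Matrix m m ℂ) * (hC.eigenvectorUnitary : Matrix m m ℂ) = 1
    from Unitary.coe_star_mul_self _, one_mul, Matrix.charpoly_diagonal]
  rfl

theorem charpoly_blockDiagonal {m o : Type*} [Fintype m] [DecidableEq m] [Fintype o]
    [DecidableEq o] (B : o → Matrix m m ℂ) :
    (Matrix.blockDiagonal B).charpoly = ∏ r, (B r).charpoly := by
  rw [Matrix.charpoly, show (Matrix.blockDiagonal B).charmatrix =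
    Matrix.blockDiagonal fun r => (B r).charmatrix from ?_, Matrix.det_blockDiagonal]
  · rfl
  · ext ⟨i, r⟩ ⟨j, r'⟩ : 2
    simp only [Matrix.charmatrix_apply, Matrix.blockDiagonal_apply, Matrix.diagonal_apply,
      Prod.mk.injEq]
    by_cases hr : r = r' <;> by_cases hi : i = j <;> simp [hr, hi]

/-- The two matrices have different index types, so similarity is replaced by the invariance of the
characteristic polynomial under cyclic permutation of products. -/
theorem charpoly_eq_of_intertwining {m o : Type*} [Fintype m] [DecidableEq m] [Fintype o]
    [DecidableEq o] (e : m ≃ o) {A : Matrix m m ℂ} {D : Matrix o o ℂ} {V : Matrix m o ℂ}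
    {W : Matrix o m ℂ} (hWV : W * V = 1) (hAV : A * V = V * D) : A.charpoly = D.charpoly := by
  have hVW : V * W = 1 := (Matrix.mul_eq_one_comm_of_equiv e.symm).1 hWV
  have hA : A = V * D * W := by rw [← hAV, Matrix.mul_assoc, hVW, Matrix.mul_one]
  have hcard := Fintype.card_congr e
  rw [hA, Matrix.charpoly_mul_comm_of_le _ _ hcard.ge, hcard, Nat.sub_self, pow_zero, one_mul,
    ← Matrix.mul_assoc, hWV, Matrix.one_mul]

/-- The multisets of roots agree, so spectral sums can be compared without matching the two
orderings of eigenvalues. -/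
theorem sum_eq_sum_of_prod_X_sub_C_eq {ι κ : Type*} [Fintype ι] [Fintype κ] {a : ι → ℝ} {b : κ → ℝ}
    (h : ∏ i, (X - Polynomial.C (a i : ℂ)) = ∏ j, (X - Polynomial.C (b j : ℂ))) (g : ℝ → ℝ) :
    ∑ i, g (a i) = ∑ j, g (b j) := by
  have h' := congrArg Polynomial.roots h
  rw [Polynomial.roots_prod _ _ (Finset.prod_ne_zero_iff.2 fun _ _ => X_sub_C_ne_zero _),
    Polynomial.roots_prod _ _ (Finset.prod_ne_zero_iff.2 fun _ _ => X_sub_C_ne_zero _)] at h'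
  simp only [roots_X_sub_C, Multiset.bind_singleton] at h'
  have h2 := congrArg (fun s => (Multiset.map (fun z : ℂ => g z.re) s).sum) h'
  simpa using h2

end Charpoly

/-! ### Block diagonalization of linked matrices -/

section Fourier

variable {k n : ℕ} [NeZero k] [NeZero n] {S : Type*} {f : ZMod k → ZMod k → S}

variable (k n) in
/-- The Fourier basis restricted to residue classes. -/
def fourierMatrix : Matrix (Fin (k * n)) (Fin k × Fin n) ℂ :=
  Matrix.of fun j p => if ((j : ℕ) : ZMod k) = ((p.1 : ℕ) : ZMod k) then
    chi k n (((p.2 : ℕ) : ZMod (k * n)) * ((j : ℕ) : ZMod (k * n))) else 0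

theorem sum_ite_natCast_eq {M : Type*} [AddCommMonoid M] (a : ZMod k) (F : ZMod (k * n) → M) :
    ∑ j : Fin (k * n), (if ((j : ℕ) : ZMod k) = a then F ((j : ℕ) : ZMod (k * n)) else 0) =
      ∑ d ∈ fiber k n a, F d := by
  rw [fiber, Finset.sum_filter]
  refine Fintype.sum_equiv (finEquivZMod (k * n)) _ _ fun j => ?_
  change _ = if red (Dvd.intro n rfl : k ∣ k * n) ((j : ℕ) : ZMod (k * n)) = a then _ else _
  rw [map_natCast]
  rfl

/-- Columns over distinct residues have disjoint supports. Over the same residue they are orthogonal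
by `sum_fiber_chi`, since distinct r, r' < n give rk and r'k distinct modulo kn. -/
theorem conjTranspose_fourierMatrix_mul :
    (fourierMatrix k n).conjTranspose * fourierMatrix k n = (n : ℂ) • 1 := by
  ext ⟨m, r⟩ ⟨m', r'⟩
  rw [Matrix.mul_apply, Matrix.smul_apply, Matrix.one_apply]
  simp only [Matrix.conjTranspose_apply, fourierMatrix, Matrix.of_apply]
  by_cases hm : m = m'
  · subst hm
    have h1 : ∀ j : Fin (k * n),
        (star (if ((j : ℕ) : ZMod k) = ((m : ℕ) : ZMod k) then
          chi k n (((r : ℕ) : ZMod (k * n)) * ((j : ℕ) : ZMod (k * n))) else 0) *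
        if ((j : ℕ) : ZMod k) = ((m : ℕ) : ZMod k) then
          chi k n (((r' : ℕ) : ZMod (k * n)) * ((j : ℕ) : ZMod (k * n))) else 0) =
        if ((j : ℕ) : ZMod k) = ((m : ℕ) : ZMod k) then
          chi k n ((((r' : ℕ) : ZMod (k * n)) - ((r : ℕ) : ZMod (k * n))) *
            ((j : ℕ) : ZMod (k * n))) else 0 := by
      intro j
      by_cases hj : ((j : ℕ) : ZMod k) = ((m : ℕ) : ZMod k)
      · rw [if_pos hj, if_pos hj, if_pos hj, ← chi_neg, ← AddChar.map_add_eq_mul]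
        congr 1
        ring
      · rw [if_neg hj, if_neg hj, if_neg hj, mul_zero]
    rw [Finset.sum_congr rfl fun j _ => h1 j, sum_ite_natCast_eq ((m : ℕ) : ZMod k)
      (fun d => chi k n ((((r' : ℕ) : ZMod (k * n)) - ((r : ℕ) : ZMod (k * n))) * d))]
    by_cases hr : r = r'
    · subst hr
      simp [card_fiber]
    · rw [if_neg (by simpa using hr), smul_zero]
      refine sum_fiber_chi _ _ fun h => hr ?_
      have h2 : ((r' : ℕ) : ZMod (k * n)) * (k : ℕ) = ((r : ℕ) : ZMod (k * n)) * (k : ℕ) := by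
        linear_combination h
      rw [← Nat.cast_mul, ← Nat.cast_mul, ZMod.natCast_eq_natCast_iff', mul_comm (r' : ℕ),
        mul_comm (r : ℕ), Nat.mod_eq_of_lt (Nat.mul_lt_mul_of_pos_left r'.2 (NeZero.pos k)),
        Nat.mod_eq_of_lt (Nat.mul_lt_mul_of_pos_left r.2 (NeZero.pos k))] at h2
      exact Fin.ext (Nat.eq_of_mul_eq_mul_left (NeZero.pos k) h2).symm
  · rw [if_neg (by simp [hm]), smul_zero]
    refine Finset.sum_eq_zero fun j _ => ?_
    by_cases hj : ((j : ℕ) : ZMod k) = ((m : ℕ) : ZMod k)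
    · rw [if_neg (fun h => hm (natCast_fin_injective (hj.symm.trans h))), mul_zero]
    · rw [if_neg hj, star_zero, zero_mul]

/-- Row i of the matrix depends only on i mod k and on the offset d = j - i. Substituting j = d + i
in the sum factors out χ(ri), which is the Fourier entry in row i, and leaves the entry of block r.
-/
theorem classMatrix_mul_fourierMatrix (x : Quotient (linkSetoid f (k * n)) → ℝ) :
    (classMatrix (linkSetoid f (k * n)) x).map (algebraMap ℝ ℂ) * fourierMatrix k n =
      fourierMatrix k n *
        Matrix.blockDiagonal fun r : Fin n => blockMatrix f x ((r : ℕ) : ZMod (k * n)) := by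
  ext i ⟨m, r⟩
  obtain ⟨l, hl⟩ : ∃ l : Fin k, ((l : ℕ) : ZMod k) = ((i : ℕ) : ZMod k) :=
    ⟨finOf ((i : ℕ) : ZMod k), natCast_finOf _⟩
  rw [Matrix.mul_apply, Matrix.mul_apply, Fintype.sum_prod_type]
  have hR : ∀ l' : Fin k, ∑ r' : Fin n, fourierMatrix k n i (l', r') *
      Matrix.blockDiagonal (fun r : Fin n => blockMatrix f x ((r : ℕ) : ZMod (k * n)))
        (l', r') (m, r) =
      fourierMatrix k n i (l', r) * blockMatrix f x ((r : ℕ) : ZMod (k * n)) l' m := by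
    intro l'
    rw [Finset.sum_eq_single r]
    · rw [Matrix.blockDiagonal_apply, if_pos rfl]
    · intro r' _ hr'
      rw [Matrix.blockDiagonal_apply, if_neg hr', mul_zero]
    · simp
  rw [Finset.sum_congr rfl fun l' _ => hR l', Finset.sum_eq_single l]
  rotate_left
  · intro l' _ hl'
    simp only [fourierMatrix, Matrix.of_apply]
    rw [if_neg (fun h => hl' (natCast_fin_injective (h.symm.trans hl.symm))), zero_mul]
  · simp
  simp only [fourierMatrix, Matrix.of_apply, if_pos hl.symm, blockMatrix]
  have hL : ∀ j : Fin (k * n),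
      (classMatrix (linkSetoid f (k * n)) x).map (algebraMap ℝ ℂ) i j *
        (if ((j : ℕ) : ZMod k) = ((m : ℕ) : ZMod k) then
          chi k n (((r : ℕ) : ZMod (k * n)) * ((j : ℕ) : ZMod (k * n))) else 0) =
      if ((j : ℕ) : ZMod k) = ((m : ℕ) : ZMod k) then
        (fun d => (x (entryClass f (k * n) (l, m) (d - ((i : ℕ) : ZMod (k * n)))) : ℂ) *
          chi k n (((r : ℕ) : ZMod (k * n)) * d)) ((j : ℕ) : ZMod (k * n)) else 0 := by
    intro j
    rw [mul_ite, mul_zero]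
    refine if_congr Iff.rfl ?_ rfl
    simp only [Matrix.map_apply, classMatrix, Matrix.of_apply, Complex.coe_algebraMap]
    rw [mk_eq_entryClass (Dvd.intro n rfl) i j (l, m) hl]
  rw [Finset.sum_congr rfl fun j _ => hL j, sum_ite_natCast_eq ((m : ℕ) : ZMod k)
    (fun d => (x (entryClass f (k * n) (l, m) (d - ((i : ℕ) : ZMod (k * n)))) : ℂ) *
          chi k n (((r : ℕ) : ZMod (k * n)) * d))]
  have hs := sum_fiber_add (((m : ℕ) : ZMod k) - ((l : ℕ) : ZMod k)) ((i : ℕ) : ZMod (k * n))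
    (fun d => (x (entryClass f (k * n) (l, m) (d - ((i : ℕ) : ZMod (k * n)))) : ℂ) *
          chi k n (((r : ℕ) : ZMod (k * n)) * d))
  rw [map_natCast, hl, sub_add_cancel] at hs
  rw [← hs, Finset.mul_sum, hl]
  refine Finset.sum_congr rfl fun d _ => ?_
  rw [add_sub_cancel_right, mul_add, AddChar.map_add_eq_mul]
  ring

/-- The empirical spectral measure of a linked matrix is the average of those of its blocks. -/
theorem integral_empiricalSpectralMeasure_classMatrix
    (x : Quotient (linkSetoid f (k * n)) → ℝ) (g : ℝ → ℝ) :
    ∫ t, g t ∂(empiricalSpectralMeasure (classMatrix (linkSetoid f (k * n)) x)) =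
      (n : ℝ)⁻¹ * ∑ r : Fin n, ∫ t, g t ∂(empiricalSpectralMeasure
        (companionMatrix f k (blockCoord f x ((r : ℕ) : ZMod (k * n))))) := by
  have hA := isHermitian_classMatrix (linkSetoid_swap (f := f)) x
  have hC := fun r : Fin n => isHermitian_companionMatrix (blockCoord f x ((r : ℕ) : ZMod (k * n)))
  have hn : (n : ℂ) ≠ 0 := by exact_mod_cast NeZero.ne n
  have hWV : ((n : ℂ)⁻¹ • (fourierMatrix k n).conjTranspose) * fourierMatrix k n = 1 := by
    rw [Matrix.smul_mul, conjTranspose_fourierMatrix_mul, smul_smul, inv_mul_cancel₀ hn, one_smul]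
  have hchar := charpoly_eq_of_intertwining finProdFinEquiv.symm hWV
    (classMatrix_mul_fourierMatrix x)
  rw [Matrix.charpoly_map, hA.charpoly_eq, charpoly_blockDiagonal, Polynomial.map_prod]
    at hchar
  simp only [blockMatrix_eq_smul_companionMatrix, charpoly_smul_of_isHermitian (hC _)] at hchar
  have hsum := sum_eq_sum_of_prod_X_sub_C_eq (a := hA.eigenvalues)
    (b := fun p : Fin n × Fin k => Real.sqrt n * (hC p.1).eigenvalues p.2) (by
      rw [Fintype.prod_prod_type]
      simpa using hchar) (fun t => g (t / Real.sqrt (k * n : ℕ)))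
  rw [integral_empiricalSpectralMeasure hA]
  simp only [integral_empiricalSpectralMeasure (hC _)]
  rw [hsum, Fintype.sum_prod_type, ← Finset.mul_sum, ← mul_assoc]
  congr 1
  · push_cast
    rw [mul_inv, mul_comm]
  -- Since √(kn) = √k √n, the factor √n of the blocks cancels and the normalization by √k of the
  -- companion remains.
  · refine Finset.sum_congr rfl fun r _ => Finset.sum_congr rfl fun i _ => ?_
    congr 1
    have hn' : Real.sqrt n ≠ 0 := (Real.sqrt_pos.2 (by exact_mod_cast NeZero.pos n)).ne'
    push_cast
    rw [Real.sqrt_mul (by positivity), mul_comm (Real.sqrt k), mul_div_mul_left _ _ hn']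

end Fourier

/-! ### A central limit theorem for triangular arrays of multiples of one variable -/

section CentralLimit

/-- Telescoping: the factors are replaced one at a time, all others being bounded by one. -/
theorem norm_prod_sub_prod_le_sum {ι : Type*} (s : Finset ι) {a b : ι → ℂ} (ha : ∀ i, ‖a i‖ ≤ 1)
    (hb : ∀ i, ‖b i‖ ≤ 1) : ‖∏ i ∈ s, a i - ∏ i ∈ s, b i‖ ≤ ∑ i ∈ s, ‖a i - b i‖ := by
  classical
  induction s using Finset.induction_on with
  | empty => simp
  | insert i s hi ih =>
    rw [Finset.prod_insert hi, Finset.prod_insert hi, Finset.sum_insert hi]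
    have hP : ‖∏ j ∈ s, a j‖ ≤ 1 := by
      rw [norm_prod]
      exact Finset.prod_le_one (fun _ _ => norm_nonneg _) fun j _ => ha j
    calc ‖a i * ∏ j ∈ s, a j - b i * ∏ j ∈ s, b j‖
        = ‖(a i - b i) * ∏ j ∈ s, a j + b i * (∏ j ∈ s, a j - ∏ j ∈ s, b j)‖ := by ring_nf
      _ ≤ ‖a i - b i‖ * ‖∏ j ∈ s, a j‖ + ‖b i‖ * ‖∏ j ∈ s, a j - ∏ j ∈ s, b j‖ := by
        refine (norm_add_le _ _).trans ?_
        rw [norm_mul, norm_mul]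
      _ ≤ ‖a i - b i‖ * 1 + 1 * ∑ j ∈ s, ‖a j - b j‖ := by
        gcongr
        exact hb i
      _ = _ := by ring

variable {μ : Measure ℝ} [IsProbabilityMeasure μ]

/-- Both characteristic functions have the second-order Taylor expansion of a centred law of
variance one. -/
theorem charFun_sub_exp_isLittleO (hmean : ∫ x, x ∂μ = 0) (hvar : ∫ x, x ^ 2 ∂μ = 1) :
    (fun t : ℝ => charFun μ t - Complex.exp (-(t : ℂ) ^ 2 / 2)) =o[𝓝 0] fun t => t ^ 2 := by
  have h1 := taylor_charFun_two (P := μ) (X := id) aemeasurable_id hmean (by simpa using hvar)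
  have h2 := taylor_charFun_two (P := gaussianReal 0 1) (X := id) aemeasurable_id (by simp) (by
    have h := variance_id_gaussianReal (μ := 0) (v := 1)
    rw [variance_of_integral_eq_zero aemeasurable_id (by simp)] at h
    simpa using h)
  have h3 := h1.sub h2
  refine h3.congr_left fun t => ?_
  rw [Measure.map_id, Measure.map_id, charFun_gaussianReal]
  simp [neg_div]

/-- Each factor is replaced by its Gaussian counterpart. As the coefficients are uniformly small,
the total error is o(1) times the sum of their squares, which stays bounded. -/
theorem tendsto_prod_charFun (hmean : ∫ x, x ∂μ = 0) (hvar : ∫ x, x ^ 2 ∂μ = 1)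
    {C : ℕ → Type*} [∀ n, Fintype (C n)] {w : ∀ n, C n → ℝ} {M : ℕ → ℝ} {σ : ℝ}
    (hw : ∀ᶠ n in atTop, ∀ c, |w n c| ≤ M n) (hM : Tendsto M atTop (𝓝 0))
    (hσ : Tendsto (fun n => ∑ c, w n c ^ 2) atTop (𝓝 σ)) :
    Tendsto (fun n => ∏ c, charFun μ (w n c)) atTop (𝓝 (Complex.exp (-(σ : ℂ) / 2))) := by
  have hexp : Tendsto (fun n => ∏ c, Complex.exp (-(w n c : ℂ) ^ 2 / 2)) atTop
      (𝓝 (Complex.exp (-(σ : ℂ) / 2))) := by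
    have : ∀ n, ∏ c, Complex.exp (-(w n c : ℂ) ^ 2 / 2) =
        Complex.exp (-((∑ c, w n c ^ 2 : ℝ) : ℂ) / 2) := by
      intro n
      rw [← Complex.exp_sum]
      push_cast
      rw [← Finset.sum_div, Finset.sum_neg_distrib]
    simp only [this]
    refine (Complex.continuous_exp.tendsto _).comp ?_
    refine Tendsto.div_const (Tendsto.neg ?_) _
    exact (Complex.continuous_ofReal.tendsto _).comp hσ
  suffices h : Tendsto (fun n => ∏ c, charFun μ (w n c) -
      ∏ c, Complex.exp (-(w n c : ℂ) ^ 2 / 2)) atTop (𝓝 0) by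
    simpa using h.add hexp
  rw [NormedAddGroup.tendsto_nhds_zero]
  intro ε hε
  -- Eventually the sum of squares is below |σ| + 1, so this choice leaves strict room; the absolute
  -- value dispenses with knowing the sign of σ.
  have hε' : 0 < ε / (|σ| + 2) := by positivity
  have hev := (charFun_sub_exp_isLittleO hmean hvar).def hε'
  rw [Metric.eventually_nhds_iff] at hev
  obtain ⟨δ, hδ, hb⟩ := hev
  have hσ' : ∀ᶠ n in atTop, ∑ c, w n c ^ 2 < |σ| + 1 :=
    hσ.eventually_lt_const (lt_of_le_of_lt (le_abs_self σ) (lt_add_one _))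
  filter_upwards [hw, hM.eventually_lt_const hδ, hσ'] with n h1 h2 h3
  have hexp1 : ∀ c, ‖Complex.exp (-(w n c : ℂ) ^ 2 / 2)‖ ≤ 1 := by
    intro c
    rw [show -(w n c : ℂ) ^ 2 / 2 = ((-(w n c) ^ 2 / 2 : ℝ) : ℂ) by push_cast; ring,
      Complex.norm_exp_ofReal, Real.exp_le_one_iff]
    nlinarith [sq_nonneg (w n c)]
  refine (norm_prod_sub_prod_le_sum _ (fun c => norm_charFun_le_one _) hexp1).trans_lt ?_
  have hsum : ∑ c, ‖charFun μ (w n c) - Complex.exp (-(w n c : ℂ) ^ 2 / 2)‖ ≤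
      ∑ c, ε / (|σ| + 2) * w n c ^ 2 := by
    refine Finset.sum_le_sum fun c _ => ?_
    have := hb (y := w n c) (by
      rw [Real.dist_eq, sub_zero]
      exact (h1 c).trans_lt h2)
    rwa [norm_pow, Real.norm_eq_abs, sq_abs] at this
  refine hsum.trans_lt ?_
  rw [← Finset.mul_sum]
  calc ε / (|σ| + 2) * ∑ c, w n c ^ 2 < ε / (|σ| + 2) * (|σ| + 2) := by
        gcongr
        linarith
    _ = ε := by field_simp

end CentralLimit

/-! ### Collecting the coefficients of a repeated variable -/

section Collect

variable {I C : Type*} [Fintype C] [DecidableEq C] (T : Finset I) (cls : I → C) (κ : I → ℝ)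

/-- The total coefficient of a class. -/
def classCoeff (c : C) : ℝ := ∑ i ∈ T with cls i = c, κ i

theorem sum_mul_classCoeff (x : C → ℝ) :
    ∑ c, x c * classCoeff T cls κ c = ∑ i ∈ T, x (cls i) * κ i := by
  simp only [classCoeff, Finset.mul_sum]
  rw [← Finset.sum_fiberwise T cls]
  refine Finset.sum_congr rfl fun c _ => Finset.sum_congr rfl fun i hi => ?_
  rw [(Finset.mem_filter.1 hi).2]

variable {T cls κ}

/-- Square one factor out: this is `sum_mul_classCoeff` evaluated at the class coefficients
themselves. -/
theorem sum_classCoeff_sq {m : I → ℝ}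
    (hm : ∀ i ∈ T, classCoeff T cls κ (cls i) = m i * κ i) :
    ∑ c, classCoeff T cls κ c ^ 2 = ∑ i ∈ T, m i * κ i ^ 2 := by
  simp only [sq]
  rw [sum_mul_classCoeff]
  refine Finset.sum_congr rfl fun i hi => ?_
  rw [hm i hi]
  ring

omit [Fintype C] in
theorem abs_classCoeff_le {B : ℝ} (hB : 0 ≤ B)
    (h : ∀ i ∈ T, |classCoeff T cls κ (cls i)| ≤ B) (c : C) : |classCoeff T cls κ c| ≤ B := by
  by_cases hc : ∃ i ∈ T, cls i = c
  · obtain ⟨i, hi, rfl⟩ := hc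
    exact h i hi
  · push Not at hc
    rw [classCoeff, Finset.filter_false_of_mem fun i hi => hc i hi]
    simpa using hB

end Collect

/-! ### Coordinates of the companion ensemble -/

section Coordinates

variable {k : ℕ} {S : Type*} {f : ZMod k → ZMod k → S}

instance fintypeQuotientLinkSetoid {N : ℕ} : Fintype (Quotient (linkSetoid f N)) :=
  Fintype.ofFinite _

variable (f) in
/-- The Euclidean space of coordinates of the companion ensemble. -/
abbrev CoordSpace : Type := EuclideanSpace ℝ (Quotient (linkSetoid f k) × Fin 2)

open scoped Classical in
/-- The vector of the coordinates that a companion matrix depends on. -/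
def ofCoord (ω : Quotient (linkSetoid f k) → ℝ × ℝ) : CoordSpace f :=
  WithLp.toLp 2 fun p => if p.2 = 0 then (ω p.1).1
    else if IsRealEntry f k p.1.out then 0 else (ω p.1).2

/-- The pairs of coordinates given by a vector. -/
def toCoord (v : CoordSpace f) : Quotient (linkSetoid f k) → ℝ × ℝ := fun q => (v (q, 0), v (q, 1))

theorem continuous_toCoord : Continuous (toCoord (f := f)) := by
  unfold toCoord
  fun_prop

theorem measurable_ofCoord : Measurable (ofCoord (f := f)) := by
  unfold ofCoord
  refine (WithLp.measurable_toLp 2 _).comp (measurable_pi_lambda _ fun p => ?_)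
  split_ifs <;> fun_prop

theorem continuous_companionMatrix : Continuous (companionMatrix f k) := by
  refine continuous_matrix fun i j => ?_
  change Continuous fun ω => companionMatrix f k ω (i, j).1 (i, j).2
  generalize (i, j) = p
  have hc : Continuous fun ω : Quotient (linkSetoid f k) → ℝ × ℝ =>
      toComplexGaussian (ω (Quotient.mk _ p)) := by
    unfold toComplexGaussian
    fun_prop
  by_cases hp : IsRealEntry f k p
  · simp only [companionMatrix_apply_of_real hp]
    fun_prop
  · by_cases h : SameEntry f k p (Quotient.mk (linkSetoid f k) p).out
    · simpa only [companionMatrix_apply_of_sameEntry hp h] using hc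
    · simpa only [companionMatrix_apply_of_not_sameEntry hp h] using hc.star

/-- The second coordinate over a real entry is discarded because the companion matrix never reads
it. It is zero for a block but Gaussian in the companion law, so without this the coordinate vectors
could not converge in law. -/
theorem companionMatrix_toCoord_ofCoord (ω : Quotient (linkSetoid f k) → ℝ × ℝ) :
    companionMatrix f k (toCoord (ofCoord ω)) = companionMatrix f k ω := by
  have h1 : ∀ q, (toCoord (ofCoord ω) q).1 = (ω q).1 := fun q => by simp [toCoord, ofCoord]
  have h2 : ∀ q, ¬ IsRealEntry f k q.out → toCoord (ofCoord ω) q = ω q := fun q hq => by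
    simp [toCoord, ofCoord, hq]
  ext i j
  change companionMatrix f k _ (i, j).1 (i, j).2 = companionMatrix f k _ (i, j).1 (i, j).2
  generalize (i, j) = p
  have hreal := isRealEntry_iff_of_linkSetoid (linkSetoid_out (f := f) p)
  by_cases hp : IsRealEntry f k p
  · rw [companionMatrix_apply_of_real hp, companionMatrix_apply_of_real hp, h1]
  · have h2' := h2 (Quotient.mk _ p) (fun h => hp (hreal.2 h))
    by_cases h : SameEntry f k p (Quotient.mk (linkSetoid f k) p).out
    · rw [companionMatrix_apply_of_sameEntry hp h, companionMatrix_apply_of_sameEntry hp h, h2']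
    · rw [companionMatrix_apply_of_not_sameEntry hp h,
        companionMatrix_apply_of_not_sameEntry hp h, h2']

open scoped Classical in
theorem inner_ofCoord (ω : Quotient (linkSetoid f k) → ℝ × ℝ) (u : CoordSpace f) :
    inner ℝ (ofCoord ω) u = ∑ q, ((ω q).1 * u (q, 0) +
      (if IsRealEntry f k q.out then 0 else (ω q).2 * u (q, 1))) := by
  rw [PiLp.inner_apply, Fintype.sum_prod_type]
  refine Finset.sum_congr rfl fun q _ => ?_
  rw [Fin.sum_univ_two]
  simp [ofCoord, mul_comm]

variable (f) in
/-- The law of the coordinates of the companion ensemble. -/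
def limitLaw : Measure (CoordSpace f) :=
  (Measure.pi fun _ : Quotient (linkSetoid f k) => gaussianPair).map ofCoord

instance isProbabilityMeasure_gaussianPair : IsProbabilityMeasure gaussianPair := by
  unfold gaussianPair
  infer_instance

instance isProbabilityMeasure_limitLaw : IsProbabilityMeasure (limitLaw f) :=
  Measure.isProbabilityMeasure_map measurable_ofCoord.aemeasurable

theorem integral_exp_gaussianPair (a b : ℝ) :
    ∫ x, Complex.exp (((x.1 * a + x.2 * b : ℝ) : ℂ) * Complex.I) ∂gaussianPair =
      Complex.exp (-((a ^ 2 + b ^ 2 : ℝ) : ℂ) / 2) := by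
  have h : ∀ x : ℝ × ℝ, Complex.exp (((x.1 * a + x.2 * b : ℝ) : ℂ) * Complex.I) =
      Complex.exp (a * x.1 * Complex.I) * Complex.exp (b * x.2 * Complex.I) := by
    intro x
    rw [← Complex.exp_add]
    push_cast
    ring_nf
  simp only [h]
  rw [gaussianPair, integral_prod_mul (fun x : ℝ => Complex.exp (a * x * Complex.I))
    (fun x : ℝ => Complex.exp (b * x * Complex.I)), ← charFun_apply_real, ← charFun_apply_real,
    charFun_gaussianReal, charFun_gaussianReal, ← Complex.exp_add]
  congr 1
  push_cast
  ring

open scoped Classical in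
/-- The variance of a linear functional of the coordinates of the companion ensemble. -/
def limitVariance (u : CoordSpace f) : ℝ :=
  ∑ q : Quotient (linkSetoid f k),
    (u (q, 0) ^ 2 + (if IsRealEntry f k q.out then 0 else u (q, 1)) ^ 2)

theorem charFun_limitLaw (u : CoordSpace f) :
    charFun (limitLaw f) u = Complex.exp (-(limitVariance u : ℂ) / 2) := by
  classical
  rw [charFun_apply, limitLaw, integral_map measurable_ofCoord.aemeasurable
    (by fun_prop)]
  have h : ∀ ω : Quotient (linkSetoid f k) → ℝ × ℝ,
      Complex.exp (((inner ℝ (ofCoord ω) u : ℝ) : ℂ) * Complex.I) =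
      ∏ q, Complex.exp ((((ω q).1 * u (q, 0) + (ω q).2 *
        (if IsRealEntry f k q.out then 0 else u (q, 1)) : ℝ) : ℂ) * Complex.I) := by
    intro ω
    rw [inner_ofCoord, ← Complex.exp_sum, ← Finset.sum_mul]
    push_cast
    congr 2
    refine Finset.sum_congr rfl fun q _ => ?_
    split_ifs <;> simp
  simp only [h]
  rw [integral_fintype_prod_eq_prod (fun q (x : ℝ × ℝ) =>
    Complex.exp (((x.1 * u (q, 0) + x.2 *
        (if IsRealEntry f k q.out then 0 else u (q, 1)) : ℝ) : ℂ) * Complex.I))]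
  simp only [integral_exp_gaussianPair]
  rw [← Complex.exp_sum, ← Finset.sum_div, Finset.sum_neg_distrib]
  congr 3
  rw [limitVariance]
  push_cast
  rfl

end Coordinates

/-! ### Joint convergence of the coordinates of the blocks -/

section Functional

variable {k n : ℕ} [NeZero k] [NeZero n] {S : Type*} {f : ZMod k → ZMod k → S}

open scoped Classical in
/-- Coefficient of the real part of the entry of a block in a linear functional. -/
def reCoeff (u : CoordSpace f) (q : Quotient (linkSetoid f k)) : ℝ :=
  if IsRealEntry f k q.out then u (q, 0) else Real.sqrt 2 * u (q, 0)

open scoped Classical in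
/-- Coefficient of the imaginary part of the entry of a block in a linear functional. -/
def imCoeff (u : CoordSpace f) (q : Quotient (linkSetoid f k)) : ℝ :=
  if IsRealEntry f k q.out then 0 else Real.sqrt 2 * u (q, 1)

/-- Coefficients of a linear functional of the block coordinates. -/
def entryCoeff (u : CoordSpace f) (r : ZMod (k * n))
    (i : (_ : Quotient (linkSetoid f k)) × ZMod (k * n)) : ℝ :=
  (reCoeff u i.1 * (chi k n (r * i.2)).re + imCoeff u i.1 * (chi k n (r * i.2)).im) / Real.sqrt n

variable (f n) in
/-- The offsets of the entries over each position of the companion matrix. -/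
def offsets : Finset ((_ : Quotient (linkSetoid f k)) × ZMod (k * n)) :=
  Finset.univ.sigma fun q =>
    fiber k n (((q.out.2 : ℕ) : ZMod k) - ((q.out.1 : ℕ) : ZMod k))

/-- The class of the entries at a given offset. -/
def offsetClass (i : (_ : Quotient (linkSetoid f k)) × ZMod (k * n)) :
    Quotient (linkSetoid f (k * n)) := entryClass f (k * n) i.1.out i.2

theorem mem_offsets {i : (_ : Quotient (linkSetoid f k)) × ZMod (k * n)} :
    i ∈ offsets n f ↔ Compatible (Dvd.intro n rfl : k ∣ k * n) i.1.out i.2 := by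
  rw [offsets, Finset.mem_sigma, mem_fiber]
  simp [Compatible]

/-- A functional of the coordinates is linear in the independent entries, indexed by position and
offset. Several terms may involve the same entry, hence the recourse to `classCoeff`. -/
theorem inner_blockCoord (u : CoordSpace f) (x : Quotient (linkSetoid f (k * n)) → ℝ)
    (r : ZMod (k * n)) :
    inner ℝ (ofCoord (blockCoord f x r)) u =
      ∑ i ∈ offsets n f, x (offsetClass i) * entryCoeff u r i := by
  rw [inner_ofCoord, offsets, Finset.sum_sigma]
  refine Finset.sum_congr rfl fun q _ => ?_
  have hre : (blockMatrix f x r q.out.1 q.out.2).re =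
      ∑ d ∈ fiber k n (((q.out.2 : ℕ) : ZMod k) - ((q.out.1 : ℕ) : ZMod k)),
        x (entryClass f (k * n) q.out d) * (chi k n (r * d)).re := by
    simp only [blockMatrix, Matrix.of_apply, Complex.re_sum, Complex.re_ofReal_mul, Prod.mk.eta]
  have him : (blockMatrix f x r q.out.1 q.out.2).im =
      ∑ d ∈ fiber k n (((q.out.2 : ℕ) : ZMod k) - ((q.out.1 : ℕ) : ZMod k)),
        x (entryClass f (k * n) q.out d) * (chi k n (r * d)).im := by
    simp only [blockMatrix, Matrix.of_apply, Complex.im_sum, Complex.im_ofReal_mul, Prod.mk.eta]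
  by_cases hq : IsRealEntry f k q.out
  · simp only [blockCoord, if_pos hq, entryCoeff, reCoeff, imCoeff, offsetClass]
    rw [hre, Finset.sum_div, Finset.sum_mul, add_zero]
    exact Finset.sum_congr rfl fun d _ => by ring
  · simp only [blockCoord, if_neg hq, entryCoeff, reCoeff, imCoeff, offsetClass]
    rw [hre, him, Finset.mul_sum, Finset.mul_sum, Finset.sum_div, Finset.sum_div, Finset.sum_mul,
      Finset.sum_mul, ← Finset.sum_add_distrib]
    exact Finset.sum_congr rfl fun d _ => by ring

open scoped Classical in
/-- The number of offsets that have the class of a given offset. -/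
def multiplicity (i : (_ : Quotient (linkSetoid f k)) × ZMod (k * n)) : ℝ :=
  if IsRealEntry f k i.1.out ∧ i.2 ≠ -i.2 then 2 else 1

/-- Over a real position d and -d share a variable, and their coefficients agree because only the
even function Re χ occurs; the coefficient doubles unless d = -d. Over a complex position nothing
coincides. -/
theorem classCoeff_offsetClass [DecidableEq (Quotient (linkSetoid f (k * n)))] (u : CoordSpace f)
    (r : ZMod (k * n)) {i : (_ : Quotient (linkSetoid f k)) × ZMod (k * n)}
    (hi : i ∈ offsets n f) :
    classCoeff (offsets n f) offsetClass (entryCoeff u r) (offsetClass i) =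
      multiplicity i * entryCoeff u r i := by
  classical
  obtain ⟨q, d⟩ := i
  have hd := mem_offsets.1 hi
  have hmem : ∀ j, (j ∈ offsets n f ∧ offsetClass j = offsetClass (⟨q, d⟩ :
      (_ : Quotient (linkSetoid f k)) × ZMod (k * n))) ↔
      j = ⟨q, d⟩ ∨ (IsRealEntry f k q.out ∧ j = ⟨q, -d⟩) := by
    rintro ⟨q', d'⟩
    constructor
    · rintro ⟨h1, h2⟩
      obtain ⟨hqq, h3⟩ := (entryClass_out_eq_iff _ (mem_offsets.1 h1) hd).1 h2
      change q' = q at hqq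
      subst hqq
      rcases h3 with h3 | ⟨h3, h4⟩
      · exact Or.inl (by rw [show d' = d from h3])
      · exact Or.inr ⟨h3, by rw [show d' = -d from h4]⟩
    · rintro (h | ⟨hr, h⟩)
      · rw [h]
        exact ⟨hi, rfl⟩
      · rw [h]
        have hc : Compatible (Dvd.intro n rfl : k ∣ k * n) q.out (-d) := by
          have h1 := (SameEntry.sub_eq_and_entryClass_eq (Dvd.intro n rfl : k ∣ k * n)
            (show SameEntry f k q.out q.out.swap from hr)).1
          have h2 := (compatible_swap (Dvd.intro n rfl : k ∣ k * n)).2 hd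
          unfold Compatible at h2 ⊢
          rw [h2, h1]
        exact ⟨mem_offsets.2 hc, (entryClass_out_eq_iff _ hc hd).2 ⟨rfl, Or.inr ⟨hr, rfl⟩⟩⟩
  by_cases hr : IsRealEntry f k q.out
  · have hfilter : (offsets n f).filter (fun j => offsetClass j = offsetClass (⟨q, d⟩ :
        (_ : Quotient (linkSetoid f k)) × ZMod (k * n))) = {⟨q, d⟩, ⟨q, -d⟩} := by
      ext j
      rw [Finset.mem_filter, hmem]
      simp [hr]
    rw [classCoeff, hfilter]
    by_cases hdd : d = -d
    · rw [← hdd]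
      simp [multiplicity, ← hdd]
    · rw [Finset.sum_pair (by simpa using hdd)]
      simp only [multiplicity, hr, hdd, entryCoeff, imCoeff, if_true, ne_eq, not_false_eq_true,
        and_self, mul_neg, chi_neg, RCLike.star_def, Complex.conj_re]
      ring
  · have hfilter : (offsets n f).filter (fun j => offsetClass j = offsetClass (⟨q, d⟩ :
        (_ : Quotient (linkSetoid f k)) × ZMod (k * n))) = {⟨q, d⟩} := by
      ext j
      rw [Finset.mem_filter, hmem]
      simp [hr]
    rw [classCoeff, hfilter, Finset.sum_singleton]
    simp [multiplicity, hr]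

theorem abs_re_chi_le (a : ZMod (k * n)) : |(chi k n a).re| ≤ 1 :=
  (Complex.abs_re_le_norm _).trans (norm_chi a).le

theorem abs_im_chi_le (a : ZMod (k * n)) : |(chi k n a).im| ≤ 1 :=
  (Complex.abs_im_le_norm _).trans (norm_chi a).le

theorem abs_entryCoeff_le (u : CoordSpace f) (r : ZMod (k * n))
    (i : (_ : Quotient (linkSetoid f k)) × ZMod (k * n)) :
    |entryCoeff u r i| ≤ (|reCoeff u i.1| + |imCoeff u i.1|) / Real.sqrt n := by
  rw [entryCoeff, abs_div, abs_of_nonneg (Real.sqrt_nonneg n)]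
  gcongr
  refine (abs_add_le _ _).trans ?_
  rw [abs_mul, abs_mul]
  exact add_le_add (mul_le_of_le_one_right (abs_nonneg _) (abs_re_chi_le _))
    (mul_le_of_le_one_right (abs_nonneg _) (abs_im_chi_le _))

/-- A bound for the coefficients of a linear functional. -/
def coeffBound (u : CoordSpace f) : ℝ := ∑ q, (|reCoeff u q| + |imCoeff u q|)

omit [NeZero k] in
theorem le_coeffBound (u : CoordSpace f) (q : Quotient (linkSetoid f k)) :
    |reCoeff u q| + |imCoeff u q| ≤ coeffBound u :=
  Finset.single_le_sum (f := fun q => |reCoeff u q| + |imCoeff u q|)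
    (fun _ _ => by positivity) (Finset.mem_univ q)

omit [NeZero k] [NeZero n] in
theorem multiplicity_nonneg_and_le (i : (_ : Quotient (linkSetoid f k)) × ZMod (k * n)) :
    0 ≤ multiplicity i ∧ multiplicity i ≤ 2 := by
  unfold multiplicity
  split_ifs <;> norm_num

theorem abs_classCoeff_entryCoeff_le [DecidableEq (Quotient (linkSetoid f (k * n)))]
    (u : CoordSpace f) (r : ZMod (k * n)) (c : Quotient (linkSetoid f (k * n))) :
    |classCoeff (offsets n f) offsetClass (entryCoeff u r) c| ≤
      2 * coeffBound u / Real.sqrt n := by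
  have h0 : 0 ≤ coeffBound u := Finset.sum_nonneg fun _ _ => by positivity
  refine abs_classCoeff_le (by positivity) (fun i hi => ?_) c
  rw [classCoeff_offsetClass u r hi, abs_mul, mul_div_assoc,
    abs_of_nonneg (multiplicity_nonneg_and_le i).1]
  refine mul_le_mul (multiplicity_nonneg_and_le i).2 ((abs_entryCoeff_le u r i).trans ?_)
    (abs_nonneg _) zero_le_two
  gcongr
  exact le_coeffBound u i.1

/-- Double-angle formulas express the squares through χ(2rd), whose sum over a fiber vanishes; only
the mean values 1/2 of cos² and sin² survive. -/
theorem sum_entryCoeff_sq (u : CoordSpace f) {r : ZMod (k * n)} (hr : 2 * r * (k : ℕ) ≠ 0)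
    (q : Quotient (linkSetoid f k)) (a : ZMod k) :
    ∑ d ∈ fiber k n a, entryCoeff u r ⟨q, d⟩ ^ 2 = (reCoeff u q ^ 2 + imCoeff u q ^ 2) / 2 := by
  have hn : (0 : ℝ) < n := by exact_mod_cast NeZero.pos n
  have hchi := sum_fiber_chi a (2 * r) hr
  have hre := congrArg Complex.re hchi
  have him := congrArg Complex.im hchi
  rw [Complex.re_sum, Complex.zero_re] at hre
  rw [Complex.im_sum, Complex.zero_im] at him
  have hterm : ∀ d, entryCoeff u r ⟨q, d⟩ ^ 2 = (n : ℝ)⁻¹ *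
      ((reCoeff u q ^ 2 + imCoeff u q ^ 2) / 2 +
        (reCoeff u q ^ 2 - imCoeff u q ^ 2) / 2 * (chi k n (2 * r * d)).re +
        reCoeff u q * imCoeff u q * (chi k n (2 * r * d)).im) := by
    intro d
    have h2 : chi k n (2 * r * d) = chi k n (r * d) * chi k n (r * d) := by
      rw [← AddChar.map_add_eq_mul]
      congr 1
      ring
    have h1 : (chi k n (r * d)).re ^ 2 + (chi k n (r * d)).im ^ 2 = 1 := by
      have := norm_chi (k := k) (n := n) (r * d)
      rw [Complex.norm_eq_sqrt_sq_add_sq, Real.sqrt_eq_one] at this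
      exact this
    rw [h2, Complex.mul_re, Complex.mul_im, entryCoeff, div_pow, Real.sq_sqrt hn.le, div_eq_inv_mul]
    congr 1
    linear_combination ((reCoeff u q ^ 2 + imCoeff u q ^ 2) / 2) * h1
  simp only [hterm]
  rw [← Finset.mul_sum, Finset.sum_add_distrib, Finset.sum_add_distrib, ← Finset.mul_sum,
    ← Finset.mul_sum, hre, him, Finset.sum_const, card_fiber]
  simp only [nsmul_eq_mul, mul_zero, add_zero]
  field_simp

theorem card_eq_neg_le (N : ℕ) [NeZero N] [DecidableEq (ZMod N)] :
    (Finset.univ.filter fun d : ZMod N => d = -d).card ≤ 2 := by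
  have h := IsAddCyclic.card_nsmul_eq_zero_le (α := ZMod N) (n := 2) two_pos
  refine le_trans (Finset.card_le_card fun d hd => ?_) h
  rw [Finset.mem_filter] at hd ⊢
  refine ⟨Finset.mem_univ _, ?_⟩
  rw [two_nsmul]
  exact eq_neg_iff_add_eq_zero.1 hd.2

/-- Over a real position the doubling cancels the 1/2, up to at most two offsets with d = -d, each
contributing O(1/n). Over a complex position the √2 in the coefficients cancels it exactly. -/
theorem abs_sum_multiplicity_sub_limitVariance_le (u : CoordSpace f) {r : ZMod (k * n)}
    (hr : 2 * r * (k : ℕ) ≠ 0) :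
    |∑ i ∈ offsets n f, multiplicity i * entryCoeff u r i ^ 2 - limitVariance u| ≤
      (∑ q : Quotient (linkSetoid f k), 2 * (|reCoeff u q| + |imCoeff u q|) ^ 2) / n := by
  classical
  have hn : (0 : ℝ) < n := by exact_mod_cast NeZero.pos n
  rw [offsets, Finset.sum_sigma, limitVariance, ← Finset.sum_sub_distrib, Finset.sum_div]
  refine (Finset.abs_sum_le_sum_abs _ _).trans (Finset.sum_le_sum fun q _ => ?_)
  set a : ZMod k := ((q.out.2 : ℕ) : ZMod k) - ((q.out.1 : ℕ) : ZMod k)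
  have hsq := sum_entryCoeff_sq u hr q a
  by_cases hq : IsRealEntry f k q.out
  · have h1 : ∑ d ∈ fiber k n a, multiplicity (⟨q, d⟩ : (_ : Quotient (linkSetoid f k)) ×
        ZMod (k * n)) * entryCoeff u r ⟨q, d⟩ ^ 2 =
        2 * ∑ d ∈ fiber k n a, entryCoeff u r ⟨q, d⟩ ^ 2 -
          ∑ d ∈ fiber k n a with d = -d, entryCoeff u r ⟨q, d⟩ ^ 2 := by
      rw [Finset.mul_sum, Finset.sum_filter, ← Finset.sum_sub_distrib]
      refine Finset.sum_congr rfl fun d _ => ?_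
      by_cases hd : d = -d
      · simp only [multiplicity, hq, if_pos hd]
        rw [if_neg (by simpa using hd)]
        ring
      · simp only [multiplicity, hq, if_neg hd]
        rw [if_pos (by simpa using hd)]
        ring
    have h2 : ∑ d ∈ fiber k n a with d = -d, entryCoeff u r ⟨q, d⟩ ^ 2 ≤
        2 * (|reCoeff u q| + |imCoeff u q|) ^ 2 / n := by
      have hle : ∀ d ∈ (fiber k n a).filter (fun d => d = -d), entryCoeff u r ⟨q, d⟩ ^ 2 ≤
          (|reCoeff u q| + |imCoeff u q|) ^ 2 / n := by
        intro d _
        have := abs_entryCoeff_le u r ⟨q, d⟩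
        rw [← sq_abs, ← Real.sq_sqrt hn.le, ← div_pow]
        exact pow_le_pow_left₀ (abs_nonneg _) this 2
      refine (Finset.sum_le_card_nsmul _ _ _ hle).trans ?_
      rw [nsmul_eq_mul, mul_div_assoc]
      have hcard : (((fiber k n a).filter (fun d => d = -d)).card : ℝ) ≤ 2 := by
        exact_mod_cast (Finset.card_le_card (Finset.filter_subset_filter _
          (Finset.subset_univ _))).trans (card_eq_neg_le (k * n))
      gcongr
    have h3 : 0 ≤ ∑ d ∈ fiber k n a with d = -d, entryCoeff u r ⟨q, d⟩ ^ 2 :=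
      Finset.sum_nonneg fun _ _ => sq_nonneg _
    rw [h1, hsq, if_pos hq, show 2 * ((reCoeff u q ^ 2 + imCoeff u q ^ 2) / 2) = u (q, 0) ^ 2 by
      simp [reCoeff, imCoeff, hq]; ring]
    rw [abs_le]
    constructor <;> nlinarith
  · have h1 : ∑ d ∈ fiber k n a, multiplicity (⟨q, d⟩ : (_ : Quotient (linkSetoid f k)) ×
        ZMod (k * n)) * entryCoeff u r ⟨q, d⟩ ^ 2 =
        ∑ d ∈ fiber k n a, entryCoeff u r ⟨q, d⟩ ^ 2 := by
      simp [multiplicity, hq]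
    have hs : Real.sqrt 2 ^ 2 = 2 := Real.sq_sqrt zero_le_two
    rw [h1, hsq, if_neg hq, show (reCoeff u q ^ 2 + imCoeff u q ^ 2) / 2 =
      u (q, 0) ^ 2 + u (q, 1) ^ 2 by simp only [reCoeff, imCoeff, if_neg hq, mul_pow, hs]; ring,
      sub_self, abs_zero]
    positivity

end Functional

/-! ### Characteristic functions of the block coordinates and their limit -/

section Convergence

variable {k : ℕ} [NeZero k] {S : Type*} {f : ZMod k → ZMod k → S}
variable {μ : Measure ℝ} [IsProbabilityMeasure μ]

variable (f μ) in
/-- The law of the coordinates of a block. -/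
def blockLaw (n : ℕ) [NeZero n] (r : ZMod (k * n)) : Measure (CoordSpace f) :=
  (Measure.pi fun _ : Quotient (linkSetoid f (k * n)) => μ).map
    fun x => ofCoord (blockCoord f x r)

theorem measurable_blockCoord (n : ℕ) [NeZero n] (r : ZMod (k * n)) :
    Measurable fun x : Quotient (linkSetoid f (k * n)) → ℝ => blockCoord f x r := by
  classical
  refine measurable_pi_lambda _ fun q => ?_
  have h : Measurable fun x : Quotient (linkSetoid f (k * n)) → ℝ =>
      blockMatrix f x r q.out.1 q.out.2 := by
    simp only [blockMatrix, Matrix.of_apply]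
    fun_prop
  have hre := Complex.measurable_re.comp h
  have him := Complex.measurable_im.comp h
  unfold blockCoord
  split_ifs
  · exact (hre.div_const _).prodMk measurable_const
  · exact ((hre.const_mul _).div_const _).prodMk ((him.const_mul _).div_const _)

instance isProbabilityMeasure_blockLaw (n : ℕ) [NeZero n] (r : ZMod (k * n)) :
    IsProbabilityMeasure (blockLaw f μ n r) :=
  Measure.isProbabilityMeasure_map
    (measurable_ofCoord.comp (measurable_blockCoord n r)).aemeasurable

theorem charFun_blockLaw [∀ n, DecidableEq (Quotient (linkSetoid f (k * n)))] (n : ℕ) [NeZero n]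
    (r : ZMod (k * n)) (u : CoordSpace f) :
    charFun (blockLaw f μ n r) u =
      ∏ c, charFun μ (classCoeff (offsets n f) offsetClass (entryCoeff u r) c) := by
  have hmeas : Measurable fun x : Quotient (linkSetoid f (k * n)) → ℝ =>
      ofCoord (blockCoord f x r) := measurable_ofCoord.comp (measurable_blockCoord n r)
  rw [charFun_apply, blockLaw, integral_map hmeas.aemeasurable (by fun_prop)]
  have h : ∀ x : Quotient (linkSetoid f (k * n)) → ℝ,
      Complex.exp (((inner ℝ (ofCoord (blockCoord f x r)) u : ℝ) : ℂ) * Complex.I) =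
      ∏ c, Complex.exp
        (classCoeff (offsets n f) offsetClass (entryCoeff u r) c * x c * Complex.I) := by
    intro x
    rw [inner_blockCoord, ← sum_mul_classCoeff, ← Complex.exp_sum, ← Finset.sum_mul]
    push_cast
    simp only [mul_comm]
  simp only [h]
  rw [integral_fintype_prod_eq_prod (fun c (t : ℝ) => Complex.exp
    (classCoeff (offsets n f) offsetClass (entryCoeff u r) c * t * Complex.I))]
  simp only [charFun_apply_real]

theorem two_mul_natCast_mul_ne_zero {n : ℕ} (r : ℕ) (h : ¬ n ∣ 2 * r) :
    2 * ((r : ℕ) : ZMod (k * n)) * (k : ℕ) ≠ 0 := by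
  intro h'
  apply h
  rw [← natCast_mul_self_eq_zero_iff (k := k)]
  push_cast
  exact h'

/-- The coordinates of the blocks converge in law to those of the companion ensemble. -/
theorem tendsto_charFun_blockLaw (hmean : ∫ x, x ∂μ = 0) (hvar : ∫ x, x ^ 2 ∂μ = 1) {r : ℕ → ℕ}
    (hr : ∀ᶠ n in atTop, ¬ (n + 1) ∣ 2 * r n) (u : CoordSpace f) :
    Tendsto (fun n => charFun (blockLaw f μ (n + 1) ((r n : ℕ) : ZMod (k * (n + 1)))) u) atTop
      (𝓝 (charFun (limitLaw f) u)) := by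
  classical
  simp only [charFun_blockLaw, charFun_limitLaw]
  have hcast : Tendsto (fun n : ℕ => ((n + 1 : ℕ) : ℝ)) atTop atTop :=
    tendsto_natCast_atTop_atTop.comp (tendsto_add_atTop_nat 1)
  refine tendsto_prod_charFun hmean hvar (M := fun n => 2 * coeffBound u / Real.sqrt (n + 1 : ℕ))
    (Eventually.of_forall fun n c => abs_classCoeff_entryCoeff_le u _ c)
    ((Real.tendsto_sqrt_atTop.comp hcast).const_div_atTop _) ?_
  rw [tendsto_iff_norm_sub_tendsto_zero]
  refine squeeze_zero' (Eventually.of_forall fun _ => norm_nonneg _) ?_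
    (hcast.const_div_atTop
      (∑ q : Quotient (linkSetoid f k), 2 * (|reCoeff u q| + |imCoeff u q|) ^ 2))
  filter_upwards [hr] with n hn
  rw [Real.norm_eq_abs, sum_classCoeff_sq fun i hi => classCoeff_offsetClass u _ hi]
  exact abs_sum_multiplicity_sub_limitVariance_le u (two_mul_natCast_mul_ne_zero _ hn)

end Convergence

/-! ### Convergence of the mean -/

section Average

theorem card_dvd_two_mul_le (n : ℕ) [NeZero n] :
    (Finset.univ.filter fun r : Fin n => n ∣ 2 * (r : ℕ)).card ≤ 2 := by
  refine le_trans (Finset.card_le_card_of_injOn (finEquivZMod n) (fun r hr => ?_)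
    (finEquivZMod n).injective.injOn) (card_eq_neg_le n)
  have h : n ∣ 2 * (r : ℕ) := (Finset.mem_filter.1 hr).2
  refine Finset.mem_filter.2 ⟨Finset.mem_univ _, ?_⟩
  rw [eq_neg_iff_add_eq_zero, ← two_mul]
  change 2 * ((r : ℕ) : ZMod n) = 0
  rw [← ZMod.natCast_eq_zero_iff] at h
  simpa using h

/-- Convergence along every admissible sequence is uniform convergence over admissible r: otherwise
choosing a bad r for infinitely many n gives a contradiction. The at most two excluded indices
contribute O(1/n). -/
theorem tendsto_average {J : ℕ → ℕ → ℝ} {l G : ℝ} (hJ : ∀ n r, |J n r - l| ≤ G)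
    (h : ∀ r : ℕ → ℕ, (∀ᶠ n in atTop, ¬ (n + 1) ∣ 2 * r n) →
      Tendsto (fun n => J n (r n)) atTop (𝓝 l)) :
    Tendsto (fun n => ((n + 1 : ℕ) : ℝ)⁻¹ * ∑ r : Fin (n + 1), J n r) atTop (𝓝 l) := by
  classical
  have hG : 0 ≤ G := (abs_nonneg _).trans (hJ 0 0)
  rw [Metric.tendsto_atTop']
  intro ε hε
  have hunif : ∀ᶠ n in atTop, ∀ r, ¬ (n + 1) ∣ 2 * r → |J n r - l| < ε / 2 := by
    by_contra hcon
    rw [not_eventually] at hcon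
    have hbad : ∃ᶠ n in atTop, ∃ r, ¬ (n + 1) ∣ 2 * r ∧ ε / 2 ≤ |J n r - l| := by
      refine hcon.mono fun n hn => ?_
      push Not at hn
      exact hn
    -- The default value 1 is admissible as soon as n + 1 ≥ 3.
    let r : ℕ → ℕ := fun n =>
      if h : ∃ r, ¬ (n + 1) ∣ 2 * r ∧ ε / 2 ≤ |J n r - l| then h.choose else 1
    have hr : ∀ᶠ n in atTop, ¬ (n + 1) ∣ 2 * r n := by
      filter_upwards [eventually_ge_atTop 2] with n hn
      by_cases hex : ∃ r, ¬ (n + 1) ∣ 2 * r ∧ ε / 2 ≤ |J n r - l|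
      · simp only [r, dif_pos hex]
        exact hex.choose_spec.1
      · simp only [r, dif_neg hex]
        intro hd
        have := Nat.le_of_dvd (by norm_num) hd
        omega
    have hev := (Metric.tendsto_nhds.1 (h r hr)) (ε / 2) (by positivity)
    obtain ⟨n, hex, hlt⟩ := (hbad.and_eventually hev).exists
    simp only [r, dif_pos hex, Real.dist_eq] at hlt
    exact absurd hlt (not_lt.2 hex.choose_spec.2)
  have hcast : Tendsto (fun n : ℕ => ((n + 1 : ℕ) : ℝ)) atTop atTop :=
    tendsto_natCast_atTop_atTop.comp (tendsto_add_atTop_nat 1)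
  have hsmall := (hcast.const_div_atTop (2 * G)).eventually_lt_const (half_pos hε)
  obtain ⟨n₀, hn₀⟩ := eventually_atTop.1 (hunif.and hsmall)
  refine ⟨n₀, fun n hn => ?_⟩
  obtain ⟨h1, h2⟩ := hn₀ n hn.le
  have hpos : (0 : ℝ) < ((n + 1 : ℕ) : ℝ) := by positivity
  have hle : ∀ r : Fin (n + 1), |J n r - l| ≤
      ε / 2 + if (n + 1) ∣ 2 * (r : ℕ) then G else 0 := by
    intro r
    split_ifs with hd
    · exact (hJ n r).trans (by linarith)
    · rw [add_zero]
      exact (h1 r hd).le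
  have hsum : |∑ r : Fin (n + 1), (J n r - l)| ≤ (n + 1 : ℕ) * (ε / 2) + 2 * G := by
    refine (Finset.abs_sum_le_sum_abs _ _).trans ((Finset.sum_le_sum fun r _ => hle r).trans ?_)
    rw [Finset.sum_add_distrib, Finset.sum_const, Finset.card_univ, Fintype.card_fin,
      nsmul_eq_mul, ← Finset.sum_filter, Finset.sum_const, nsmul_eq_mul]
    have : ((Finset.univ.filter fun r : Fin (n + 1) => (n + 1) ∣ 2 * (r : ℕ)).card : ℝ) ≤ 2 := by
      exact_mod_cast card_dvd_two_mul_le (n + 1)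
    gcongr
  have heq : ((n + 1 : ℕ) : ℝ)⁻¹ * ∑ r : Fin (n + 1), J n r - l =
      ((n + 1 : ℕ) : ℝ)⁻¹ * ∑ r : Fin (n + 1), (J n r - l) := by
    rw [Finset.sum_sub_distrib, Finset.sum_const, Finset.card_univ, Fintype.card_fin, nsmul_eq_mul]
    field_simp
  rw [Real.dist_eq, heq, abs_mul, abs_of_pos (inv_pos.2 hpos)]
  calc ((n + 1 : ℕ) : ℝ)⁻¹ * |∑ r : Fin (n + 1), (J n r - l)|
      ≤ ((n + 1 : ℕ) : ℝ)⁻¹ * ((n + 1 : ℕ) * (ε / 2) + 2 * G) := by gcongr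
    _ = ε / 2 + 2 * G / (n + 1 : ℕ) := by field_simp
    _ < ε := by linarith

end Average

section Mean

variable {k : ℕ} [NeZero k] {S : Type*} {f : ZMod k → ZMod k → S}
variable {μ : Measure ℝ} [IsProbabilityMeasure μ]

omit [NeZero k] in
theorem continuous_integral_empiricalSpectralMeasure_companionMatrix {g : ℝ → ℝ} {L : ℝ}
    (hL : 0 ≤ L) (hg : ∀ x y, |g y - g x| ≤ L * |y - x|) :
    Continuous fun v : CoordSpace f =>
      ∫ t, g t ∂(empiricalSpectralMeasure (companionMatrix f k (toCoord v))) :=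
  (continuousOn_integral_empiricalSpectralMeasure hL hg).comp_continuous
    (continuous_companionMatrix.comp continuous_toCoord)
    fun v => isHermitian_companionMatrix (toCoord v)

/-- Lévy's continuity theorem turns convergence of characteristic functions into weak convergence,
tested on a spectral statistic that is bounded and continuous in the coordinates. -/
theorem tendsto_integral_block (hmean : ∫ x, x ∂μ = 0) (hvar : ∫ x, x ^ 2 ∂μ = 1)
    {g : ℝ → ℝ} {L G : ℝ} (hL : 0 ≤ L) (hg : ∀ x y, |g y - g x| ≤ L * |y - x|)
    (hG : ∀ x, |g x| ≤ G) {r : ℕ → ℕ} (hr : ∀ᶠ n in atTop, ¬ (n + 1) ∣ 2 * r n) :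
    Tendsto (fun n => ∫ x : Quotient (linkSetoid f (k * (n + 1))) → ℝ,
        ∫ t, g t ∂(empiricalSpectralMeasure
          (companionMatrix f k (blockCoord f x ((r n : ℕ) : ZMod (k * (n + 1))))))
        ∂(Measure.pi fun _ => μ)) atTop
      (𝓝 (∫ ω : Quotient (linkSetoid f k) → ℝ × ℝ,
        ∫ t, g t ∂(empiricalSpectralMeasure (companionMatrix f k ω))
        ∂(Measure.pi fun _ => gaussianPair))) := by
  have hcont := continuous_integral_empiricalSpectralMeasure_companionMatrix (f := f) hL hg
  let H : BoundedContinuousFunction (CoordSpace f) ℝ :=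
    BoundedContinuousFunction.ofNormedAddCommGroup _ hcont G
      fun v => abs_integral_empiricalSpectralMeasure_le _ hG
  have hweak := ProbabilityMeasure.tendsto_of_tendsto_charFun
    (μ := fun n => ⟨blockLaw f μ (n + 1) ((r n : ℕ) : ZMod (k * (n + 1))), inferInstance⟩)
    (μ₀ := ⟨limitLaw f, inferInstance⟩)
    (fun u => tendsto_charFun_blockLaw hmean hvar hr u)
  have h := (ProbabilityMeasure.tendsto_iff_forall_integral_tendsto.1 hweak) H
  have hlim : ∫ v, H v ∂(limitLaw f) = ∫ ω : Quotient (linkSetoid f k) → ℝ × ℝ,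
        ∫ t, g t ∂(empiricalSpectralMeasure (companionMatrix f k ω))
        ∂(Measure.pi fun _ => gaussianPair) := by
    rw [limitLaw, integral_map measurable_ofCoord.aemeasurable
      H.continuous.measurable.aestronglyMeasurable]
    refine integral_congr_ae (Eventually.of_forall fun ω => ?_)
    change ∫ t, g t ∂(empiricalSpectralMeasure (companionMatrix f k (toCoord (ofCoord ω)))) = _
    rw [companionMatrix_toCoord_ofCoord]
  have hseq : ∀ n, ∫ v, H v ∂(blockLaw f μ (n + 1) ((r n : ℕ) : ZMod (k * (n + 1)))) =
      ∫ x : Quotient (linkSetoid f (k * (n + 1))) → ℝ,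
        ∫ t, g t ∂(empiricalSpectralMeasure
          (companionMatrix f k (blockCoord f x ((r n : ℕ) : ZMod (k * (n + 1))))))
        ∂(Measure.pi fun _ => μ) := by
    intro n
    have hmeas : Measurable fun x : Quotient (linkSetoid f (k * (n + 1))) → ℝ =>
        ofCoord (blockCoord f x ((r n : ℕ) : ZMod (k * (n + 1)))) :=
      measurable_ofCoord.comp (measurable_blockCoord (n + 1) _)
    rw [blockLaw, integral_map hmeas.aemeasurable H.continuous.measurable.aestronglyMeasurable]
    refine integral_congr_ae (Eventually.of_forall fun x => ?_)
    change ∫ t, g t ∂(empiricalSpectralMeasure (companionMatrix f k (toCoord (ofCoord _)))) = _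
    rw [companionMatrix_toCoord_ofCoord]
  rw [← hlim]
  exact h.congr hseq

/-- The mean of a spectral statistic converges to that of the companion ensemble. -/
theorem tendsto_integral_linkedLaw (hmean : ∫ x, x ∂μ = 0) (hvar : ∫ x, x ^ 2 ∂μ = 1)
    {g : ℝ → ℝ} {L G : ℝ} (hL : 0 ≤ L) (hg : ∀ x y, |g y - g x| ≤ L * |y - x|)
    (hG : ∀ x, |g x| ≤ G) :
    Tendsto (fun n => ∫ A, ∫ t, g t ∂(empiricalSpectralMeasure A)
        ∂(linkedLaw f (k * (n + 1)) μ)) atTop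
      (𝓝 (∫ A, ∫ t, g t ∂(empiricalSpectralMeasure A) ∂(companionLaw f k))) := by
  have hlim : ∫ A, ∫ t, g t ∂(empiricalSpectralMeasure A) ∂(companionLaw f k) =
      ∫ ω : Quotient (linkSetoid f k) → ℝ × ℝ,
        ∫ t, g t ∂(empiricalSpectralMeasure (companionMatrix f k ω))
        ∂(Measure.pi fun _ => gaussianPair) := by
    rw [companionLaw]
    exact integral_map continuous_companionMatrix.measurable.aemeasurable
      (measurable_integral_empiricalSpectralMeasure_of_lipschitz hL hg).aestronglyMeasurable
  have hblock : ∀ n r, Measurable fun x : Quotient (linkSetoid f (k * (n + 1))) → ℝ =>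
      ∫ t, g t ∂(empiricalSpectralMeasure
        (companionMatrix f k (blockCoord f x ((r : ℕ) : ZMod (k * (n + 1)))))) := fun n r =>
    (measurable_integral_empiricalSpectralMeasure_of_lipschitz hL hg).comp
      (continuous_companionMatrix.measurable.comp (measurable_blockCoord (n + 1) _))
  have hseq : ∀ n, ∫ A, ∫ t, g t ∂(empiricalSpectralMeasure A) ∂(linkedLaw f (k * (n + 1)) μ) =
      ((n + 1 : ℕ) : ℝ)⁻¹ * ∑ r : Fin (n + 1),
        ∫ x : Quotient (linkSetoid f (k * (n + 1))) → ℝ,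
        ∫ t, g t ∂(empiricalSpectralMeasure
          (companionMatrix f k (blockCoord f x (((r : ℕ) : ℕ) : ZMod (k * (n + 1))))))
        ∂(Measure.pi fun _ => μ) := by
    intro n
    have hlaw : linkedLaw f (k * (n + 1)) μ =
        (Measure.pi fun _ : Quotient (linkSetoid f (k * (n + 1))) => μ).map
          (classMatrix (linkSetoid f (k * (n + 1)))) := rfl
    rw [hlaw, integral_map measurable_classMatrix.aemeasurable
      (measurable_integral_empiricalSpectralMeasure_of_lipschitz hL hg).aestronglyMeasurable]
    simp only [integral_empiricalSpectralMeasure_classMatrix]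
    rw [integral_const_mul, integral_finsetSum]
    intro r _
    exact integrable_of_abs_le (hblock n r)
      fun x => abs_integral_empiricalSpectralMeasure_le _ hG
  rw [hlim]
  simp only [hseq]
  have hG0 : 0 ≤ G := (abs_nonneg _).trans (hG 0)
  have habs : ∀ {Ω : Type _} [MeasurableSpace Ω] (P : Measure Ω) [IsProbabilityMeasure P]
      (F : Ω → ℝ), (∀ x, |F x| ≤ G) → |∫ x, F x ∂P| ≤ G := by
    intro Ω _ P _ F hF
    have := norm_integral_le_of_norm_le_const (μ := P) (f := F) (Eventually.of_forall hF)
    simpa using this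
  refine tendsto_average (J := fun n r => ∫ x : Quotient (linkSetoid f (k * (n + 1))) → ℝ,
        ∫ t, g t ∂(empiricalSpectralMeasure
          (companionMatrix f k (blockCoord f x ((r : ℕ) : ZMod (k * (n + 1))))))
        ∂(Measure.pi fun _ => μ)) (G := G + G) (fun n r => ?_)
    fun r hr => tendsto_integral_block hmean hvar hL hg hG hr
  exact (abs_sub _ _).trans (add_le_add
    (habs _ _ fun x => abs_integral_empiricalSpectralMeasure_le _ hG)
    (habs _ _ fun x => abs_integral_empiricalSpectralMeasure_le _ hG))

theorem ae_tendsto_integral_of_isTestFunction (hmom : ∀ m : ℕ, Integrable (fun x : ℝ => x ^ m) μ)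
    (hmean : ∫ x, x ∂μ = 0) (hvar : ∫ x, x ^ 2 ∂μ = 1) {g : ℝ → ℝ} (hg : IsTestFunction g) :
    ∀ᵐ A ∂(Measure.infinitePi fun n : ℕ => linkedLaw f (k * (n + 1)) μ),
      Tendsto (fun n => ∫ t, g t ∂(empiricalSpectralMeasure (A n))) atTop
        (𝓝 (∫ A, ∫ t, g t ∂(empiricalSpectralMeasure A) ∂(companionLaw f k))) := by
  -- The constant 2k² dominates both the factor 2 for class sizes and the factor k² for the number
  -- of classes.
  obtain ⟨D, hD⟩ := exists_fourth_moment_bound (μ := μ) hmom hg (C := 2 * (k : ℝ) ^ 2)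
    (by positivity)
  obtain ⟨h, G, L, K, hL0, hK0, hG, hL, hlip, hquad⟩ := hg
  have hk1 : (1 : ℝ) ≤ (k : ℝ) ^ 2 :=
    one_le_pow₀ (by exact_mod_cast NeZero.pos k)
  refine ae_tendsto_of_summable_fourth_moment (fun n => linkedLaw f (k * (n + 1)) μ)
    (F := fun n A => ∫ t, g t ∂(empiricalSpectralMeasure A))
    (fun n => measurable_integral_empiricalSpectralMeasure_of_lipschitz hL0 hlip)
    (fun n A => abs_integral_empiricalSpectralMeasure_le A hG)
    (summable_div_mul_sqrt (NeZero.pos k) D) (fun n => ?_)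
    (tendsto_integral_linkedLaw hmean hvar hL0 hlip hG)
  refine hD (k * (n + 1)) (Nat.mul_pos (NeZero.pos k) n.succ_pos) (linkSetoid f (k * (n + 1)))
    linkSetoid_swap (fun c => ?_) ?_
  · have h1 : ({p | Quotient.mk (linkSetoid f (k * (n + 1))) p = c}.ncard : ℝ) ≤
        2 * (k * (n + 1) : ℕ) := by
      exact_mod_cast ncard_class_le (Dvd.intro (n + 1) rfl) c
    refine h1.trans ?_
    have : (0 : ℝ) ≤ (k * (n + 1) : ℕ) := Nat.cast_nonneg _
    nlinarith
  · have h1 : ((Nat.card (Quotient (linkSetoid f (k * (n + 1)))) : ℕ) : ℝ) ≤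
        (k : ℝ) ^ 2 * (k * (n + 1) : ℕ) := by
      exact_mod_cast card_classes_le (f := f) (Dvd.intro (n + 1) rfl : k ∣ k * (n + 1))
    refine h1.trans ?_
    have : (0 : ℝ) ≤ (k * (n + 1) : ℕ) := Nat.cast_nonneg _
    nlinarith

end Mean

/-! ### Weak convergence from countably many test functions -/

section Weak

/-- Smooth cutoffs increasing to one. -/
def cutoff (M : ℕ) : ContDiffBump (0 : ℝ) where
  rIn := M + 1
  rOut := M + 2
  rIn_pos := by positivity
  rIn_lt_rOut := by linarith

theorem isTestFunction_cutoff (M : ℕ) : IsTestFunction (cutoff M) :=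
  isTestFunction_of_hasCompactSupport (cutoff M).contDiff (cutoff M).hasCompactSupport

theorem integrable_cutoff (M : ℕ) (ν : Measure ℝ) [IsProbabilityMeasure ν] :
    Integrable (cutoff M) ν :=
  integrable_of_abs_le (cutoff M).continuous.measurable (C := 1) fun x => by
    rw [abs_of_nonneg (cutoff M).nonneg]
    exact (cutoff M).le_one

theorem tendsto_integral_cutoff (ν : Measure ℝ) [IsProbabilityMeasure ν] :
    Tendsto (fun M => ∫ x, cutoff M x ∂ν) atTop (𝓝 1) := by
  have h := tendsto_integral_of_dominated_convergence (μ := ν) (F := fun M x => cutoff M x)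
    (f := fun _ => (1 : ℝ)) (fun _ => 1)
    (fun M => (cutoff M).continuous.aestronglyMeasurable) (integrable_const _)
    (fun M => Eventually.of_forall fun x => by
      rw [Real.norm_of_nonneg (cutoff M).nonneg]
      exact (cutoff M).le_one)
    (Eventually.of_forall fun x => tendsto_const_nhds.congr' ?_)
  · simpa using h
  · filter_upwards [eventually_ge_atTop ⌈|x|⌉₊] with M hM
    refine ((cutoff M).one_of_mem_closedBall ?_).symm
    rw [mem_closedBall_zero_iff, Real.norm_eq_abs]
    have h1 : |x| ≤ M := (Nat.le_ceil _).trans (by exact_mod_cast hM)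
    change |x| ≤ (M : ℝ) + 1
    linarith

/-- The exponential is Lipschitz in the frequency where |x| < M + 2, and elsewhere the cutoff
vanishes and the trivial bound 2 applies. Measuring the tail by a test function makes the estimate
stable under the convergence assumed later. -/
theorem norm_charFun_sub_charFun_le (ν : Measure ℝ) [IsProbabilityMeasure ν] (M : ℕ) (s t : ℝ) :
    ‖charFun ν t - charFun ν s‖ ≤ |t - s| * (M + 2) + 2 * (1 - ∫ x, cutoff M x ∂ν) := by
  have hexp : ∀ t x : ℝ, ‖Complex.exp (t * x * Complex.I)‖ = 1 := fun t x => by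
    rw [← Complex.ofReal_mul, Complex.norm_exp_ofReal_mul_I]
  have hint : ∀ t : ℝ, Integrable (fun x : ℝ => Complex.exp (t * x * Complex.I)) ν := fun t => by
    refine Integrable.of_bound (C := 1) (by fun_prop) (Eventually.of_forall fun x => (hexp t x).le)
  rw [charFun_apply_real, charFun_apply_real, ← integral_sub (hint t) (hint s)]
  have hpt : ∀ x : ℝ, ‖Complex.exp (t * x * Complex.I) - Complex.exp (s * x * Complex.I)‖ ≤
      |t - s| * (M + 2) + 2 * (1 - cutoff M x) := by
    intro x
    have h0 : 0 ≤ cutoff M x := (cutoff M).nonneg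
    have h1 : cutoff M x ≤ 1 := (cutoff M).le_one
    by_cases hx : |x| < M + 2
    · have hfac : Complex.exp (t * x * Complex.I) - Complex.exp (s * x * Complex.I) =
          Complex.exp (s * x * Complex.I) *
            (Complex.exp (Complex.I * (((t - s) * x : ℝ) : ℂ)) - 1) := by
        rw [mul_sub, ← Complex.exp_add, mul_one]
        congr 2
        push_cast
        ring
      rw [hfac, norm_mul, hexp, one_mul]
      have hle := Real.norm_exp_I_mul_ofReal_sub_one_le (x := (t - s) * x)
      rw [Real.norm_eq_abs, abs_mul] at hle
      have : |t - s| * |x| ≤ |t - s| * (M + 2) := by gcongr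
      linarith
    · have hz : cutoff M x = 0 := (cutoff M).zero_of_le_dist (by
        rw [Real.dist_eq, sub_zero]
        exact not_lt.1 hx)
      rw [hz]
      have h2 := norm_sub_le (Complex.exp (t * x * Complex.I)) (Complex.exp (s * x * Complex.I))
      rw [hexp, hexp] at h2
      have : 0 ≤ |t - s| * ((M : ℝ) + 2) := by positivity
      linarith
  have hi := integrable_cutoff M ν
  have hi' : Integrable (fun x => 1 - cutoff M x) ν := (integrable_const 1).sub hi
  refine (norm_integral_le_of_norm_le (g := fun x => |t - s| * (M + 2) + 2 * (1 - cutoff M x))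
    ?_ (Eventually.of_forall hpt)).trans (le_of_eq ?_)
  · exact (integrable_const _).add (hi'.const_mul _)
  · rw [integral_add (integrable_const _) (hi'.const_mul _),
      integral_const_mul (2 : ℝ), integral_sub (integrable_const _) hi]
    simp

theorem charFun_eq_integral_cos_add_integral_sin (ν : Measure ℝ) [IsProbabilityMeasure ν] (t : ℝ) :
    charFun ν t = ((∫ x, Real.cos (t * x) ∂ν : ℝ) : ℂ) +
      ((∫ x, Real.sin (t * x) ∂ν : ℝ) : ℂ) * Complex.I := by
  have hc : Integrable (fun x => Real.cos (t * x)) ν :=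
    integrable_of_abs_le (by fun_prop) (C := 1) fun x => Real.abs_cos_le_one _
  have hs : Integrable (fun x => Real.sin (t * x)) ν :=
    integrable_of_abs_le (by fun_prop) (C := 1) fun x => Real.abs_sin_le_one _
  rw [charFun_apply_real, ← integral_complex_ofReal, ← integral_complex_ofReal,
    ← integral_mul_const, ← integral_add hc.ofReal (hs.ofReal.mul_const _)]
  refine integral_congr_ae (Eventually.of_forall fun x => ?_)
  change Complex.exp _ = ((Real.cos (t * x) : ℝ) : ℂ) + ((Real.sin (t * x) : ℝ) : ℂ) * Complex.I
  rw [Complex.exp_mul_I]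
  push_cast
  rfl

/-- Convergence of the cutoff integrals is tightness, which makes the characteristic functions
equicontinuous up to a small error; rational frequencies then suffice. -/
theorem tendsto_charFun_of_countable {ν : ℕ → Measure ℝ} [∀ n, IsProbabilityMeasure (ν n)]
    {ν₀ : Measure ℝ} [IsProbabilityMeasure ν₀]
    (hcos : ∀ q : ℚ, Tendsto (fun n => ∫ x, Real.cos (q * x) ∂(ν n)) atTop
      (𝓝 (∫ x, Real.cos (q * x) ∂ν₀)))
    (hsin : ∀ q : ℚ, Tendsto (fun n => ∫ x, Real.sin (q * x) ∂(ν n)) atTop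
      (𝓝 (∫ x, Real.sin (q * x) ∂ν₀)))
    (hcut : ∀ M : ℕ, Tendsto (fun n => ∫ x, cutoff M x ∂(ν n)) atTop (𝓝 (∫ x, cutoff M x ∂ν₀)))
    (t : ℝ) : Tendsto (fun n => charFun (ν n) t) atTop (𝓝 (charFun ν₀ t)) := by
  have hrat : ∀ q : ℚ, Tendsto (fun n => charFun (ν n) (q : ℝ)) atTop (𝓝 (charFun ν₀ (q : ℝ))) := by
    intro q
    simp only [charFun_eq_integral_cos_add_integral_sin]
    exact ((Complex.continuous_ofReal.tendsto _).comp (hcos q)).add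
      (((Complex.continuous_ofReal.tendsto _).comp (hsin q)).mul_const _)
  rw [Metric.tendsto_nhds]
  intro ε hε
  obtain ⟨M, hM⟩ := ((tendsto_integral_cutoff ν₀).eventually_const_lt
    (show 1 - ε / 10 < 1 by linarith)).exists
  have hM2 : (0 : ℝ) < (M : ℝ) + 2 := by positivity
  obtain ⟨q, hq1, hq2⟩ := exists_rat_btwn (show t < t + ε / (10 * (M + 2)) by
    have : 0 < ε / (10 * ((M : ℝ) + 2)) := by positivity
    linarith)
  have hq : |t - q| * ((M : ℝ) + 2) ≤ ε / 10 := by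
    have h1 : |t - q| ≤ ε / (10 * (M + 2)) := by
      rw [abs_le]
      constructor <;> linarith
    calc |t - q| * ((M : ℝ) + 2) ≤ ε / (10 * (M + 2)) * (M + 2) := by gcongr
      _ = ε / 10 := by field_simp
  -- Budget: each change of frequency costs at most 3ε/10 and the rational frequency costs ε/10.
  filter_upwards [(hcut M).eventually_const_lt hM,
    (Metric.tendsto_nhds.1 (hrat q)) (ε / 10) (by positivity)] with n h1 h2
  have ha := norm_charFun_sub_charFun_le (ν n) M q t
  have hb := norm_charFun_sub_charFun_le ν₀ M q t
  rw [dist_eq_norm] at h2 ⊢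
  have htri : ‖charFun (ν n) t - charFun ν₀ t‖ ≤ ‖charFun (ν n) t - charFun (ν n) (q : ℝ)‖ +
      ‖charFun (ν n) (q : ℝ) - charFun ν₀ (q : ℝ)‖ + ‖charFun ν₀ t - charFun ν₀ (q : ℝ)‖ := by
    have : charFun (ν n) t - charFun ν₀ t = (charFun (ν n) t - charFun (ν n) (q : ℝ)) +
      (charFun (ν n) (q : ℝ) - charFun ν₀ (q : ℝ)) - (charFun ν₀ t - charFun ν₀ (q : ℝ)) := by ring
    rw [this]
    exact (norm_sub_le _ _).trans (add_le_add (norm_add_le _ _) le_rfl)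
  linarith

theorem tendsto_integral_of_countable {ν : ℕ → Measure ℝ} [∀ n, IsProbabilityMeasure (ν n)]
    {ν₀ : Measure ℝ} [IsProbabilityMeasure ν₀]
    (hcos : ∀ q : ℚ, Tendsto (fun n => ∫ x, Real.cos (q * x) ∂(ν n)) atTop
      (𝓝 (∫ x, Real.cos (q * x) ∂ν₀)))
    (hsin : ∀ q : ℚ, Tendsto (fun n => ∫ x, Real.sin (q * x) ∂(ν n)) atTop
      (𝓝 (∫ x, Real.sin (q * x) ∂ν₀)))
    (hcut : ∀ M : ℕ, Tendsto (fun n => ∫ x, cutoff M x ∂(ν n)) atTop (𝓝 (∫ x, cutoff M x ∂ν₀)))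
    (g : BoundedContinuousFunction ℝ ℝ) :
    Tendsto (fun n => ∫ x, g x ∂(ν n)) atTop (𝓝 (∫ x, g x ∂ν₀)) := by
  have hweak := ProbabilityMeasure.tendsto_of_tendsto_charFun
    (μ := fun n => ⟨ν n, inferInstance⟩) (μ₀ := ⟨ν₀, inferInstance⟩)
    (tendsto_charFun_of_countable (ν := ν) (ν₀ := ν₀) hcos hsin hcut)
  exact (ProbabilityMeasure.tendsto_iff_forall_integral_tendsto.1 hweak) g

end Weak

/-! ### Almost sure weak convergence for linked ensembles -/

section Linked

variable {k : ℕ} [NeZero k] {S : Type*} {f : ZMod k → ZMod k → S}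
variable {μ : Measure ℝ} [IsProbabilityMeasure μ]

instance isProbabilityMeasure_companionLaw : IsProbabilityMeasure (companionLaw f k) := by
  rw [companionLaw]
  exact Measure.isProbabilityMeasure_map continuous_companionMatrix.measurable.aemeasurable

instance isProbabilityMeasure_eigenvalueDistribution_companionLaw :
    IsProbabilityMeasure (eigenvalueDistribution (companionLaw f k)) := by
  refine isProbabilityMeasure_eigenvalueDistribution (NeZero.pos k) _ ?_
  rw [companionLaw, ae_map_iff continuous_companionMatrix.measurable.aemeasurable
    measurableSet_isHermitian]
  exact Eventually.of_forall isHermitian_companionMatrix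

omit [NeZero k] [IsProbabilityMeasure μ] in
theorem ae_isHermitian_linkedLaw (f : ZMod k → ZMod k → S) (N : ℕ) :
    ∀ᵐ A ∂(linkedLaw f N μ), A.IsHermitian := by
  have hlaw : linkedLaw f N μ = (Measure.pi fun _ : Quotient (linkSetoid f N) => μ).map
      (classMatrix (linkSetoid f N)) := rfl
  rw [hlaw, ae_map_iff measurable_classMatrix.aemeasurable measurableSet_isHermitian]
  exact Eventually.of_forall (isHermitian_classMatrix linkSetoid_swap)

/-- Almost sure weak convergence of the empirical spectral measures of linked ensembles. -/
theorem ae_tendsto_linkedLaw (hmom : ∀ m : ℕ, Integrable (fun x : ℝ => x ^ m) μ)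
    (hmean : ∫ x, x ∂μ = 0) (hvar : ∫ x, x ^ 2 ∂μ = 1) (f : ZMod k → ZMod k → S) :
    ∀ᵐ A ∂(Measure.infinitePi fun n : ℕ => linkedLaw f (k * (n + 1)) μ),
      ∀ g : BoundedContinuousFunction ℝ ℝ,
        Tendsto (fun n : ℕ => ∫ x, g x ∂(empiricalSpectralMeasure (A n))) atTop
          (𝓝 (∫ x, g x ∂(eigenvalueDistribution (companionLaw f k)))) := by
  have hherm : ∀ᵐ A ∂(Measure.infinitePi fun n : ℕ => linkedLaw f (k * (n + 1)) μ),
      ∀ n, (A n).IsHermitian := by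
    rw [ae_all_iff]
    intro n
    exact (measurePreserving_eval_infinitePi (fun n : ℕ => linkedLaw f (k * (n + 1)) μ)
      n).quasiMeasurePreserving.ae (ae_isHermitian_linkedLaw f _)
  have htest : ∀ g : BoundedContinuousFunction ℝ ℝ, IsTestFunction g →
      ∀ᵐ A ∂(Measure.infinitePi fun n : ℕ => linkedLaw f (k * (n + 1)) μ),
        Tendsto (fun n => ∫ t, g t ∂(empiricalSpectralMeasure (A n))) atTop
          (𝓝 (∫ x, g x ∂(eigenvalueDistribution (companionLaw f k)))) := by
    intro g hg
    rw [integral_eigenvalueDistribution]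
    exact ae_tendsto_integral_of_isTestFunction hmom hmean hvar hg
  have hcos : ∀ q : ℚ, _ := fun q => htest (BoundedContinuousFunction.ofNormedAddCommGroup
    (fun x : ℝ => Real.cos (q * x)) (by fun_prop) 1 fun x => Real.abs_cos_le_one _)
    (isTestFunction_cos q)
  have hsin : ∀ q : ℚ, _ := fun q => htest (BoundedContinuousFunction.ofNormedAddCommGroup
    (fun x : ℝ => Real.sin (q * x)) (by fun_prop) 1 fun x => Real.abs_sin_le_one _)
    (isTestFunction_sin q)
  have hcut : ∀ M : ℕ, _ := fun M => htest (BoundedContinuousFunction.ofNormedAddCommGroup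
    (cutoff M) (cutoff M).continuous 1 fun x => by
      rw [Real.norm_of_nonneg (cutoff M).nonneg]
      exact (cutoff M).le_one) (isTestFunction_cutoff M)
  filter_upwards [hherm, ae_all_iff.2 hcos, ae_all_iff.2 hsin, ae_all_iff.2 hcut]
    with A hA h1 h2 h3 g
  have hprob : ∀ n, IsProbabilityMeasure (empiricalSpectralMeasure (A n)) := fun n =>
    isProbabilityMeasure_empiricalSpectralMeasure
      (Nat.mul_pos (NeZero.pos k) n.succ_pos) (hA n)
  exact tendsto_integral_of_countable h1 h2 h3 g

end Linked

/-! ### Block circulant ensembles and the GUE -/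

section BlockCirculant

variable {k N : ℕ}

theorem blockCirculantSetoid_natCast_mul [NeZero N] (a b : ZMod N) (m : ℕ) :
    blockCirculantSetoid k N (finOf a, finOf b)
      (finOf (a + (m : ZMod N) * k), finOf (b + (m : ZMod N) * k)) := by
  induction m with
  | zero =>
    simp only [Nat.cast_zero, zero_mul, add_zero]
    exact (blockCirculantSetoid k N).refl _
  | succ m ih =>
    refine (blockCirculantSetoid k N).trans ih (.rel _ _ (Or.inr ⟨?_, ?_⟩)) <;>
    · simp only [natCast_finOf]
      push_cast
      ring

/-- For the link function (a, b), linked positions have indices congruent modulo k and equal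
differences modulo N, so both indices differ by the same multiple of k. -/
theorem blockCirculantSetoid_eq_linkSetoid [NeZero N] (hkN : k ∣ N) :
    blockCirculantSetoid k N = linkSetoid (fun a b : ZMod k => (a, b)) N := by
  refine Setoid.ext fun p q => ⟨fun h => ?_, fun h => ?_⟩
  · induction h with
    | rel p q h =>
      rcases h with h | ⟨h1, h2⟩
      · exact .rel _ _ (Or.inl h)
      · refine .rel _ _ (Or.inr ⟨by rw [h1, h2]; ring, ?_⟩)
        have e1 := congrArg (red hkN) h1
        have e2 := congrArg (red hkN) h2
        simp only [map_add, map_natCast, ZMod.natCast_self, add_zero] at e1 e2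
        rw [e1, e2]
    | refl p => exact .refl _
    | symm p q _ ih => exact .symm _ _ ih
    | trans p q r _ _ ih1 ih2 => exact .trans _ _ _ ih1 ih2
  · induction h with
    | rel p q h =>
      rcases h with h | ⟨h1, h2⟩
      · exact .rel _ _ (Or.inl h)
      · simp only [Prod.mk.injEq] at h2
        obtain ⟨c, hc⟩ : (k : ℤ) ∣ ((q.1 : ℕ) : ℤ) - ((p.1 : ℕ) : ℤ) := by
          rw [← ZMod.intCast_zmod_eq_zero_iff_dvd]
          push_cast
          rw [h2.1, sub_self]
        have hc1 := congrArg (Int.cast : ℤ → ZMod N) hc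
        push_cast at hc1
        -- The number of shifts c may be negative; modulo N it is replaced by a natural number so
        -- that the shift can be iterated.
        have hm : ((((c : ZMod N)).val : ℕ) : ZMod N) = (c : ZMod N) := ZMod.natCast_zmod_val _
        have h := blockCirculantSetoid_natCast_mul (k := k) (((p.1 : ℕ) : ZMod N))
          (((p.2 : ℕ) : ZMod N)) ((c : ZMod N).val)
        rw [hm, show ((p.1 : ℕ) : ZMod N) + (c : ZMod N) * k = ((q.1 : ℕ) : ZMod N) by
          linear_combination -hc1, show ((p.2 : ℕ) : ZMod N) + (c : ZMod N) * k =
          ((q.2 : ℕ) : ZMod N) by linear_combination -hc1 - h1] at h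
        simp only [finOf_natCast] at h
        exact h
    | refl p => exact .refl _
    | symm p q _ ih => exact .symm _ _ ih
    | trans p q r _ _ ih1 ih2 => exact .trans _ _ _ ih1 ih2

end BlockCirculant

/-! ### The companion ensemble of the finest link function is the GUE -/

section GUE

theorem linked_pair_iff {k : ℕ} [NeZero k] {p q : Fin k × Fin k} :
    Linked (fun a b : ZMod k => (a, b)) k p q ↔ p = q := by
  constructor
  · rintro ⟨-, h⟩
    simp only [Prod.mk.injEq] at h
    exact Prod.ext (natCast_fin_injective h.1) (natCast_fin_injective h.2)
  · rintro rfl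
    exact ⟨rfl, rfl⟩

theorem sameEntry_pair_iff {k : ℕ} [NeZero k] {p q : Fin k × Fin k} :
    SameEntry (fun a b : ZMod k => (a, b)) k p q ↔ p = q := by
  constructor
  · intro h
    induction h with
    | rel p q h =>
      rcases h with h | h
      · exact linked_pair_iff.1 h
      · exact Prod.swap_injective (linked_pair_iff.1 h)
    | refl p => rfl
    | symm p q _ ih => exact ih.symm
    | trans p q r _ _ ih1 ih2 => exact ih1.trans ih2
  · rintro rfl
    exact .refl _

theorem isRealEntry_pair_iff {k : ℕ} [NeZero k] {p : Fin k × Fin k} :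
    IsRealEntry (fun a b : ZMod k => (a, b)) k p ↔ p.1 = p.2 := by
  rw [IsRealEntry, sameEntry_pair_iff]
  constructor
  · intro h
    exact congrArg Prod.fst h
  · intro h
    exact Prod.ext h h.symm

variable {k : ℕ} [NeZero k]

/-- The position on or above the diagonal in a class of positions. -/
def upperPos (q : Quotient (linkSetoid (fun a b : ZMod k => (a, b)) k)) : Fin k × Fin k :=
  if q.out.1 ≤ q.out.2 then q.out else q.out.swap

omit [NeZero k] in
theorem upperPos_injective : Function.Injective (upperPos (k := k)) := by
  intro q q' h
  have h1 : ∀ q : Quotient (linkSetoid (fun a b : ZMod k => (a, b)) k),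
      Quotient.mk _ (upperPos q) = q := by
    intro q
    unfold upperPos
    split_ifs
    · exact q.out_eq
    · rw [mk_swap, q.out_eq]
  rw [← h1 q, ← h1 q', h]

/-- Conjugation of the entry if its representative is below the diagonal. -/
def orient (q : Quotient (linkSetoid (fun a b : ZMod k => (a, b)) k)) (x : ℝ × ℝ) : ℝ × ℝ :=
  if q.out.1 ≤ q.out.2 then x else (x.1, -x.2)

omit [NeZero k] in
theorem measurePreserving_orient (q : Quotient (linkSetoid (fun a b : ZMod k => (a, b)) k)) :
    MeasurePreserving (orient q) gaussianPair gaussianPair := by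
  unfold orient
  by_cases hq : q.out.1 ≤ q.out.2
  · simp only [if_pos hq]
    exact MeasurePreserving.id _
  · simp only [if_neg hq]
    have hneg : MeasurePreserving (fun x : ℝ => -x) (gaussianReal 0 1) (gaussianReal 0 1) :=
      ⟨measurable_neg, by rw [gaussianReal_map_neg, neg_zero]⟩
    exact (MeasurePreserving.id (gaussianReal 0 1)).prod hneg

-- Distinct classes read distinct GUE pairs, so independence persists, and a standard Gaussian pair
-- is invariant under negating its second component.
omit [NeZero k] in
theorem map_orient_upperPos :
    (Measure.pi fun _ : Fin k × Fin k => gaussianPair).map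
      (fun ω (q : Quotient (linkSetoid (fun a b : ZMod k => (a, b)) k)) =>
        orient q (ω (upperPos q))) = Measure.pi fun _ => gaussianPair := by
  have hind : iIndepFun (fun (p : Fin k × Fin k) (ω : Fin k × Fin k → ℝ × ℝ) => ω p)
      (Measure.pi fun _ : Fin k × Fin k => gaussianPair) :=
    iIndepFun_pi (X := fun _ => id) fun _ => aemeasurable_id
  have hind' := (hind.precomp (upperPos_injective (k := k))).comp orient
    fun q => (measurePreserving_orient q).measurable
  have hmp : ∀ q : Quotient (linkSetoid (fun a b : ZMod k => (a, b)) k),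
      MeasurePreserving (fun ω : Fin k × Fin k → ℝ × ℝ => orient q (ω (upperPos q)))
        (Measure.pi fun _ : Fin k × Fin k => gaussianPair) gaussianPair := fun q =>
    (measurePreserving_orient q).comp
      (measurePreserving_eval (fun _ : Fin k × Fin k => gaussianPair) (upperPos q))
  have h := (iIndepFun_iff_map_fun_eq_pi_map fun q => (hmp q).measurable.aemeasurable).1 hind'
  refine h.trans ?_
  congr 1
  ext1 q
  exact (hmp q).map_eq

theorem toComplexGaussian_conj (x : ℝ × ℝ) :
    toComplexGaussian (x.1, -x.2) = star (toComplexGaussian x) := by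
  simp only [toComplexGaussian, RCLike.star_def, map_div₀, map_add, map_mul, Complex.conj_ofReal,
    Complex.conj_I, Complex.ofReal_neg]
  ring

theorem mk_out_eq_or (p : Fin k × Fin k) :
    (Quotient.mk (linkSetoid (fun a b : ZMod k => (a, b)) k) p).out = p ∨
      (Quotient.mk (linkSetoid (fun a b : ZMod k => (a, b)) k) p).out = p.swap := by
  rcases sameEntry_or_of_linkSetoid
    (linkSetoid_out (f := fun a b : ZMod k => (a, b)) p) with h | h
  · exact Or.inl (sameEntry_pair_iff.1 h).symm
  · right
    rw [sameEntry_pair_iff.1 h, Prod.swap_swap]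
    exact congrArg Quotient.out (congrArg (Quotient.mk _) (sameEntry_pair_iff.1 h)).symm

/-- The representative chosen by `Quotient.out` may lie below the diagonal; `orient` compensates by
a conjugation, so both matrices agree for every sample. -/
theorem companionMatrix_orient_upperPos (ω : Fin k × Fin k → ℝ × ℝ) :
    companionMatrix (fun a b : ZMod k => (a, b)) k (fun q => orient q (ω (upperPos q))) =
      gueMatrix k ω := by
  ext i j
  change companionMatrix (fun a b : ZMod k => (a, b)) k _ (i, j).1 (i, j).2 = _
  rcases lt_trichotomy i j with hij | rfl | hij
  · have hreal : ¬ IsRealEntry (fun a b : ZMod k => (a, b)) k (i, j) := fun h =>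
      hij.ne (isRealEntry_pair_iff.1 h)
    simp only [gueMatrix, Matrix.of_apply, if_neg hij.ne, if_pos hij]
    rcases mk_out_eq_or (i, j) with h | h
    · rw [companionMatrix_apply_of_sameEntry hreal (sameEntry_pair_iff.2 h.symm)]
      simp only [orient, upperPos, h, if_pos hij.le]
    · rw [companionMatrix_apply_of_not_sameEntry hreal fun h' => ?_]
      · simp only [orient, upperPos, h, Prod.fst_swap, Prod.snd_swap, if_neg (not_le.2 hij),
          Prod.swap_swap, toComplexGaussian_conj, star_star]
      · rw [sameEntry_pair_iff, h] at h'
        exact hij.ne (congrArg Prod.fst h')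
  · rw [companionMatrix_apply_of_real (isRealEntry_pair_iff.2 rfl)]
    have h : (Quotient.mk (linkSetoid (fun a b : ZMod k => (a, b)) k) (i, i)).out = (i, i) := by
      rcases mk_out_eq_or (i, i) with h | h
      · exact h
      · exact h
    simp [gueMatrix, orient, upperPos, h]
  · have hreal : ¬ IsRealEntry (fun a b : ZMod k => (a, b)) k (i, j) := fun h =>
      hij.ne' (isRealEntry_pair_iff.1 h)
    simp only [gueMatrix, Matrix.of_apply, if_neg hij.ne', if_neg hij.not_gt]
    rcases mk_out_eq_or (i, j) with h | h
    · rw [companionMatrix_apply_of_sameEntry hreal (sameEntry_pair_iff.2 h.symm)]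
      simp only [orient, upperPos, h, if_neg (not_le.2 hij), toComplexGaussian_conj,
        Prod.swap_prod_mk]
    · rw [companionMatrix_apply_of_not_sameEntry hreal fun h' => ?_]
      · simp only [orient, upperPos, h, if_pos hij.le, Prod.swap_prod_mk]
      · rw [sameEntry_pair_iff, h] at h'
        exact hij.ne' (congrArg Prod.fst h')

theorem companionLaw_pair_eq_gueLaw :
    companionLaw (fun a b : ZMod k => (a, b)) k = gueLaw k := by
  have hmeas : Measurable fun (ω : Fin k × Fin k → ℝ × ℝ)
      (q : Quotient (linkSetoid (fun a b : ZMod k => (a, b)) k)) => orient q (ω (upperPos q)) :=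
    measurable_pi_lambda _ fun q =>
      (measurePreserving_orient q).measurable.comp (measurable_pi_apply _)
  change (Measure.pi fun _ : Quotient (linkSetoid (fun a b : ZMod k => (a, b)) k) =>
    gaussianPair).map (companionMatrix (fun a b : ZMod k => (a, b)) k) = _
  rw [← map_orient_upperPos, Measure.map_map continuous_companionMatrix.measurable hmeas, gueLaw]
  congr 1
  ext1 ω
  exact companionMatrix_orient_upperPos ω

end GUE

end PeriodicEnsemble

end

open PeriodicEnsemble in
theorem theorem2 (k : ℕ) (hk : 0 < k)
    (μ : Measure ℝ) [IsProbabilityMeasure μ]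
    (hmom : ∀ m : ℕ, Integrable (fun x : ℝ => x ^ m) μ)
    (hmean : ∫ x, x ∂μ = 0) (hvar : ∫ x, x ^ 2 ∂μ = 1) :
    (∀ {S : Type*} (f : ZMod k → ZMod k → S),
      ∀ᵐ A ∂(Measure.infinitePi fun n : ℕ => linkedLaw f (k * (n + 1)) μ),
        ∀ g : BoundedContinuousFunction ℝ ℝ,
          Tendsto (fun n : ℕ => ∫ x, g x ∂(empiricalSpectralMeasure (A n))) atTop
            (𝓝 (∫ x, g x ∂(eigenvalueDistribution (companionLaw f k))))) ∧
    (∀ᵐ A ∂(Measure.infinitePi fun n : ℕ => blockCirculantLaw k (k * (n + 1)) μ),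
      ∀ g : BoundedContinuousFunction ℝ ℝ,
        Tendsto (fun n : ℕ => ∫ x, g x ∂(empiricalSpectralMeasure (A n))) atTop
          (𝓝 (∫ x, g x ∂(eigenvalueDistribution (gueLaw k))))) := by
  have : NeZero k := ⟨hk.ne'⟩
  refine ⟨fun f => ae_tendsto_linkedLaw hmom hmean hvar f, ?_⟩
  have hlaw : ∀ n : ℕ, blockCirculantLaw k (k * (n + 1)) μ =
      linkedLaw (fun a b : ZMod k => (a, b)) (k * (n + 1)) μ := fun n => by
    rw [blockCirculantLaw, linkedLaw, blockCirculantSetoid_eq_linkSetoid (Dvd.intro _ rfl)]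
  simp only [hlaw]
  rw [← companionLaw_pair_eq_gueLaw]
  exact ae_tendsto_linkedLaw hmom hmean hvar fun a b : ZMod k => (a, b)
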